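/- Let $d\ge 2$, $L\ge R>0$, $\mathcal D_L=[-L,L]^d$, and let $\Phi:[0,\infty)\to[0,\infty)$, $b:[-1,1]\to[0,\infty)$ be measurable with $\mathbf 1_{|v|\le R}\Phi(|v|)\in L^\infty(\mathcal D_L)$ and $\int_{\mathbb S^{d-1}}b(\sigma\cdot e)\,d\sigma<\infty$ for unit vectors $e$. Put $\tilde b(\cos\theta)=[b(\cos\theta)+b(\cos(\pi-\theta))]\mathbf 1_{0\le\theta\le\pi/2}$ and, with $\hat q=q/|q|$, $v'=v-\frac{q-|q|\sigma}{2}$, $v_*'=v-\frac{q+|q|\sigma}{2}$, $$Q^R(g,f)(v)=\int_{|q|\le R}\int_{\mathbb S^{d-1}}\Phi(|q|)\,\tilde b(\sigma\cdot\hat q)\,\bigl[g(v_*')f(v')-g(v-q)f(v)\bigr]\,d\sigma\,dq .$$ Functions of $v$ are real-valued and $2L$-periodic in each coordinate; $L^p$ and $H^1$ are the corresponding spaces on the torus, with $\|f\|_{L^p}^p=\int_{\mathcal D_L}|f|^p\,dv$ and $\|f\|_{H^1}^2=\|f\|_{L^2}^2+\sum_{i}\|\partial_{v_i}f\|_{L^2}^2$.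 For an integer $N\ge0$ let $\mathbb P_N=\mathrm{span}\{e^{i\frac{\pi}{L}k\cdot v}: k\in\mathbb Z^d,\ -N/2\le k_j\le N/2 \text{ for all } j\}$, and let $\mathcal P_N g=\sum_{-N/2\le k\le N/2}\hat g_k e^{i\frac{\pi}{L}k\cdot v}$, $\hat g_k=(2L)^{-d}\int_{\mathcal D_L}g\,e^{-i\frac{\pi}{L}k\cdot v}\,dv$. For $f_N^0\in\mathbb P_N$, a solution on $[0,T]$ of the Fourier--Galerkin system $$\partial_t f_N=\mathcal P_NQ^R(f_N,f_N),\qquad f_N(0,\cdot)=f_N^0, \qquad (*)$$ is a function $f_N(t,v)$ with $f_N(t,\cdot)\in L^1\cap H^1$ for all $t\in[0,T]$ that satisfies $(*)$ for every $v$ and every $t\in[0,T]$ (one-sided derivatives at the end points). **Theorem.** There is a constant $D_0>0$, depending only on $R,L,d$ and the kernel $(\Phi,b)$, with the following two properties. (1) If $N\ge0$, $t_0\ge0$, $f_N^0\in\mathbb P_N$, and $f_N$ is a solution of $(*)$ on $[0,t_0]$ with $\|f_N(t)\|_{L^1}\le M$ for all $t\in[0,t_0]$, then $\|f_N(t)\|_{L^2}\le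 e^{t_0D_0M}\|f_N^0\|_{L^2}$ for all $t\in[0,t_0]$. (2) Let $f^0\ge0$ be periodic and in $L^1\cap H^1$, let $T>0$, $C>1$, and let thresholds $N_c\in\mathbb N$ and $N_d(\varepsilon)\in\mathbb N$ ($\varepsilon>0$) be given. Then there is an integer $N_0$, depending on $T$, $f^0$ (and on $C$, $N_c$, $N_d$), such that the following holds for every family $(f_N^0)_{N\ge0}$ with $f_N^0\in\mathbb P_N$ and (a) $\int_{\mathcal D_L}f_N^0\,dv=\int_{\mathcal D_L}f^0\,dv$ for all $N$; (b) $\|f_N^0\|_{L^2}\le\|f^0\|_{L^2}$ and $\|f_N^0\|_{H^1}\le\|f^0\|_{H^1}$ for all $N$; (c) $\|f_N^0\|_{L^1}\le C\|f^0\|_{L^1}$ for all $N>N_c$; (d) for every $\varepsilon>0$, $\|\max(-f_N^0,0)\|_{L^2}<\varepsilon$ for all $N>N_d(\varepsilon)$. For all $N>N_0$ the system $(*)$ has a unique solution $f_N$ on $[0,T]$ with $f_N(t,\cdot)\in L^1\cap H^1$; moreover $f_N(t,\cdot)\in\mathbb P_N$, and for all $t\in[0,T]$ $$\|f_N(t)\|_{L^1}\le2\|f^0\|_{L^1},\qquad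 \|f_N(t)\|_{L^2}\le e^{2D_0\|f^0\|_{L^1}T}\,\|f^0\|_{L^2}.$$ -/

import Mathlib

open MeasureTheory Set

namespace FourierGalerkin

noncomputable section

/-- The velocity space `ℝ^d` with the Euclidean norm. -/
abbrev Vel (d : ℕ) : Type := EuclideanSpace ℝ (Fin d)

/-- The unit sphere `S^{d-1}`. -/
abbrev UnitSphere (d : ℕ) : Type := Metric.sphere (0 : Vel d) 1

/-- The surface measure on the unit sphere. -/
abbrev surfaceMeasure (d : ℕ) : Measure (UnitSphere d) :=
  (volume : Measure (Vel d)).toSphere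

/-- The cube `[-L, L]^d`, the fundamental domain of the torus. -/
def box (d : ℕ) (L : ℝ) : Set (Vel d) := {v | ∀ i, v i ∈ Icc (-L) L}

/-- Lebesgue measure on the cube `[-L, L]^d`. -/
abbrev boxMeasure (d : ℕ) (L : ℝ) : Measure (Vel d) := volume.restrict (box d L)

/-- `2L`-periodicity in each coordinate. -/
def IsPeriodic {d : ℕ} (L : ℝ) (f : Vel d → ℝ) : Prop :=
  ∀ (v : Vel d) (i : Fin d), f (v + EuclideanSpace.single i (2 * L)) = f v

/-! ### Sobolev space of periodic functions -/

/-- `g` is the weak `i`-th partial derivative of `f` on `ℝ^d`. For a periodic `f` this is the weak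
derivative on the torus. -/
def HasWeakPartial {d : ℕ} (i : Fin d) (f g : Vel d → ℝ) : Prop :=
  LocallyIntegrable f ∧ LocallyIntegrable g ∧
    ∀ φ : Vel d → ℝ, ContDiff ℝ (⊤ : ℕ∞) φ → HasCompactSupport φ →
      ∫ v, f v * fderiv ℝ φ v (EuclideanSpace.single i 1) = - ∫ v, g v * φ v

open Classical in
/-- A choice of the weak `i`-th partial derivative (unique almost everywhere), zero if there is
none. -/
def weakPartial {d : ℕ} (i : Fin d) (f : Vel d → ℝ) : Vel d → ℝ :=
  if h : ∃ g, HasWeakPartial i f g then h.choose else 0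

/-- `f` is periodic and belongs to `H^1` of the torus. -/
def MemH1Per {d : ℕ} (L : ℝ) (f : Vel d → ℝ) : Prop :=
  IsPeriodic L f ∧ MemLp f 2 (boxMeasure d L) ∧
    ∀ i, ∃ g, HasWeakPartial i f g ∧ MemLp g 2 (boxMeasure d L)

/-- The norm `(‖f‖²_{L²} + ∑ᵢ ‖∂ᵢ f‖²_{L²})^{1/2}` of `H^1` of the torus. -/
def normH1 {d : ℕ} (L : ℝ) (f : Vel d → ℝ) : ℝ :=
  Real.sqrt (lpNorm f 2 (boxMeasure d L) ^ 2 +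
    ∑ i, lpNorm (weakPartial i f) 2 (boxMeasure d L) ^ 2)

/-! ### Truncated collision operator -/

/-- The symmetrized angular kernel
`[b(cos θ) + b(cos (π - θ))] 1_{0 ≤ θ ≤ π/2}` as a function of `x = cos θ`. -/
def symmKernel (b : ℝ → ℝ) (x : ℝ) : ℝ := if 0 ≤ x then b x + b (-x) else 0

/-- The truncated collision operator `Q^R(g, f)` with kinetic kernel `Φ` and symmetrized angular
kernel; here `q̂ = q / |q|`, `v' = v - (q - |q| σ) / 2` and `v_*' = v - (q + |q| σ) / 2`. -/
def collision {d : ℕ} (R : ℝ) (Φ b : ℝ → ℝ) (g f : Vel d → ℝ) (v : Vel d) : ℝ :=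
  ∫ q in Metric.closedBall (0 : Vel d) R, ∫ σ : UnitSphere d,
    Φ ‖q‖ * symmKernel b (inner ℝ (σ : Vel d) (‖q‖⁻¹ • q)) *
      (g (v - (2⁻¹ : ℝ) • (q + ‖q‖ • (σ : Vel d))) * f (v - (2⁻¹ : ℝ) • (q - ‖q‖ • (σ : Vel d)))
        - g (v - q) * f v) ∂(surfaceMeasure d)

/-- The assumptions on truncation parameters and collision kernel. -/
structure KernelAssumptions (d : ℕ) (L R : ℝ) (Φ b : ℝ → ℝ) : Prop where
  R_pos : 0 < R
  R_le_L : R ≤ L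
  Φ_meas : Measurable Φ
  Φ_nonneg : ∀ r, 0 ≤ r → 0 ≤ Φ r
  Φ_bdd : MemLp ((Metric.closedBall (0 : Vel d) R).indicator fun v => Φ ‖v‖) ⊤ (boxMeasure d L)
  b_meas : Measurable b
  b_nonneg : ∀ x ∈ Icc (-1 : ℝ) 1, 0 ≤ b x
  cutoff : ∀ e : UnitSphere d,
    Integrable (fun σ : UnitSphere d => b (inner ℝ (σ : Vel d) (e : Vel d))) (surfaceMeasure d)

/-! ### Fourier projection -/

/-- The Fourier mode `e^{i (π/L) k·v}`. -/
def fourierMode {d : ℕ} (L : ℝ) (k : Fin d → ℤ) (v : Vel d) : ℂ :=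
  Complex.exp (Complex.I * ((Real.pi / L * ∑ j, (k j : ℝ) * v j : ℝ) : ℂ))

/-- The multi-indices `k ∈ ℤ^d` with `-N/2 ≤ k_j ≤ N/2` for all `j`; the integer division rounds
`N/2` down, which does not change the set of integers `k_j`. -/
def modes (d N : ℕ) : Finset (Fin d → ℤ) :=
  Fintype.piFinset fun _ => Finset.Icc (-((N : ℤ) / 2)) ((N : ℤ) / 2)

/-- The Fourier coefficient `ĝ_k = (2L)^{-d} ∫_{[-L,L]^d} g conj(e_k) dv`. -/
def coeff {d : ℕ} (L : ℝ) (g : Vel d → ℂ) (k : Fin d → ℤ) : ℂ :=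
  ((2 * L : ℝ) ^ d : ℂ)⁻¹ * ∫ v in box d L, g v * (starRingEnd ℂ) (fourierMode L k v)

/-- The projection `P_N g = ∑_{-N/2 ≤ k ≤ N/2} ĝ_k e_k`. -/
def proj {d : ℕ} (L : ℝ) (N : ℕ) (g : Vel d → ℂ) (v : Vel d) : ℂ :=
  ∑ k ∈ modes d N, coeff L g k * fourierMode L k v

/-- The real-valued function `f` belongs to `ℙ_N = span {e_k : -N/2 ≤ k ≤ N/2}`. -/
def MemTrigPoly {d : ℕ} (L : ℝ) (N : ℕ) (f : Vel d → ℝ) : Prop :=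
  (fun v => (f v : ℂ)) ∈ Submodule.span ℂ (fourierMode L '' (modes d N : Set (Fin d → ℤ)))

/-- `f = f(t, v)` solves `∂_t f = P_N Q^R(f, f)`, `f(0, ·) = f₀` on `[0, T]`, with values in
`L^1 ∩ H^1` of the torus. -/
structure IsSolution {d : ℕ} (L R : ℝ) (Φ b : ℝ → ℝ) (N : ℕ) (f₀ : Vel d → ℝ) (T : ℝ)
    (f : ℝ → Vel d → ℝ) : Prop where
  memL1 : ∀ t ∈ Icc 0 T, MemLp (f t) 1 (boxMeasure d L)
  memH1 : ∀ t ∈ Icc 0 T, MemH1Per L (f t)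
  init : f 0 = f₀
  eqn : ∀ t ∈ Icc 0 T, ∀ v, HasDerivWithinAt (fun s => (f s v : ℂ))
    (proj L N (fun w => (collision R Φ b (f t) (f t) w : ℂ)) v) (Icc 0 T) t

/-- The conditions on the family `(f_N^0)_N` of numerical initial data relative to `f^0`, where the
thresholds "there is `N_0` such that for all `N > N_0`" are `Nc` in the `L^1` bound and `Nd ε` in
the smallness of the negative part. -/
structure AdmissibleData {d : ℕ} (L : ℝ) (f0 : Vel d → ℝ) (C : ℝ) (Nc : ℕ) (Nd : ℝ → ℕ)
    (fN0 : ℕ → Vel d → ℝ) : Prop where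
  trig : ∀ N, MemTrigPoly L N (fN0 N)
  mass : ∀ N, ∫ v in box d L, fN0 N v = ∫ v in box d L, f0 v
  normL2_le : ∀ N, lpNorm (fN0 N) 2 (boxMeasure d L) ≤ lpNorm f0 2 (boxMeasure d L)
  normH1_le : ∀ N, normH1 L (fN0 N) ≤ normH1 L f0
  normL1_le : ∀ N, Nc < N →
    lpNorm (fN0 N) 1 (boxMeasure d L) ≤ C * lpNorm f0 1 (boxMeasure d L)
  neg_small : ∀ ε, 0 < ε → ∀ N, Nd ε < N →
    lpNorm (fun v => max (-fN0 N v) 0) 2 (boxMeasure d L) < ε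

/-- `D₀` is a constant for the a priori bound: a solution with `‖f(t)‖_{L^1} ≤ M` on `[0, t₀]`
satisfies `‖f(t)‖_{L^2} ≤ e^{t₀ D₀ M} ‖f(0)‖_{L^2}` there, for every `N`, `t₀`, `M` and every
initial value in `ℙ_N`. -/
def IsL2GrowthConstant (d : ℕ) (L R : ℝ) (Φ b : ℝ → ℝ) (D₀ : ℝ) : Prop :=
  ∀ (N : ℕ) (t₀ M : ℝ) (g : Vel d → ℝ) (f : ℝ → Vel d → ℝ), 0 ≤ t₀ → MemTrigPoly L N g →
    IsSolution L R Φ b N g t₀ f →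
    (∀ t ∈ Icc 0 t₀, lpNorm (f t) 1 (boxMeasure d L) ≤ M) →
    ∀ t ∈ Icc 0 t₀, lpNorm (f t) 2 (boxMeasure d L) ≤
      Real.exp (t₀ * D₀ * M) * lpNorm g 2 (boxMeasure d L)

end

end FourierGalerkin

/-!
The system is an ordinary differential equation for finitely many Fourier coefficients with a
quadratic right-hand side, so that everything rests on a priori bounds that do not depend on the
cut-off `N`.

*The quadratic estimate.* Let `κ` be the measure `1_{|q| ≤ R} Φ(|q|) b̃(σ·q̂) dσ dq`
(`collisionMeasure`). It is invariant under simultaneous rotations of `q` and `σ`. Averaging a test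
function over the orthogonal group therefore shows that `q` and `|q| σ` have the same distribution
under `κ`, and that the distributions of `q`, `|q| σ` and `(q + |q| σ) / 2` have bounded densities
(`exists_isDensityBound`). For the last one this uses that `b̃` lives on angles of at most `π/2`,
where `|q̂ + σ| / 2 ≥ 1/2`; for larger angles `v_*'` could collapse onto `v`. Cauchy–Schwarz with
weight `|g(v_*')|` and a translation of the torus then give `‖Q(g, f)‖₂ ≤ 2C ‖g‖₁ ‖f‖₂`
(`lpNorm_collision_le`). The projection does not increase the `L²` norm, and Gronwall's inequality
yields the first assertion with `D₀ = 2C` (`IsTraj.lpNorm_two_le`).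

*The bootstrap.* The mass is conserved, since `Q(f, f)` has integral zero, and
`‖f‖₁ = ∫ f + 2 ‖f⁻‖₁`. Hence `‖f‖₁ ≤ 2 ‖f⁰‖₁` as long as the negative part stays small. While
this bound holds, the `L²` norm and, by the Leibniz rule for `Q`, the derivatives grow at most
exponentially at rates independent of `N`. So the error of the projection of `Q(f, f)` is `O(1/N)`
in `L²` (`IsTrig.lpNorm_sub_rproj_le`). The negative part is fed only by this error, by the loss
term and by the part of the gain term in which exactly one factor is negative; the latter two are
linear in `‖f⁻‖₂`. Gronwall's inequality for `‖f⁻‖₂` (`IsTraj.lpNorm_negPart_le`) keeps it small on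
`[0, T]` when `N` is large, which improves the bound to a strict one (`exists_apriori`).

*Existence and uniqueness.* The vector field cut off outside a large ball is globally Lipschitz and
has solutions on `[0, T]`; by the bootstrap the cut-off never becomes active
(`exists_traj_of_apriori`). A solution in the sense of the statement is pointwise in `v`. Since the
right-hand side is a trigonometric polynomial, so is the solution, and evaluation at finitely many
points turns the pointwise equation into one for the coefficients (`IsSolution.isTraj`), where
uniqueness for Lipschitz equations applies (`IsTraj.unique`).
-/

namespace FourierGalerkin

open scoped ENNReal Pointwise ComplexConjugate

/-! ### Averaging over rotations -/

/-- Every function on `ℝ^d` has a radial average that has the same integral against all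
rotation-invariant measures: the average over Haar measure of the orthogonal group. -/
theorem exists_radial_average {d : ℕ} (H : Vel d → ℝ≥0∞) (hH : Measurable H) :
    ∃ K : Vel d → ℝ≥0∞, Measurable K ∧ (∀ z z', ‖z‖ = ‖z'‖ → K z = K z') ∧
      ∀ ν : Measure (Vel d), SFinite ν → (∀ A : Vel d ≃ₗᵢ[ℝ] Vel d, ν.map A = ν) →
        ∫⁻ z, H z ∂ν = ∫⁻ z, K z ∂ν := by
  let U := unitary (Vel d →L[ℝ] Vel d)
  have : IsTopologicalGroup U :=
    { continuous_inv := by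
        refine continuous_induced_rng.2 ?_
        exact (ContinuousLinearMap.adjoint (𝕜 := ℝ) (E := Vel d) (F := Vel d)).continuous.comp
          continuous_subtype_val }
  have : CompactSpace U := by
    refine isCompact_iff_compactSpace.1 (Metric.isCompact_of_isClosed_isBounded ?_ ?_)
    · have h1 : Continuous fun A : Vel d →L[ℝ] Vel d => star A :=
        (ContinuousLinearMap.adjoint (𝕜 := ℝ) (E := Vel d) (F := Vel d)).continuous
      have h2 : ((U : Set (Vel d →L[ℝ] Vel d))) =
          {A | star A * A = 1} ∩ {A | A * star A = 1} := by
        ext A; exact Unitary.mem_iff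
      rw [h2]
      exact (isClosed_eq (h1.mul continuous_id) continuous_const).inter
        (isClosed_eq (continuous_id.mul h1) continuous_const)
    · refine (Metric.isBounded_closedBall (x := (0 : Vel d →L[ℝ] Vel d)) (r := 1)).subset ?_
      intro A hA
      rw [mem_closedBall_zero_iff]
      refine ContinuousLinearMap.opNorm_le_bound _ zero_le_one fun x => ?_
      have := (Unitary.linearIsometryEquiv (⟨A, hA⟩ : U)).norm_map x
      rw [one_mul]
      exact this.le
  let _ : MeasurableSpace U := borel U
  have : BorelSpace U := ⟨rfl⟩
  let m : Measure U := (Measure.haar (univ : Set U))⁻¹ • Measure.haar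
  have hm : IsProbabilityMeasure m := by
    refine ⟨?_⟩
    simp only [m, Measure.smul_apply, smul_eq_mul]
    refine ENNReal.inv_mul_cancel ?_ (measure_ne_top _ _)
    exact (isOpen_univ.measure_pos _ univ_nonempty).ne'
  have hinv : m.IsMulLeftInvariant := by
    simp only [m]; infer_instance
  let ρ : U → Vel d → Vel d := fun A z => ((A⁻¹ : U) : Vel d →L[ℝ] Vel d) z
  have hρ : Measurable fun p : Vel d × U => ρ p.2 p.1 := by
    have : Continuous fun p : Vel d × U => ρ p.2 p.1 := by
      have h1 : Continuous fun p : Vel d × U => ((p.2⁻¹ : U) : Vel d →L[ℝ] Vel d) :=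
        continuous_subtype_val.comp continuous_snd.inv
      exact h1.clm_apply continuous_fst
    exact this.measurable
  refine ⟨fun z => ∫⁻ A, H (ρ A z) ∂m, (hH.comp hρ).lintegral_prod_right', ?_, ?_⟩
  · intro z z' hz
    obtain ⟨B, hB⟩ : ∃ B : Vel d ≃ₗᵢ[ℝ] Vel d, B z = z' :=
      ⟨_, Submodule.reflection_sub hz⟩
    let b : U := Unitary.linearIsometryEquiv.symm B
    have hb : ∀ x, (b : Vel d →L[ℝ] Vel d) x = B x := fun x => rfl
    have := lintegral_mul_left_eq_self (μ := m) (fun A => H (ρ A z)) b⁻¹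
    dsimp only
    rw [← this]
    refine lintegral_congr fun A => ?_
    congr 1
    have h2 : (b⁻¹ * A)⁻¹ = A⁻¹ * b := by rw [mul_inv_rev, inv_inv]
    simp only [ρ]
    rw [← hB, ← hb, h2]
    rfl
  · intro ν hν hA
    have h1 : ∀ A : U, ∫⁻ z, H (ρ A z) ∂ν = ∫⁻ z, H z ∂ν := by
      intro A
      conv_rhs => rw [← hA (Unitary.linearIsometryEquiv A⁻¹)]
      rw [lintegral_map hH (LinearIsometryEquiv.continuous _).measurable]
      rfl
    rw [lintegral_lintegral_swap (f := fun z A => H (ρ A z)) (hH.comp hρ).aemeasurable]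
    simp [h1]

/-- Surface measure on the sphere is rotation-invariant. -/
theorem measurePreserving_sphere_of_isometry {d : ℕ} (A : Vel d ≃ₗᵢ[ℝ] Vel d)
    (T : UnitSphere d → UnitSphere d) (hT : ∀ s, (T s : Vel d) = A s) :
    MeasurePreserving T (surfaceMeasure d) (surfaceMeasure d) := by
  have hTm : Measurable T := by
    refine (continuous_induced_rng.2 ?_).measurable
    have : (Subtype.val ∘ T) = fun s : UnitSphere d => A s := funext hT
    rw [this]
    exact A.continuous.comp continuous_subtype_val
  refine ⟨hTm, ?_⟩
  ext s hs
  rw [Measure.map_apply hTm hs, Measure.toSphere_apply' _ (hTm hs), Measure.toSphere_apply' _ hs]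
  congr 1
  have h2 : Ioo (0 : ℝ) 1 • ((↑) '' (T ⁻¹' s) : Set (Vel d)) =
      A ⁻¹' (Ioo (0 : ℝ) 1 • ((↑) '' s : Set (Vel d))) := by
    ext x
    simp only [mem_smul, mem_image, mem_preimage]
    constructor
    · rintro ⟨r, hr, y, ⟨σ, hσ, rfl⟩, rfl⟩
      exact ⟨r, hr, A σ, ⟨T σ, hσ, hT σ⟩, by simp⟩
    · rintro ⟨r, hr, y, ⟨σ, hσ, rfl⟩, h⟩
      refine ⟨r, hr, A.symm σ, ⟨⟨A.symm σ, by simp⟩, ?_, rfl⟩, ?_⟩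
      · have : T ⟨A.symm σ, by simp⟩ = σ := Subtype.ext (by rw [hT]; simp)
        rw [this]; exact hσ
      · apply A.injective; simp [← h]
  rw [h2]
  exact A.measurePreserving.measure_preimage_equiv (f := A.toMeasurableEquiv) _

/-! ### The collision measure -/

/-- The kernel `Φ(|q|) b̃(σ·q̂)` as a function of `(q, σ)`. -/
noncomputable def kernelFun {d : ℕ} (Φ b : ℝ → ℝ) (p : Vel d × UnitSphere d) : ℝ :=
  Φ ‖p.1‖ * symmKernel b (inner ℝ (p.2 : Vel d) (‖p.1‖⁻¹ • p.1))

/-- The measure `1_{|q| ≤ R} Φ(|q|) b̃(σ·q̂) dσ dq`. It turns the collision operator into a single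
integral. -/
noncomputable def collisionMeasure (d : ℕ) (R : ℝ) (Φ b : ℝ → ℝ) :
    Measure (Vel d × UnitSphere d) :=
  ((volume.restrict (Metric.closedBall (0 : Vel d) R)).prod (surfaceMeasure d)).withDensity
    fun p => ENNReal.ofReal (kernelFun Φ b p)

/-- The velocities `α q + β |q| σ` in terms of which the collision operator is written. -/
noncomputable def velMap {d : ℕ} (α β : ℝ) (p : Vel d × UnitSphere d) : Vel d :=
  α • p.1 + (β * ‖p.1‖) • (p.2 : Vel d)

theorem continuous_velMap {d : ℕ} (α β : ℝ) : Continuous (velMap (d := d) α β) := by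
  unfold velMap; fun_prop

theorem measurable_symmKernel {b : ℝ → ℝ} (hb : Measurable b) : Measurable (symmKernel b) := by
  unfold symmKernel
  exact Measurable.ite measurableSet_Ici (hb.add (hb.comp measurable_neg)) measurable_const

theorem symmKernel_nonneg {b : ℝ → ℝ} (hb : ∀ x ∈ Icc (-1 : ℝ) 1, 0 ≤ b x) {x : ℝ} (hx : |x| ≤ 1) :
    0 ≤ symmKernel b x := by
  unfold symmKernel
  obtain ⟨h1, h2⟩ := abs_le.1 hx
  split_ifs
  · exact add_nonneg (hb _ ⟨h1, h2⟩) (hb _ ⟨by linarith, by linarith⟩)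
  · exact le_rfl

theorem abs_inner_normalize_le {d : ℕ} (p : Vel d × UnitSphere d) :
    |inner ℝ (p.2 : Vel d) (‖p.1‖⁻¹ • p.1)| ≤ 1 := by
  refine (abs_real_inner_le_norm _ _).trans ?_
  rw [norm_smul, norm_inv, norm_norm]
  have h : ‖(p.2 : Vel d)‖ = 1 := by simp
  rw [h, one_mul]
  exact inv_mul_le_one

theorem measurable_kernelFun {d : ℕ} {Φ b : ℝ → ℝ} (hΦ : Measurable Φ) (hb : Measurable b) :
    Measurable (kernelFun (d := d) Φ b) := by
  unfold kernelFun
  refine (hΦ.comp measurable_fst.norm).mul ((measurable_symmKernel hb).comp ?_)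
  have h1 : Measurable fun p : Vel d × UnitSphere d => (p.2 : Vel d) :=
    measurable_subtype_coe.comp measurable_snd
  have h2 : Measurable fun p : Vel d × UnitSphere d => ‖p.1‖⁻¹ • p.1 :=
    measurable_fst.norm.inv.smul measurable_fst
  exact h1.inner h2

theorem kernelFun_nonneg {d : ℕ} {L R : ℝ} {Φ b : ℝ → ℝ} (hB : KernelAssumptions d L R Φ b)
    (p : Vel d × UnitSphere d) : 0 ≤ kernelFun Φ b p :=
  mul_nonneg (hB.Φ_nonneg _ (norm_nonneg _))
    (symmKernel_nonneg hB.b_nonneg (abs_inner_normalize_le p))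

theorem lintegral_collisionMeasure {d : ℕ} {L R : ℝ} {Φ b : ℝ → ℝ}
    (hB : KernelAssumptions d L R Φ b) {F : Vel d × UnitSphere d → ℝ≥0∞} (hF : Measurable F) :
    ∫⁻ p, F p ∂(collisionMeasure d R Φ b) =
      ∫⁻ q in Metric.closedBall (0 : Vel d) R, ∫⁻ σ, ENNReal.ofReal (Φ ‖q‖) *
        (ENNReal.ofReal (symmKernel b (inner ℝ (σ : Vel d) (‖q‖⁻¹ • q))) * F (q, σ))
          ∂(surfaceMeasure d) := by
  have hk := (measurable_kernelFun (d := d) hB.Φ_meas hB.b_meas).ennreal_ofReal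
  rw [collisionMeasure, lintegral_withDensity_eq_lintegral_mul _ hk hF,
    lintegral_prod _ (hk.mul hF).aemeasurable]
  refine lintegral_congr fun q => lintegral_congr fun σ => ?_
  rw [Pi.mul_apply, kernelFun, ENNReal.ofReal_mul (hB.Φ_nonneg _ (norm_nonneg _)), mul_assoc]

/-- The rotation of the sphere induced by a linear isometry. -/
noncomputable def rotateSphere {d : ℕ} (A : Vel d ≃ₗᵢ[ℝ] Vel d) (s : UnitSphere d) : UnitSphere d :=
  ⟨A s, by simp⟩

theorem measurePreserving_rotateSphere {d : ℕ} (A : Vel d ≃ₗᵢ[ℝ] Vel d) :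
    MeasurePreserving (rotateSphere A) (surfaceMeasure d) (surfaceMeasure d) :=
  measurePreserving_sphere_of_isometry A _ fun _ => rfl

theorem measurePreserving_restrict_closedBall {d : ℕ} (R : ℝ) (A : Vel d ≃ₗᵢ[ℝ] Vel d) :
    MeasurePreserving A (volume.restrict (Metric.closedBall (0 : Vel d) R))
      (volume.restrict (Metric.closedBall (0 : Vel d) R)) := by
  have h := A.measurePreserving.restrict_preimage
    (Metric.isClosed_closedBall (x := (0 : Vel d)) (ε := R)).measurableSet
  have h2 : A ⁻¹' Metric.closedBall (0 : Vel d) R = Metric.closedBall (0 : Vel d) R := by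
    ext x; simp
  rwa [h2] at h

instance {d : ℕ} {R : ℝ} {Φ b : ℝ → ℝ} : SFinite (collisionMeasure d R Φ b) := by
  have : SFinite ((volume.restrict (Metric.closedBall (0 : Vel d) R)).prod (surfaceMeasure d)) :=
    Measure.prod.instSFinite
  unfold collisionMeasure; infer_instance

/-- The distribution of `α q + β |q| σ` under the collision measure is rotation-invariant. -/
theorem map_velMap_rotation {d : ℕ} {L R : ℝ} {Φ b : ℝ → ℝ} (hB : KernelAssumptions d L R Φ b)
    (α β : ℝ) (A : Vel d ≃ₗᵢ[ℝ] Vel d) :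
    ((collisionMeasure d R Φ b).map (velMap α β)).map A =
      (collisionMeasure d R Φ b).map (velMap α β) := by
  let T : Vel d × UnitSphere d → Vel d × UnitSphere d := Prod.map A (rotateSphere A)
  have hT : MeasurePreserving T
      ((volume.restrict (Metric.closedBall (0 : Vel d) R)).prod (surfaceMeasure d))
      ((volume.restrict (Metric.closedBall (0 : Vel d) R)).prod (surfaceMeasure d)) :=
    (measurePreserving_restrict_closedBall R A).prod (measurePreserving_rotateSphere A)
  have hk := (measurable_kernelFun (d := d) hB.Φ_meas hB.b_meas).ennreal_ofReal
  have hkT : ∀ p, kernelFun Φ b (T p) = kernelFun (d := d) Φ b p := by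
    intro p
    simp only [kernelFun, T, Prod.map, rotateSphere, LinearIsometryEquiv.norm_map]
    rw [← map_smul, LinearIsometryEquiv.inner_map_map]
  have hκ : (collisionMeasure d R Φ b).map T = collisionMeasure d R Φ b := by
    ext s hs
    rw [Measure.map_apply hT.measurable hs, collisionMeasure,
      withDensity_apply _ (hT.measurable hs), withDensity_apply _ hs,
      ← hT.setLIntegral_comp_preimage hs hk]
    simp only [hkT]
  have hW := (continuous_velMap (d := d) α β).measurable
  rw [Measure.map_map A.continuous.measurable hW]
  conv_rhs => rw [← hκ, Measure.map_map hW hT.measurable]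
  congr 1
  ext1 p
  simp only [Function.comp, velMap, T, Prod.map, rotateSphere, map_add, map_smul,
    LinearIsometryEquiv.norm_map]

/-- `∫ H(|q| σ) = ∫ H(q)` for the collision measure, since `|q| σ` and `q` have the same length. -/
theorem lintegral_velMap_swap {d : ℕ} {L R : ℝ} {Φ b : ℝ → ℝ} (hB : KernelAssumptions d L R Φ b)
    {H : Vel d → ℝ≥0∞} (hH : Measurable H) :
    ∫⁻ p, H (velMap 0 1 p) ∂(collisionMeasure d R Φ b) =
      ∫⁻ p, H (velMap 1 0 p) ∂(collisionMeasure d R Φ b) := by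
  obtain ⟨K, hK, hrad, hKint⟩ := exists_radial_average H hH
  have h : ∀ α β : ℝ, ∫⁻ p, H (velMap α β p) ∂(collisionMeasure d R Φ b) =
      ∫⁻ p, K (velMap α β p) ∂(collisionMeasure d R Φ b) := by
    intro α β
    have hW := (continuous_velMap (d := d) α β).measurable
    rw [← lintegral_map hH hW, hKint _ inferInstance (map_velMap_rotation hB α β),
      lintegral_map hK hW]
  rw [h, h]
  refine lintegral_congr fun p => hrad _ _ ?_
  simp [velMap, norm_smul]

theorem map_velMap_swap {d : ℕ} {L R : ℝ} {Φ b : ℝ → ℝ} (hB : KernelAssumptions d L R Φ b) :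
    (collisionMeasure d R Φ b).map (velMap 0 1) = (collisionMeasure d R Φ b).map (velMap 1 0) := by
  refine Measure.ext_of_lintegral _ fun H hH => ?_
  rw [lintegral_map hH (continuous_velMap _ _).measurable,
    lintegral_map hH (continuous_velMap _ _).measurable, lintegral_velMap_swap hB hH]

/-- Contracting by a factor of at least `1/2` multiplies an integral over a centred ball by at most
`2 ^ d`. -/
theorem lintegral_closedBall_smul_le {d : ℕ} {R c : ℝ} (hc : 1 / 2 ≤ c) (hc1 : c ≤ 1)
    {K : Vel d → ℝ≥0∞} (hK : Measurable K) :
    ∫⁻ q in Metric.closedBall (0 : Vel d) R, K (c • q) ≤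
      2 ^ d * ∫⁻ q in Metric.closedBall (0 : Vel d) R, K q := by
  have hc0 : 0 < c := by linarith
  have hball : MeasurableSet (Metric.closedBall (0 : Vel d) R) :=
    Metric.isClosed_closedBall.measurableSet
  let F := (Metric.closedBall (0 : Vel d) R).indicator K
  have hF : Measurable F := hK.indicator hball
  calc ∫⁻ q in Metric.closedBall (0 : Vel d) R, K (c • q)
      ≤ ∫⁻ q, F (c • q) := by
        rw [← lintegral_indicator hball]
        refine lintegral_mono fun q => ?_
        by_cases hq : q ∈ Metric.closedBall (0 : Vel d) R
        · have : c • q ∈ Metric.closedBall (0 : Vel d) R := by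
            rw [mem_closedBall_zero_iff] at hq ⊢
            rw [norm_smul, Real.norm_of_nonneg hc0.le]
            exact (mul_le_of_le_one_left (norm_nonneg _) hc1).trans hq
          simp [F, hq, this]
        · simp [hq]
    _ = ENNReal.ofReal |(c ^ d)⁻¹| * ∫⁻ q, F q := by
        rw [← lintegral_map hF (measurable_const_smul c), Measure.map_addHaar_smul _ hc0.ne',
          lintegral_smul_measure]
        simp
    _ ≤ 2 ^ d * ∫⁻ q in Metric.closedBall (0 : Vel d) R, K q := by
        rw [← lintegral_indicator hball]
        gcongr
        have : |(c ^ d)⁻¹| ≤ 2 ^ d := by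
          rw [abs_of_nonneg (by positivity), ← inv_pow]
          refine pow_le_pow_left₀ (by positivity) ?_ d
          rw [inv_le_comm₀ hc0 two_pos]; linarith
        refine (ENNReal.ofReal_le_ofReal this).trans ?_
        rw [ENNReal.ofReal_pow (by norm_num)]
        simp

theorem lintegral_symmKernel_lt_top {d : ℕ} {L R : ℝ} {Φ b : ℝ → ℝ}
    (hB : KernelAssumptions d L R Φ b) (e : UnitSphere d) :
    ∫⁻ σ, ENNReal.ofReal (symmKernel b (inner ℝ (σ : Vel d) (e : Vel d)))
      ∂(surfaceMeasure d) < ∞ := by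
  have h1 := (hB.cutoff e).lintegral_lt_top
  have h2 := (hB.cutoff (-e)).lintegral_lt_top
  have hm : Measurable fun σ : UnitSphere d => b (inner ℝ (σ : Vel d) (e : Vel d)) :=
    hB.b_meas.comp (measurable_subtype_coe.inner measurable_const)
  refine lt_of_le_of_lt ?_ (ENNReal.add_lt_top.2 ⟨h1, h2⟩)
  rw [← lintegral_add_left hm.ennreal_ofReal]
  refine lintegral_mono fun σ => ?_
  unfold symmKernel
  simp only [coe_neg_sphere, inner_neg_right]
  split_ifs
  · exact ENNReal.ofReal_add_le
  · simp

theorem closedBall_subset_box {d : ℕ} {L R : ℝ} (h : R ≤ L) :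
    Metric.closedBall (0 : Vel d) R ⊆ box d L := by
  intro q hq i
  rw [mem_closedBall_zero_iff] at hq
  exact abs_le.1 ((PiLp.norm_apply_le q i).trans (hq.trans h))

/-- `Φ(|q|)` is essentially bounded on the ball, since the ball lies in the cube. -/
theorem exists_bound_kinetic {d : ℕ} {L R : ℝ} {Φ b : ℝ → ℝ} (hB : KernelAssumptions d L R Φ b) :
    ∃ M : ℝ, ∀ᵐ q : Vel d ∂(volume.restrict (Metric.closedBall (0 : Vel d) R)), Φ ‖q‖ ≤ M := by
  have h := ae_le_lpNorm_exponent_top hB.Φ_bdd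
  have h2 := ae_restrict_of_ae_restrict_of_subset (closedBall_subset_box hB.R_le_L) h
  refine ⟨lpNorm ((Metric.closedBall (0 : Vel d) R).indicator fun v => Φ ‖v‖) ∞
    (boxMeasure d L), ?_⟩
  filter_upwards [h2, ae_restrict_mem Metric.isClosed_closedBall.measurableSet] with q hq hq2
  rw [indicator_of_mem hq2] at hq
  exact (le_abs_self _).trans hq

/-- The distribution of `α q + β |q| σ` under the collision measure has bounded density, provided
`|α e + β σ|` stays between `1/2` and `1` for `σ·e ≥ 0`. After radial averaging of the test
function only the length `|q| |α q̂ + β σ|` matters, so that the change of variables reduces to a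
dilation. -/
theorem exists_lintegral_velMap_le {d : ℕ} (hd : 2 ≤ d) {L R : ℝ} {Φ b : ℝ → ℝ}
    (hB : KernelAssumptions d L R Φ b) :
    ∃ C : ℝ, 0 < C ∧ ∀ α β : ℝ,
      (∀ e σ : UnitSphere d, 0 ≤ (inner ℝ (σ : Vel d) (e : Vel d) : ℝ) →
        1 / 2 ≤ ‖α • (e : Vel d) + β • (σ : Vel d)‖ ∧ ‖α • (e : Vel d) + β • (σ : Vel d)‖ ≤ 1) →
      ∀ H : Vel d → ℝ≥0∞, Measurable H →
        ∫⁻ p, H (velMap α β p) ∂(collisionMeasure d R Φ b) ≤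
          ENNReal.ofReal C * ∫⁻ z in Metric.closedBall (0 : Vel d) R, H z := by
  obtain ⟨M, hM⟩ := exists_bound_kinetic hB
  let e : UnitSphere d := ⟨EuclideanSpace.single ⟨0, by omega⟩ 1, by simp⟩
  let I := ∫⁻ σ, ENNReal.ofReal (symmKernel b (inner ℝ (σ : Vel d) (e : Vel d))) ∂(surfaceMeasure d)
  have hI : I < ∞ := lintegral_symmKernel_lt_top hB e
  refine ⟨(ENNReal.ofReal M * (I * 2 ^ d)).toReal + 1, by positivity, fun α β hαβ H hH => ?_⟩
  have hfin : ENNReal.ofReal M * (I * 2 ^ d) ≠ ∞ :=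
    ENNReal.mul_ne_top ENNReal.ofReal_ne_top (ENNReal.mul_ne_top hI.ne (by simp))
  have hC : ENNReal.ofReal M * (I * 2 ^ d) ≤
      ENNReal.ofReal ((ENNReal.ofReal M * (I * 2 ^ d)).toReal + 1) := by
    conv_lhs => rw [← ENNReal.ofReal_toReal hfin]
    exact ENNReal.ofReal_le_ofReal (by linarith)
  refine le_trans ?_ (mul_le_mul_left hC _)
  obtain ⟨K, hK, hrad, hKint⟩ := exists_radial_average H hH
  have hW := (continuous_velMap (d := d) α β).measurable
  have hball := hKint _
    (inferInstance : SFinite (volume.restrict (Metric.closedBall (0 : Vel d) R)))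
    fun A => (measurePreserving_restrict_closedBall R A).map_eq
  rw [← lintegral_map hH hW, hKint _ inferInstance (map_velMap_rotation hB α β),
    lintegral_map hK hW, hball,
    lintegral_collisionMeasure (F := fun p => K (velMap α β p)) hB (hK.comp hW)]
  let c : UnitSphere d → ℝ := fun σ => ‖α • (e : Vel d) + β • (σ : Vel d)‖
  let B : UnitSphere d → ℝ≥0∞ := fun σ =>
    ENNReal.ofReal (symmKernel b (inner ℝ (σ : Vel d) (e : Vel d)))
  have hc : Measurable c :=
    (measurable_const.add (measurable_subtype_coe.const_smul β)).norm
  have hBm : Measurable B := ((measurable_symmKernel hB.b_meas).comp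
    (measurable_subtype_coe.inner measurable_const)).ennreal_ofReal
  have hKm : Measurable fun p : Vel d × UnitSphere d => B p.2 * K (c p.2 • p.1) :=
    (hBm.comp measurable_snd).mul (hK.comp ((hc.comp measurable_snd).smul measurable_fst))
  -- For `q ≠ 0` a rotation taking `e` to `q / |q|` makes the angular kernel independent of `q`.
  have key : ∀ q : Vel d, q ≠ 0 →
      ∫⁻ σ, ENNReal.ofReal (symmKernel b (inner ℝ (σ : Vel d) (‖q‖⁻¹ • q))) *
        K (velMap α β (q, σ)) ∂(surfaceMeasure d) =
      ∫⁻ σ, B σ * K (c σ • q) ∂(surfaceMeasure d) := by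
    intro q hq
    have hq0 : ‖q‖ ≠ 0 := norm_ne_zero_iff.2 hq
    have hn : ‖(e : Vel d)‖ = ‖‖q‖⁻¹ • q‖ := by
      rw [norm_smul, norm_inv, norm_norm, inv_mul_cancel₀ hq0]; simp [e]
    obtain ⟨A, hA⟩ : ∃ A : Vel d ≃ₗᵢ[ℝ] Vel d, A e = ‖q‖⁻¹ • q :=
      ⟨_, Submodule.reflection_sub hn⟩
    have hm : Measurable fun σ : UnitSphere d =>
        ENNReal.ofReal (symmKernel b (inner ℝ (σ : Vel d) (‖q‖⁻¹ • q))) *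
          K (velMap α β (q, σ)) :=
      ((measurable_symmKernel hB.b_meas).comp
        (measurable_subtype_coe.inner measurable_const)).ennreal_ofReal.mul
        (hK.comp (hW.comp (measurable_const.prodMk measurable_id)))
    rw [← (measurePreserving_rotateSphere A).lintegral_comp hm]
    refine lintegral_congr fun σ => ?_
    have h1 : (inner ℝ ((rotateSphere A σ : UnitSphere d) : Vel d) (‖q‖⁻¹ • q) : ℝ) =
        inner ℝ (σ : Vel d) (e : Vel d) := by
      rw [← hA]; exact A.inner_map_map _ _
    have h2 : K (velMap α β (q, rotateSphere A σ)) = K (c σ • q) := by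
      refine hrad _ _ ?_
      have hqe : q = ‖q‖ • A e := by rw [hA, smul_smul, mul_inv_cancel₀ hq0, one_smul]
      have : velMap α β (q, rotateSphere A σ) = ‖q‖ • A (α • (e : Vel d) + β • (σ : Vel d)) := by
        simp only [velMap, rotateSphere, map_add, map_smul, smul_add, smul_smul]
        rw [mul_comm ‖q‖ α, mul_comm ‖q‖ β, mul_smul α, ← hqe]
      rw [this, norm_smul, norm_smul, LinearIsometryEquiv.norm_map, norm_norm, norm_norm,
        mul_comm]
    rw [h1, h2]
  calc _ ≤ ∫⁻ q in Metric.closedBall (0 : Vel d) R, ENNReal.ofReal M *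
          ∫⁻ σ, B σ * K (c σ • q) ∂(surfaceMeasure d) := by
        have h0 : ∀ᵐ q : Vel d ∂(volume.restrict (Metric.closedBall (0 : Vel d) R)), q ≠ 0 := by
          have : Nonempty (Fin d) := ⟨⟨0, by omega⟩⟩
          exact ae_restrict_of_ae (Measure.ae_ne volume 0)
        refine lintegral_mono_ae ?_
        filter_upwards [hM, h0] with q hq hq0
        rw [lintegral_const_mul' _ _ ENNReal.ofReal_ne_top, key q hq0]
        gcongr
    _ = ENNReal.ofReal M * ∫⁻ σ, B σ * (∫⁻ q in Metric.closedBall (0 : Vel d) R, K (c σ • q))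
          ∂(surfaceMeasure d) := by
        rw [lintegral_const_mul' _ _ ENNReal.ofReal_ne_top,
          lintegral_lintegral_swap (f := fun q σ => B σ * K (c σ • q)) hKm.aemeasurable]
        congr 1
        refine lintegral_congr fun σ => ?_
        rw [lintegral_const_mul' _ _ ENNReal.ofReal_ne_top]
    _ ≤ ENNReal.ofReal M * ∫⁻ σ, B σ *
          (2 ^ d * ∫⁻ q in Metric.closedBall (0 : Vel d) R, K q) ∂(surfaceMeasure d) := by
        refine mul_le_mul' le_rfl (lintegral_mono fun σ => ?_)
        dsimp only
        by_cases hσ : 0 ≤ (inner ℝ (σ : Vel d) (e : Vel d) : ℝ)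
        · obtain ⟨h1, h2⟩ := hαβ e σ hσ
          exact mul_le_mul' le_rfl (lintegral_closedBall_smul_le h1 h2 hK)
        · have : B σ = 0 := by simp [B, symmKernel, hσ]
          simp [this]
    _ = _ := by
        rw [lintegral_mul_const _ hBm]
        ring

/-! ### Integration of periodic functions over the cube -/

/-- The basis `(2L e_i)` of the period lattice. -/
noncomputable def latticeBasis (d : ℕ) {L : ℝ} (hL : 0 < L) : Module.Basis (Fin d) ℝ (Vel d) :=
  (EuclideanSpace.basisFun (Fin d) ℝ).toBasis.isUnitSMul (w := fun _ => 2 * L)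
    fun _ => isUnit_iff_ne_zero.2 (by positivity)

theorem latticeBasis_apply {d : ℕ} {L : ℝ} (hL : 0 < L) (i : Fin d) :
    latticeBasis d hL i = EuclideanSpace.single i (2 * L) := by
  rw [latticeBasis, Module.Basis.isUnitSMul_apply]
  ext j
  simp

theorem mem_fundamentalDomain_latticeBasis {d : ℕ} {L : ℝ} (hL : 0 < L) (v : Vel d) :
    v ∈ ZSpan.fundamentalDomain (latticeBasis d hL) ↔ ∀ i, v i ∈ Ico 0 (2 * L) := by
  rw [ZSpan.mem_fundamentalDomain]
  refine forall_congr' fun i => ?_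
  have h : (latticeBasis d hL).repr v i = (2 * L)⁻¹ * v i := by
    conv_rhs => rw [← (latticeBasis d hL).sum_repr v]
    simp only [latticeBasis_apply]
    rw [WithLp.ofLp_sum, Finset.sum_apply, Finset.sum_eq_single i]
    · simp; field_simp
    · intro j _ hj; simp [hj.symm]
    · simp
  rw [h, mem_Ico, mem_Ico, inv_mul_lt_iff₀ (by positivity), mul_one]
  have : 0 ≤ (2 * L)⁻¹ * v i ↔ 0 ≤ v i := by
    rw [mul_nonneg_iff_of_pos_left (by positivity)]
  rw [this]

/-- A function periodic along the coordinate directions is invariant under the period lattice. -/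
theorem apply_vadd_of_periodic {d : ℕ} {L : ℝ} (hL : 0 < L) {E : Type*} {F : Vel d → E}
    (hF : ∀ v i, F (v + EuclideanSpace.single i (2 * L)) = F v)
    (g : Submodule.span ℤ (range (latticeBasis d hL))) (v : Vel d) : F (g +ᵥ v) = F v := by
  obtain ⟨g, hg⟩ := g
  change F (g + v) = F v
  induction hg using Submodule.span_induction generalizing v with
  | mem x hx =>
    obtain ⟨i, rfl⟩ := hx
    rw [latticeBasis_apply, add_comm, hF]
  | zero => rw [zero_add]
  | add x y _ _ hx hy => rw [add_assoc, hx, hy]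
  | smul a x _ hx =>
    induction a generalizing v with
    | zero => simp
    | succ n ih => rw [add_smul, one_smul, add_assoc, ih, hx]
    | pred n ih =>
      rw [sub_smul, one_smul, sub_add_eq_add_sub, add_sub_assoc, ih]
      rw [← hx (v - x), add_sub_cancel]

/-- The half-open cube `[-L, L)^d` as a translate of the standard fundamental domain. -/
def halfOpenBox (d : ℕ) {L : ℝ} (hL : 0 < L) : Set (Vel d) :=
  (WithLp.toLp 2 fun _ => -L : Vel d) +ᵥ ZSpan.fundamentalDomain (latticeBasis d hL)

theorem box_ae_eq {d : ℕ} {L : ℝ} (hL : 0 < L) :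
    (box d L : Set (Vel d)) =ᵐ[volume] halfOpenBox d hL := by
  have h1 := (Measure.univ_pi_Ico_ae_eq_Icc (μ := fun _ : Fin d => (volume : Measure ℝ))
    (f := fun _ => -L) (g := fun _ => L))
  have h2 := (EuclideanSpace.volume_preserving_symm_measurableEquiv_toLp
    (Fin d)).quasiMeasurePreserving.preimage_ae_eq h1
  refine Filter.EventuallyEq.trans ?_ (h2.symm.trans ?_)
  · refine Filter.Eventually.of_forall fun v => propext ?_
    change (∀ i, v i ∈ Icc (-L) L) ↔ v.ofLp ∈ Icc _ _
    simp [Pi.le_def, forall_and]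
  · refine Filter.Eventually.of_forall fun v => propext ?_
    change v.ofLp ∈ univ.pi _ ↔ v ∈ halfOpenBox d hL
    rw [halfOpenBox, mem_vadd_set_iff_neg_vadd_mem, mem_fundamentalDomain_latticeBasis]
    simp only [mem_pi, mem_univ, true_imp_iff]
    refine forall_congr' fun i => ?_
    simp only [mem_Ico, vadd_eq_add, PiLp.add_apply, PiLp.neg_apply]
    constructor <;> rintro ⟨h, h'⟩ <;> constructor <;> linarith

theorem isAddFundamentalDomain_vadd {d : ℕ} {L : ℝ} (hL : 0 < L) (w : Vel d) :
    IsAddFundamentalDomain (Submodule.span ℤ (range (latticeBasis d hL)))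
      (w +ᵥ halfOpenBox d hL) volume :=
  ((ZSpan.isAddFundamentalDomain (latticeBasis d hL) volume).vadd_of_comm _).vadd_of_comm w

theorem isAddFundamentalDomain_halfOpenBox {d : ℕ} {L : ℝ} (hL : 0 < L) :
    IsAddFundamentalDomain (Submodule.span ℤ (range (latticeBasis d hL)))
      (halfOpenBox d hL) volume :=
  (ZSpan.isAddFundamentalDomain (latticeBasis d hL) volume).vadd_of_comm _

instance {d : ℕ} {L : ℝ} (hL : 0 < L) : VAddInvariantMeasure
    (Submodule.span ℤ (range (latticeBasis d hL))) (Vel d) volume :=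
  (inferInstance : VAddInvariantMeasure
    (Submodule.span ℤ (range (latticeBasis d hL))).toAddSubgroup (Vel d) volume)

theorem preimage_sub_vadd {d : ℕ} (w : Vel d) (s : Set (Vel d)) :
    (fun v => v - w) ⁻¹' s = w +ᵥ s := by
  ext v
  rw [mem_vadd_set_iff_neg_vadd_mem, vadd_eq_add, neg_add_eq_sub]
  rfl

/-- Integrals of periodic functions over the cube are translation-invariant: a translated cube is
another fundamental domain. -/
theorem setLIntegral_box_sub {d : ℕ} {L : ℝ} (hL : 0 < L) {F : Vel d → ℝ≥0∞}
    (hF : ∀ v i, F (v + EuclideanSpace.single i (2 * L)) = F v) (w : Vel d) :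
    ∫⁻ v in box d L, F (v - w) = ∫⁻ v in box d L, F v := by
  have hF' : ∀ v i, F ((v + EuclideanSpace.single i (2 * L)) - w) = F (v - w) := fun v i => by
    rw [add_sub_right_comm, hF]
  rw [setLIntegral_congr (box_ae_eq hL), setLIntegral_congr (box_ae_eq hL),
    (isAddFundamentalDomain_halfOpenBox hL).setLIntegral_eq (isAddFundamentalDomain_vadd hL w)
      (fun v => F (v - w)) (apply_vadd_of_periodic hL (F := fun v => F (v - w)) hF'),
    ← preimage_sub_vadd]
  exact (measurePreserving_sub_right volume w).setLIntegral_comp_preimage_emb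
    (MeasurableEquiv.subRight w).measurableEmbedding F _

/-- Translation invariance of the Bochner integral of a periodic function over the cube. -/
theorem setIntegral_box_sub {d : ℕ} {L : ℝ} (hL : 0 < L) {E : Type*} [NormedAddCommGroup E]
    [NormedSpace ℝ E] {F : Vel d → E}
    (hF : ∀ v i, F (v + EuclideanSpace.single i (2 * L)) = F v) (w : Vel d) :
    ∫ v in box d L, F (v - w) = ∫ v in box d L, F v := by
  have hF' : ∀ v i, F ((v + EuclideanSpace.single i (2 * L)) - w) = F (v - w) := fun v i => by
    rw [add_sub_right_comm, hF]
  rw [setIntegral_congr_set (box_ae_eq hL), setIntegral_congr_set (box_ae_eq hL),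
    (isAddFundamentalDomain_halfOpenBox hL).setIntegral_eq (isAddFundamentalDomain_vadd hL w)
      (apply_vadd_of_periodic hL (F := fun v => F (v - w)) hF'),
    ← preimage_sub_vadd]
  exact (measurePreserving_sub_right volume w).setIntegral_preimage_emb
    (MeasurableEquiv.subRight w).measurableEmbedding F _

theorem box_eq_preimage (d : ℕ) (L : ℝ) :
    box d L = (WithLp.ofLp : Vel d → Fin d → ℝ) ⁻¹' Icc (fun _ => -L) fun _ => L := by
  ext v
  simp [box, Pi.le_def, forall_and]

theorem isCompact_box (d : ℕ) (L : ℝ) : IsCompact (box d L) := by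
  rw [box_eq_preimage]
  exact (EuclideanSpace.equiv (Fin d) ℝ).toHomeomorph.isCompact_preimage.2 isCompact_Icc

theorem volume_box (d : ℕ) {L : ℝ} (hL : 0 < L) :
    volume (box d L) = ENNReal.ofReal ((2 * L) ^ d) := by
  have h := (EuclideanSpace.volume_preserving_symm_measurableEquiv_toLp (Fin d)).measure_preimage
    (s := Icc (fun _ => -L) fun _ => L) measurableSet_Icc.nullMeasurableSet
  rw [box_eq_preimage]
  refine h.trans ?_
  rw [Real.volume_Icc_pi]
  simp only [Finset.prod_const, Finset.card_univ, Fintype.card_fin]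
  rw [← ENNReal.ofReal_pow (by linarith)]
  congr 2; ring

theorem measurableSet_box (d : ℕ) (L : ℝ) : MeasurableSet (box d L) :=
  (isCompact_box d L).measurableSet

instance {d : ℕ} {L : ℝ} : IsFiniteMeasure (boxMeasure d L) :=
  ⟨by rw [Measure.restrict_apply_univ]; exact (isCompact_box d L).measure_lt_top⟩

theorem real_box (d : ℕ) {L : ℝ} (hL : 0 < L) : (boxMeasure d L).real univ = (2 * L) ^ d := by
  rw [Measure.real, Measure.restrict_apply_univ, volume_box d hL,
    ENNReal.toReal_ofReal (by positivity)]

/-- The integral of a periodic function over a ball contained in a cube is at most that over the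
cube. -/
theorem lintegral_closedBall_sub_le {d : ℕ} {L R : ℝ} (hL : 0 < L) (hRL : R ≤ L)
    {F : Vel d → ℝ≥0∞} (hF : ∀ v i, F (v + EuclideanSpace.single i (2 * L)) = F v) (v : Vel d) :
    ∫⁻ z in Metric.closedBall (0 : Vel d) R, F (v - z) ≤ ∫⁻ z in box d L, F z := by
  refine (lintegral_mono_set (closedBall_subset_box hRL)).trans ?_
  have hneg : ∫⁻ z in box d L, F (v - z) = ∫⁻ z in box d L, F (v + z) := by
    have h := (Measure.measurePreserving_neg
      (volume : Measure (Vel d))).setLIntegral_comp_preimage_emb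
      (MeasurableEquiv.neg (Vel d)).measurableEmbedding (fun z => F (v + z)) (box d L)
    have h2 : (fun z : Vel d => -z) ⁻¹' box d L = box d L := by
      ext z
      simp only [box, mem_preimage, mem_ofPred_eq, PiLp.neg_apply, mem_Icc]
      refine forall_congr' fun i => ?_
      constructor <;> rintro ⟨h, h'⟩ <;> constructor <;> linarith
    change ∫⁻ z in (fun z : Vel d => -z) ⁻¹' box d L, F (v + -z) = _ at h
    rw [h2] at h
    simpa only [sub_eq_add_neg] using h
  rw [hneg, ← setLIntegral_box_sub hL hF (-v)]
  simp only [sub_neg_eq_add, add_comm]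
  exact le_rfl

/-! ### Continuous periodic functions -/

/-- Continuous `2L`-periodic functions. -/
structure PeriodicContinuous {d : ℕ} (L : ℝ) (f : Vel d → ℝ) : Prop where
  continuous : Continuous f
  periodic : IsPeriodic L f

namespace PeriodicContinuous

variable {d : ℕ} {L : ℝ} {f g : Vel d → ℝ}

theorem exists_bound (hL : 0 < L) (hf : PeriodicContinuous L f) : ∃ M : ℝ, ∀ v, ‖f v‖ ≤ M := by
  obtain ⟨M, hM⟩ := ((ZSpan.fundamentalDomain_isBounded (latticeBasis d hL)).isCompact_closure
    ).exists_bound_of_continuousOn hf.continuous.continuousOn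
  refine ⟨M, fun v => ?_⟩
  obtain ⟨x, hx, -⟩ := ZSpan.exist_unique_vadd_mem_fundamentalDomain (latticeBasis d hL) v
  rw [← apply_vadd_of_periodic hL hf.periodic x v]
  exact hM _ (subset_closure hx)

theorem memLp (hf : PeriodicContinuous L f) (p : ℝ≥0∞) : MemLp f p (boxMeasure d L) := by
  obtain ⟨M, hM⟩ := (isCompact_box d L).exists_bound_of_continuousOn hf.continuous.continuousOn
  refine MemLp.of_bound hf.continuous.aestronglyMeasurable M ?_
  filter_upwards [ae_restrict_mem (measurableSet_box d L)] with v hv using hM v hv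

theorem max_zero (hf : PeriodicContinuous L f) : PeriodicContinuous L fun v => max (f v) 0 :=
  ⟨hf.continuous.max continuous_const, fun v i => by rw [hf.periodic v i]⟩

theorem neg (hf : PeriodicContinuous L f) : PeriodicContinuous L fun v => -f v :=
  ⟨hf.continuous.neg, fun v i => by rw [hf.periodic v i]⟩

theorem add (hf : PeriodicContinuous L f) (hg : PeriodicContinuous L g) :
    PeriodicContinuous L fun v => f v + g v :=
  ⟨hf.continuous.add hg.continuous, fun v i => by rw [hf.periodic v i, hg.periodic v i]⟩

theorem sub (hf : PeriodicContinuous L f) (hg : PeriodicContinuous L g) :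
    PeriodicContinuous L fun v => f v - g v :=
  ⟨hf.continuous.sub hg.continuous, fun v i => by rw [hf.periodic v i, hg.periodic v i]⟩

theorem mul (hf : PeriodicContinuous L f) (hg : PeriodicContinuous L g) :
    PeriodicContinuous L fun v => f v * g v :=
  ⟨hf.continuous.mul hg.continuous, fun v i => by rw [hf.periodic v i, hg.periodic v i]⟩

theorem abs (hf : PeriodicContinuous L f) : PeriodicContinuous L fun v => |f v| :=
  ⟨hf.continuous.abs, fun v i => by rw [hf.periodic v i]⟩

theorem const_mul (c : ℝ) (hf : PeriodicContinuous L f) : PeriodicContinuous L fun v => c * f v :=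
  ⟨continuous_const.mul hf.continuous, fun v i => by rw [hf.periodic v i]⟩

end PeriodicContinuous

/-! ### Gain and loss terms -/

section

variable {d : ℕ}

/-- The gain term of the truncated collision operator. -/
noncomputable def gain (R : ℝ) (Φ b : ℝ → ℝ) (g f : Vel d → ℝ) (v : Vel d) : ℝ :=
  ∫ p, g (v - velMap 2⁻¹ 2⁻¹ p) * f (v - velMap 2⁻¹ (-2⁻¹) p) ∂(collisionMeasure d R Φ b)

/-- The collision frequency, which multiplies `f` in the loss term. -/
noncomputable def lossFreq (R : ℝ) (Φ b : ℝ → ℝ) (g : Vel d → ℝ) (v : Vel d) : ℝ :=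
  ∫ p, g (v - velMap 1 0 p) ∂(collisionMeasure d R Φ b)

variable {L R : ℝ} {Φ b : ℝ → ℝ} {f g : Vel d → ℝ}

theorem L_pos (hB : KernelAssumptions d L R Φ b) : 0 < L := hB.R_pos.trans_le hB.R_le_L

/-- The midpoint of two unit vectors forming an angle of at most `π/2` has length between `1/2`
and `1`; this is where the symmetrization of the angular kernel enters. -/
theorem norm_midpoint_bounds (e σ : UnitSphere d)
    (h : 0 ≤ (inner ℝ (σ : Vel d) (e : Vel d) : ℝ)) :
    1 / 2 ≤ ‖(2⁻¹ : ℝ) • (e : Vel d) + (2⁻¹ : ℝ) • (σ : Vel d)‖ ∧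
      ‖(2⁻¹ : ℝ) • (e : Vel d) + (2⁻¹ : ℝ) • (σ : Vel d)‖ ≤ 1 := by
  have he : ‖(e : Vel d)‖ = 1 := by simp
  have hs : ‖(σ : Vel d)‖ = 1 := by simp
  have h1 := norm_add_sq_real (e : Vel d) (σ : Vel d)
  rw [he, hs, real_inner_comm] at h1
  have h2 := norm_add_le (e : Vel d) (σ : Vel d)
  rw [← smul_add, norm_smul, Real.norm_of_nonneg (by norm_num)]
  have h0 := norm_nonneg ((e : Vel d) + (σ : Vel d))
  constructor
  · nlinarith
  · rw [he, hs] at h2; linarith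

/-- A constant that bounds the density of the distributions of `(q + |q| σ) / 2`, `q` and `|q| σ`
under the collision measure. -/
structure IsDensityBound (d : ℕ) (R : ℝ) (Φ b : ℝ → ℝ) (C : ℝ) : Prop where
  pos : 0 < C
  mid : ∀ H : Vel d → ℝ≥0∞, Measurable H →
    ∫⁻ p, H (velMap 2⁻¹ 2⁻¹ p) ∂(collisionMeasure d R Φ b) ≤
      ENNReal.ofReal C * ∫⁻ z in Metric.closedBall (0 : Vel d) R, H z
  rel : ∀ H : Vel d → ℝ≥0∞, Measurable H →
    ∫⁻ p, H (velMap 1 0 p) ∂(collisionMeasure d R Φ b) ≤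
      ENNReal.ofReal C * ∫⁻ z in Metric.closedBall (0 : Vel d) R, H z
  post : ∀ H : Vel d → ℝ≥0∞, Measurable H →
    ∫⁻ p, H (velMap 0 1 p) ∂(collisionMeasure d R Φ b) ≤
      ENNReal.ofReal C * ∫⁻ z in Metric.closedBall (0 : Vel d) R, H z

theorem exists_isDensityBound (hd : 2 ≤ d) (hB : KernelAssumptions d L R Φ b) :
    ∃ C, IsDensityBound d R Φ b C := by
  obtain ⟨C, hC, h⟩ := exists_lintegral_velMap_le hd hB
  have h10 := h 1 0 (fun e σ _ => by norm_num)
  refine ⟨C, hC, h _ _ norm_midpoint_bounds, h10, fun H hH => ?_⟩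
  rw [lintegral_velMap_swap hB hH]
  exact h10 H hH

theorem isFiniteMeasure_collisionMeasure {C : ℝ} (hC : IsDensityBound d R Φ b C) :
    IsFiniteMeasure (collisionMeasure d R Φ b) := by
  refine ⟨?_⟩
  have h := hC.rel (fun _ => 1) measurable_const
  simp only [lintegral_const, one_mul] at h
  refine h.trans_lt (ENNReal.mul_lt_top ENNReal.ofReal_lt_top ?_)
  rw [Measure.restrict_apply_univ]
  exact measure_closedBall_lt_top

theorem lintegral_sub_le {C : ℝ} (hB : KernelAssumptions d L R Φ b)
    {W : Vel d × UnitSphere d → Vel d}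
    (hW : ∀ H : Vel d → ℝ≥0∞, Measurable H →
      ∫⁻ p, H (W p) ∂(collisionMeasure d R Φ b) ≤
        ENNReal.ofReal C * ∫⁻ z in Metric.closedBall (0 : Vel d) R, H z)
    (hg : PeriodicContinuous L g) (v : Vel d) :
    ∫⁻ p, ‖g (v - W p)‖ₑ ∂(collisionMeasure d R Φ b) ≤
      ENNReal.ofReal C * ∫⁻ z in box d L, ‖g z‖ₑ := by
  refine (hW (fun z => ‖g (v - z)‖ₑ)
    (hg.continuous.comp (continuous_const.sub continuous_id)).enorm.measurable).trans ?_
  refine mul_le_mul' le_rfl ?_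
  exact lintegral_closedBall_sub_le (L_pos hB) hB.R_le_L (F := fun z => ‖g z‖ₑ)
    (fun v i => by rw [hg.periodic v i]) v

/-- Cauchy–Schwarz with weight `u`. -/
theorem lintegral_mul_sq_le {α : Type*} [MeasurableSpace α] {μ : Measure α} {u w : α → ℝ≥0∞}
    (hu : Measurable u) (hw : Measurable w) :
    (∫⁻ x, u x * w x ∂μ) ^ 2 ≤ (∫⁻ x, u x ∂μ) * ∫⁻ x, u x * w x ^ 2 ∂μ := by
  have h := ENNReal.lintegral_mul_norm_pow_le (μ := μ) hu.aemeasurable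
    (hu.mul (hw.pow_const 2)).aemeasurable (p := 1 / 2) (q := 1 / 2) (by norm_num) (by norm_num)
    (by norm_num)
  have h2 : ∀ x, u x ^ (1 / 2 : ℝ) * (u * fun x => w x ^ 2) x ^ (1 / 2 : ℝ) = u x * w x := by
    intro x
    rw [Pi.mul_apply, ENNReal.mul_rpow_of_nonneg _ _ (by norm_num), ← mul_assoc,
      ← ENNReal.rpow_add_of_nonneg _ _ (by norm_num) (by norm_num), ← ENNReal.rpow_natCast (w x),
      ← ENNReal.rpow_mul]
    norm_num
  simp only [h2] at h
  calc _ ≤ _ := pow_le_pow_left' h 2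
    _ = _ := by
      rw [mul_pow, ← ENNReal.rpow_natCast, ← ENNReal.rpow_mul, ← ENNReal.rpow_natCast,
        ← ENNReal.rpow_mul]
      norm_num

theorem integrable_gain {C : ℝ} (hB : KernelAssumptions d L R Φ b)
    (hC : IsDensityBound d R Φ b C) (hg : PeriodicContinuous L g) (hf : PeriodicContinuous L f)
    (v : Vel d) : Integrable (fun p => g (v - velMap 2⁻¹ 2⁻¹ p) * f (v - velMap 2⁻¹ (-2⁻¹) p))
      (collisionMeasure d R Φ b) := by
  have := isFiniteMeasure_collisionMeasure hC
  obtain ⟨M, hM⟩ := hg.exists_bound (L_pos hB)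
  obtain ⟨M', hM'⟩ := hf.exists_bound (L_pos hB)
  refine Integrable.of_bound (C := M * M') ?_ (Filter.Eventually.of_forall fun p => ?_)
  · exact ((hg.continuous.comp (continuous_const.sub (continuous_velMap _ _))).mul
      (hf.continuous.comp
        (continuous_const.sub (continuous_velMap _ _)))).measurable.aestronglyMeasurable
  · rw [norm_mul]
    exact mul_le_mul (hM _) (hM' _) (norm_nonneg _) ((norm_nonneg _).trans (hM 0))

theorem integrable_lossFreq {C : ℝ} (hB : KernelAssumptions d L R Φ b)
    (hC : IsDensityBound d R Φ b C) (hg : PeriodicContinuous L g) (v : Vel d) :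
    Integrable (fun p => g (v - velMap 1 0 p)) (collisionMeasure d R Φ b) := by
  have := isFiniteMeasure_collisionMeasure hC
  obtain ⟨M, hM⟩ := hg.exists_bound (L_pos hB)
  exact Integrable.of_bound (C := M)
    (hg.continuous.comp
      (continuous_const.sub (continuous_velMap _ _))).measurable.aestronglyMeasurable
    (Filter.Eventually.of_forall fun p => hM _)

theorem periodicContinuous_gain {C : ℝ} (hB : KernelAssumptions d L R Φ b)
    (hC : IsDensityBound d R Φ b C) (hg : PeriodicContinuous L g) (hf : PeriodicContinuous L f) :
    PeriodicContinuous L (gain R Φ b g f) := by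
  have := isFiniteMeasure_collisionMeasure hC
  obtain ⟨M, hM⟩ := hg.exists_bound (L_pos hB)
  obtain ⟨M', hM'⟩ := hf.exists_bound (L_pos hB)
  refine ⟨?_, fun v i => ?_⟩
  · refine continuous_of_dominated (bound := fun _ => M * M')
      (fun v => (integrable_gain hB hC hg hf v).aestronglyMeasurable)
      (fun v => Filter.Eventually.of_forall fun p => ?_) (integrable_const _)
      (Filter.Eventually.of_forall fun p => ?_)
    · rw [norm_mul]
      exact mul_le_mul (hM _) (hM' _) (norm_nonneg _) ((norm_nonneg _).trans (hM 0))
    · exact (hg.continuous.comp (continuous_id.sub continuous_const)).mul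
        (hf.continuous.comp (continuous_id.sub continuous_const))
  · unfold gain
    simp only [add_sub_right_comm, hg.periodic _ i, hf.periodic _ i]

theorem periodicContinuous_lossFreq {C : ℝ} (hB : KernelAssumptions d L R Φ b)
    (hC : IsDensityBound d R Φ b C) (hg : PeriodicContinuous L g) :
    PeriodicContinuous L (lossFreq R Φ b g) := by
  have := isFiniteMeasure_collisionMeasure hC
  obtain ⟨M, hM⟩ := hg.exists_bound (L_pos hB)
  refine ⟨?_, fun v i => ?_⟩
  · exact continuous_of_dominated (bound := fun _ => M)
      (fun v => (integrable_lossFreq hB hC hg v).aestronglyMeasurable)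
      (fun v => Filter.Eventually.of_forall fun p => hM _) (integrable_const _)
      (Filter.Eventually.of_forall fun p =>
        hg.continuous.comp (continuous_id.sub continuous_const))
  · unfold lossFreq
    simp only [add_sub_right_comm, hg.periodic _ i]

/-- The bound `‖Q⁺(g, f)‖_{L²} ≤ C ‖g‖_{L¹} ‖f‖_{L²}`: Cauchy–Schwarz with weight `|g(v_*')|`,
followed by a translation of the torus that replaces `v'` by `v` and `v_*'` by `v - |q| σ`. -/
theorem lintegral_gain_sq_le {C : ℝ} (hB : KernelAssumptions d L R Φ b)
    (hC : IsDensityBound d R Φ b C) (hg : PeriodicContinuous L g) (hf : PeriodicContinuous L f) :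
    ∫⁻ v in box d L, ‖gain R Φ b g f v‖ₑ ^ 2 ≤
      (ENNReal.ofReal C * ∫⁻ v in box d L, ‖g v‖ₑ) ^ 2 * ∫⁻ v in box d L, ‖f v‖ₑ ^ 2 := by
  have := isFiniteMeasure_collisionMeasure hC
  set κ := collisionMeasure d R Φ b
  set G := ENNReal.ofReal C * ∫⁻ v in box d L, ‖g v‖ₑ
  have hX := continuous_velMap (d := d) 2⁻¹ 2⁻¹
  have hY := continuous_velMap (d := d) 2⁻¹ (-2⁻¹)
  have hP := continuous_velMap (d := d) 0 1
  have hm : Measurable fun x : Vel d × (Vel d × UnitSphere d) =>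
      ‖g (x.1 - velMap 2⁻¹ 2⁻¹ x.2)‖ₑ * ‖f (x.1 - velMap 2⁻¹ (-2⁻¹) x.2)‖ₑ ^ 2 :=
    (hg.continuous.comp (continuous_fst.sub (hX.comp continuous_snd))).enorm.measurable.mul
      ((hf.continuous.comp (continuous_fst.sub
        (hY.comp continuous_snd))).enorm.measurable.pow_const 2)
  have hm' : Measurable fun x : (Vel d × UnitSphere d) × Vel d =>
      ‖g (x.2 - velMap 0 1 x.1)‖ₑ * ‖f x.2‖ₑ ^ 2 :=
    (hg.continuous.comp (continuous_snd.sub (hP.comp continuous_fst))).enorm.measurable.mul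
      ((hf.continuous.comp continuous_snd).enorm.measurable.pow_const 2)
  calc ∫⁻ v in box d L, ‖gain R Φ b g f v‖ₑ ^ 2
      ≤ ∫⁻ v in box d L, G * ∫⁻ p, ‖g (v - velMap 2⁻¹ 2⁻¹ p)‖ₑ *
          ‖f (v - velMap 2⁻¹ (-2⁻¹) p)‖ₑ ^ 2 ∂κ := by
        refine lintegral_mono fun v => ?_
        have h1 : ‖gain R Φ b g f v‖ₑ ≤ ∫⁻ p, ‖g (v - velMap 2⁻¹ 2⁻¹ p)‖ₑ *
            ‖f (v - velMap 2⁻¹ (-2⁻¹) p)‖ₑ ∂κ := by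
          refine (enorm_integral_le_lintegral_enorm _).trans (lintegral_mono fun p => ?_)
          rw [enorm_mul]
        refine (pow_le_pow_left' h1 2).trans ((lintegral_mul_sq_le ?_ ?_).trans ?_)
        · exact (hg.continuous.comp (continuous_const.sub hX)).enorm.measurable
        · exact (hf.continuous.comp (continuous_const.sub hY)).enorm.measurable
        · gcongr
          exact lintegral_sub_le hB hC.mid hg v
    _ = G * ∫⁻ p, (∫⁻ v in box d L, ‖g (v - velMap 2⁻¹ 2⁻¹ p)‖ₑ *
          ‖f (v - velMap 2⁻¹ (-2⁻¹) p)‖ₑ ^ 2) ∂κ := by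
        rw [lintegral_const_mul _ hm.lintegral_prod_right',
          lintegral_lintegral_swap hm.aemeasurable]
    _ = G * ∫⁻ p, (∫⁻ v in box d L, ‖g (v - velMap 0 1 p)‖ₑ * ‖f v‖ₑ ^ 2) ∂κ := by
        congr 1
        refine lintegral_congr fun p => ?_
        rw [← setLIntegral_box_sub (L_pos hB) (F := fun v => ‖g (v - velMap 0 1 p)‖ₑ * ‖f v‖ₑ ^ 2)
          _ (velMap 2⁻¹ (-2⁻¹) p)]
        · refine lintegral_congr fun v => ?_
          have : v - velMap 2⁻¹ (-2⁻¹) p - velMap 0 1 p = v - velMap 2⁻¹ 2⁻¹ p := by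
            simp only [velMap]; module
          rw [this]
        · intro v i
          rw [add_sub_right_comm, hg.periodic, hf.periodic]
    _ = G * ∫⁻ v in box d L, (∫⁻ p, ‖g (v - velMap 0 1 p)‖ₑ ∂κ) * ‖f v‖ₑ ^ 2 := by
        rw [lintegral_lintegral_swap hm'.aemeasurable]
        congr 1
        refine lintegral_congr fun v => ?_
        rw [lintegral_mul_const]
        exact (hg.continuous.comp (continuous_const.sub hP)).enorm.measurable
    _ ≤ G * ∫⁻ v in box d L, G * ‖f v‖ₑ ^ 2 := by
        gcongr with v
        exact lintegral_sub_le hB hC.post hg v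
    _ = _ := by
        rw [lintegral_const_mul _ (hf.continuous.enorm.measurable.pow_const 2)]
        ring

theorem abs_lossFreq_le {C : ℝ} (hB : KernelAssumptions d L R Φ b)
    (hC : IsDensityBound d R Φ b C) (hg : PeriodicContinuous L g) (v : Vel d) :
    |lossFreq R Φ b g v| ≤ C * lpNorm g 1 (boxMeasure d L) := by
  have h : ‖lossFreq R Φ b g v‖ₑ ≤ ENNReal.ofReal (C * lpNorm g 1 (boxMeasure d L)) := by
    rw [ENNReal.ofReal_mul hC.pos.le, ofReal_lpNorm (hg.memLp 1), eLpNorm_one_eq_lintegral_enorm]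
    exact (enorm_integral_le_lintegral_enorm _).trans (lintegral_sub_le hB hC.rel hg v)
  rw [← ofReal_norm, ENNReal.ofReal_le_ofReal_iff
    (mul_nonneg hC.pos.le lpNorm_nonneg)] at h
  exact h

theorem lpNorm_gain_le {C : ℝ} (hB : KernelAssumptions d L R Φ b)
    (hC : IsDensityBound d R Φ b C) (hg : PeriodicContinuous L g) (hf : PeriodicContinuous L f) :
    lpNorm (gain R Φ b g f) 2 (boxMeasure d L) ≤
      C * lpNorm g 1 (boxMeasure d L) * lpNorm f 2 (boxMeasure d L) := by
  have hsq : ∀ h : Vel d → ℝ, eLpNorm h 2 (boxMeasure d L) ^ 2 = ∫⁻ v in box d L, ‖h v‖ₑ ^ 2 := by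
    intro h
    have := eLpNorm_nnreal_pow_eq_lintegral (μ := boxMeasure d L) (f := h) (p := 2) (by norm_num)
    norm_num at this
    exact_mod_cast this
  have h := lintegral_gain_sq_le hB hC hg hf
  have h0 : 0 ≤ C * lpNorm g 1 (boxMeasure d L) * lpNorm f 2 (boxMeasure d L) :=
    mul_nonneg (mul_nonneg hC.pos.le lpNorm_nonneg) lpNorm_nonneg
  rw [← hsq, ← hsq, ← eLpNorm_one_eq_lintegral_enorm, ← mul_pow,
    ← ofReal_lpNorm (hg.memLp 1), ← ofReal_lpNorm (hf.memLp 2),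
    ← ofReal_lpNorm ((periodicContinuous_gain hB hC hg hf).memLp 2),
    ← ENNReal.ofReal_mul hC.pos.le,
    ← ENNReal.ofReal_mul (mul_nonneg hC.pos.le lpNorm_nonneg)] at h
  rw [ENNReal.pow_le_pow_left_iff two_ne_zero, ENNReal.ofReal_le_ofReal_iff h0] at h
  exact h

/-- The collision operator as gain minus loss. -/
theorem collision_eq {C : ℝ} (hB : KernelAssumptions d L R Φ b)
    (hC : IsDensityBound d R Φ b C) (hg : PeriodicContinuous L g) (hf : PeriodicContinuous L f)
    (v : Vel d) :
    collision R Φ b g f v = gain R Φ b g f v - lossFreq R Φ b g v * f v := by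
  have hk := measurable_kernelFun (d := d) hB.Φ_meas hB.b_meas
  have hint := (integrable_gain hB hC hg hf v).sub
    ((integrable_lossFreq hB hC hg v).mul_const (f v))
  rw [gain, lossFreq, ← integral_mul_const, ← integral_sub (integrable_gain hB hC hg hf v)
    ((integrable_lossFreq hB hC hg v).mul_const (f v))]
  rw [collisionMeasure, integrable_withDensity_iff_integrable_smul' hk.ennreal_ofReal
    (Filter.Eventually.of_forall fun _ => ENNReal.ofReal_lt_top)] at hint
  rw [collisionMeasure, integral_withDensity_eq_integral_toReal_smul hk.ennreal_ofReal
    (Filter.Eventually.of_forall fun _ => ENNReal.ofReal_lt_top), integral_prod]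
  swap
  · exact hint
  refine integral_congr_ae (Filter.Eventually.of_forall fun q => ?_)
  refine integral_congr_ae (Filter.Eventually.of_forall fun σ => ?_)
  simp only [ENNReal.toReal_ofReal (kernelFun_nonneg hB _), smul_eq_mul]
  simp only [kernelFun, velMap, smul_add, smul_neg, smul_smul, neg_mul, neg_smul, one_smul,
    zero_mul, zero_smul, add_zero, sub_eq_add_neg]

end

/-! ### Fourier modes -/

section

variable {d : ℕ} {L : ℝ}

theorem continuous_fourierMode (k : Fin d → ℤ) : Continuous (fourierMode L k) := by
  unfold fourierMode
  fun_prop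

theorem fourierMode_add_index (k l : Fin d → ℤ) (v : Vel d) :
    fourierMode L (k + l) v = fourierMode L k v * fourierMode L l v := by
  rw [fourierMode, fourierMode, fourierMode, ← Complex.exp_add, ← mul_add, ← Complex.ofReal_add,
    ← mul_add, ← Finset.sum_add_distrib]
  simp [add_mul]

theorem fourierMode_zero (v : Vel d) : fourierMode L 0 v = 1 := by simp [fourierMode]

theorem fourierMode_add (k : Fin d → ℤ) (v w : Vel d) :
    fourierMode L k (v + w) = fourierMode L k v * fourierMode L k w := by
  rw [fourierMode, fourierMode, fourierMode, ← Complex.exp_add, ← mul_add, ← Complex.ofReal_add,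
    ← mul_add, ← Finset.sum_add_distrib]
  simp [mul_add]

theorem conj_fourierMode (k : Fin d → ℤ) (v : Vel d) :
    conj (fourierMode L k v) = fourierMode L (-k) v := by
  rw [fourierMode, fourierMode, ← Complex.exp_conj, map_mul, Complex.conj_I, Complex.conj_ofReal]
  simp

theorem fourierMode_neg (k : Fin d → ℤ) (v : Vel d) :
    fourierMode L k (-v) = conj (fourierMode L k v) := by
  rw [conj_fourierMode, fourierMode, fourierMode]
  simp

theorem fourierMode_sub (k : Fin d → ℤ) (v w : Vel d) :
    fourierMode L k (v - w) = fourierMode L k v * conj (fourierMode L k w) := by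
  rw [sub_eq_add_neg, fourierMode_add, fourierMode_neg]

theorem norm_fourierMode (k : Fin d → ℤ) (v : Vel d) : ‖fourierMode L k v‖ = 1 := by
  rw [fourierMode, mul_comm, Complex.norm_exp_ofReal_mul_I]

theorem fourierMode_single (k : Fin d → ℤ) (i : Fin d) (r : ℝ) :
    fourierMode L k (EuclideanSpace.single i r) =
      Complex.exp (Complex.I * ((Real.pi / L * (k i * r) : ℝ) : ℂ)) := by
  rw [fourierMode]
  congr 3
  rw [Finset.sum_eq_single i]
  · simp
  · intro j _ hj; simp [hj]
  · simp

theorem fourierMode_periodic (hL : 0 < L) (k : Fin d → ℤ) (v : Vel d) (i : Fin d) :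
    fourierMode L k (v + EuclideanSpace.single i (2 * L)) = fourierMode L k v := by
  rw [fourierMode_add, fourierMode_single]
  have : Complex.I * ((Real.pi / L * (k i * (2 * L)) : ℝ) : ℂ) =
      (k i : ℂ) * (2 * Real.pi * Complex.I) := by
    have : Real.pi / L * (k i * (2 * L)) = k i * (2 * Real.pi) := by field_simp
    rw [this]; push_cast; ring
  rw [this, Complex.exp_int_mul_two_pi_mul_I, mul_one]

theorem integral_fourierMode_of_ne (hL : 0 < L) {k : Fin d → ℤ} (hk : k ≠ 0) :
    ∫ v in box d L, fourierMode L k v = 0 := by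
  obtain ⟨i, hi⟩ := Function.ne_iff.1 hk
  -- translating by `-(L / k_i) e_i` multiplies the mode by `-1`
  have h := setIntegral_box_sub hL (fourierMode_periodic hL k)
    (EuclideanSpace.single i (-(L / k i)))
  have h2 : ∀ v, fourierMode L k (v - EuclideanSpace.single i (-(L / k i))) =
      -fourierMode L k v := by
    intro v
    have hi' : (k i : ℝ) ≠ 0 := by exact_mod_cast hi
    have : -(EuclideanSpace.single i (-(L / k i)) : Vel d) = EuclideanSpace.single i (L / k i) := by
      ext j
      simp only [PiLp.neg_apply, PiLp.single_apply]
      split_ifs <;> simp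
    rw [sub_eq_add_neg, this, fourierMode_add, fourierMode_single]
    have h3 : Real.pi / L * (k i * (L / k i)) = Real.pi := by field_simp
    rw [h3, mul_comm Complex.I, Complex.exp_pi_mul_I]
    ring
  simp only [h2] at h
  rw [integral_neg] at h
  have h4 : (2 : ℂ) * ∫ v in box d L, fourierMode L k v = 0 := by linear_combination -h
  simpa using h4

theorem integral_fourierMode_zero (hL : 0 < L) :
    ∫ v in box d L, fourierMode L 0 v = ((2 * L : ℝ) ^ d : ℂ) := by
  simp only [fourierMode_zero]
  rw [integral_const, real_box d hL]
  simp

theorem integrableOn_box {F : Vel d → ℂ} (hF : Continuous F) : Integrable F (boxMeasure d L) :=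
  hF.continuousOn.integrableOn_compact (isCompact_box d L)

theorem coeff_fourierMode (hL : 0 < L) (k l : Fin d → ℤ) :
    coeff L (fourierMode L l) k = if l = k then 1 else 0 := by
  have h : ∀ v, fourierMode L l v * conj (fourierMode L k v) = fourierMode L (l - k) v := by
    intro v; rw [conj_fourierMode, ← fourierMode_add_index, sub_eq_add_neg]
  rw [coeff]
  simp only [h]
  split_ifs with hlk
  · rw [hlk, sub_self, integral_fourierMode_zero hL, inv_mul_cancel₀]
    have : (2 * L : ℝ) ^ d ≠ 0 := by positivity
    exact_mod_cast this
  · rw [integral_fourierMode_of_ne hL (sub_ne_zero.2 hlk), mul_zero]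

theorem coeff_sum {ι : Type*} (s : Finset ι) {F : ι → Vel d → ℂ} (hF : ∀ i ∈ s, Continuous (F i))
    (c : ι → ℂ) (k : Fin d → ℤ) :
    coeff L (fun v => ∑ i ∈ s, c i * F i v) k = ∑ i ∈ s, c i * coeff L (F i) k := by
  simp only [coeff, Finset.sum_mul]
  rw [integral_finsetSum]
  · rw [Finset.mul_sum]
    refine Finset.sum_congr rfl fun i _ => ?_
    simp only [mul_assoc]
    rw [integral_const_mul]
    ring
  · intro i hi
    have := Complex.continuous_conj.comp (continuous_fourierMode (L := L) k)
    exact integrableOn_box ((continuous_const.mul (hF i hi)).mul this)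

/-- Fourier coefficients of a finite combination of modes, whose indices may repeat. -/
theorem coeff_sum_fourierMode (hL : 0 < L) {ι : Type*} (s : Finset ι) (m : ι → Fin d → ℤ)
    (c : ι → ℂ) (k : Fin d → ℤ) :
    coeff L (fun v => ∑ i ∈ s, c i * fourierMode L (m i) v) k =
      ∑ i ∈ s, if m i = k then c i else 0 := by
  rw [coeff_sum s fun i _ => continuous_fourierMode (m i)]
  simp [coeff_fourierMode hL]

theorem coeff_trigSum (hL : 0 < L) (S : Finset (Fin d → ℤ)) (c : (Fin d → ℤ) → ℂ)
    (k : Fin d → ℤ) :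
    coeff L (fun v => ∑ l ∈ S, c l * fourierMode L l v) k = if k ∈ S then c k else 0 := by
  simpa using coeff_sum_fourierMode hL S id c k

/-! ### Trigonometric polynomials -/

/-- The Fourier coefficients of a real-valued function. -/
noncomputable abbrev rcoeff (L : ℝ) (f : Vel d → ℝ) (k : Fin d → ℤ) : ℂ :=
  coeff L (fun w => (f w : ℂ)) k

/-- The real-valued function `f` is a trigonometric polynomial with frequencies in `S`. -/
def IsTrig (L : ℝ) (S : Finset (Fin d → ℤ)) (f : Vel d → ℝ) : Prop :=
  ∀ v, (f v : ℂ) = ∑ k ∈ S, rcoeff L f k * fourierMode L k v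

theorem isTrig_of_sum (hL : 0 < L) {S : Finset (Fin d → ℤ)} {f : Vel d → ℝ}
    {c : (Fin d → ℤ) → ℂ} (h : ∀ v, (f v : ℂ) = ∑ k ∈ S, c k * fourierMode L k v) :
    IsTrig L S f ∧ ∀ k ∈ S, rcoeff L f k = c k := by
  have hc : ∀ k ∈ S, rcoeff L f k = c k := by
    intro k hk
    rw [rcoeff, funext h, coeff_trigSum hL, if_pos hk]
  refine ⟨fun v => ?_, hc⟩
  rw [h v]
  exact Finset.sum_congr rfl fun k hk => by rw [hc k hk]

/-- The span of the modes consists of the functions that equal their own partial Fourier sum. -/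
theorem memTrigPoly_iff (hL : 0 < L) {N : ℕ} {f : Vel d → ℝ} :
    MemTrigPoly L N f ↔ IsTrig L (modes d N) f := by
  rw [MemTrigPoly, Submodule.mem_span_image_finset_iff_exists_fun]
  constructor
  · rintro ⟨c, hc⟩
    refine (isTrig_of_sum hL (c := fun k => if h : k ∈ modes d N then c ⟨k, h⟩ else 0)
      fun v => ?_).1
    rw [← congrFun hc v, Finset.sum_apply, ← Finset.sum_coe_sort (modes d N)]
    exact Finset.sum_congr rfl fun k _ => by simp
  · intro h
    refine ⟨fun k => rcoeff L f k, ?_⟩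
    ext v
    rw [h v, Finset.sum_apply, ← Finset.sum_coe_sort (modes d N)]
    exact Finset.sum_congr rfl fun k _ => by simp

theorem IsTrig.eq_re {S : Finset (Fin d → ℤ)} {f : Vel d → ℝ} (h : IsTrig L S f) (v : Vel d) :
    f v = (∑ k ∈ S, rcoeff L f k * fourierMode L k v).re := by
  rw [← h v, Complex.ofReal_re]

theorem IsTrig.periodicContinuous (hL : 0 < L) {S : Finset (Fin d → ℤ)} {f : Vel d → ℝ}
    (h : IsTrig L S f) : PeriodicContinuous L f := by
  have h2 := funext h.eq_re
  refine ⟨?_, fun v i => ?_⟩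
  · rw [h2]
    exact Complex.continuous_re.comp (continuous_finsetSum _ fun k _ =>
      continuous_const.mul (continuous_fourierMode k))
  · rw [h.eq_re, h.eq_re v]
    simp only [fourierMode_periodic hL]

theorem IsTrig.coeff_eq_zero (hL : 0 < L) {S : Finset (Fin d → ℤ)} {f : Vel d → ℝ}
    (h : IsTrig L S f) {k : Fin d → ℤ} (hk : k ∉ S) : rcoeff L f k = 0 := by
  rw [rcoeff, funext h, coeff_trigSum hL, if_neg hk]

theorem coeff_neg_index (f : Vel d → ℝ) (k : Fin d → ℤ) :
    rcoeff L f (-k) = conj (rcoeff L f k) := by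
  rw [rcoeff, rcoeff, coeff, coeff, map_mul, ← integral_conj, map_inv₀, map_pow]
  simp only [conj_fourierMode, map_mul, Complex.conj_ofReal, neg_neg]

/-- A combination of modes whose coefficients are conjugate-symmetric is real-valued. -/
theorem ofReal_re_sum {S : Finset (Fin d → ℤ)} (hS : ∀ k ∈ S, -k ∈ S) {c : (Fin d → ℤ) → ℂ}
    (hc : ∀ k ∈ S, c (-k) = conj (c k)) (v : Vel d) :
    (((∑ k ∈ S, c k * fourierMode L k v).re : ℝ) : ℂ) = ∑ k ∈ S, c k * fourierMode L k v := by
  refine Complex.conj_eq_iff_re.1 ?_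
  rw [map_sum]
  refine Finset.sum_nbij' (fun k => -k) (fun k => -k) hS hS (by simp) (by simp) fun k hk => ?_
  rw [map_mul, conj_fourierMode, hc k hk]

theorem neg_mem_modes {N : ℕ} {k : Fin d → ℤ} (hk : k ∈ modes d N) : -k ∈ modes d N := by
  simp only [modes, Fintype.mem_piFinset, Finset.mem_Icc] at hk ⊢
  exact fun i => ⟨neg_le_neg (hk i).2, by have := neg_le_neg (hk i).1; simpa using this⟩

/-- Parseval's identity for trigonometric polynomials. -/
theorem IsTrig.lpNorm_sq (hL : 0 < L) {S : Finset (Fin d → ℤ)} {f : Vel d → ℝ}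
    (h : IsTrig L S f) :
    lpNorm f 2 (boxMeasure d L) ^ 2 =
      (2 * L) ^ d * ∑ k ∈ S, ‖rcoeff L f k‖ ^ 2 := by
  have hf := h.periodicContinuous hL
  have h1 : lpNorm f 2 (boxMeasure d L) ^ 2 = ∫ v in box d L, f v ^ 2 := by
    have := lpNorm_nnreal_eq_integral_norm_rpow (p := 2) (f := f) (μ := boxMeasure d L)
      (by norm_num) hf.continuous.aestronglyMeasurable
    have h3 : lpNorm f 2 (boxMeasure d L) = (∫ v in box d L, f v ^ 2) ^ (2 : ℝ)⁻¹ := by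
      simpa using this
    rw [h3, ← Real.rpow_natCast, ← Real.rpow_mul (integral_nonneg fun v => sq_nonneg _)]
    norm_num
  have h2 : ((∫ v in box d L, f v ^ 2 : ℝ) : ℂ) =
      ((2 * L : ℝ) ^ d : ℂ) * coeff L (fun w => ((f w ^ 2 : ℝ) : ℂ)) 0 := by
    have : ((2 * L : ℝ) ^ d : ℂ) ≠ 0 := by
      have : (2 * L : ℝ) ^ d ≠ 0 := by positivity
      exact_mod_cast this
    rw [coeff, mul_inv_cancel_left₀ this, ← integral_complex_ofReal]
    simp [fourierMode_zero]
  have h3 : (fun w => ((f w ^ 2 : ℝ) : ℂ)) = fun v => ∑ p ∈ S ×ˢ S,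
      (rcoeff L f p.1 * conj (rcoeff L f p.2)) *
        fourierMode L (p.1 - p.2) v := by
    ext v
    have : ((f v ^ 2 : ℝ) : ℂ) = (f v : ℂ) * conj (f v : ℂ) := by
      rw [Complex.conj_ofReal]; push_cast; ring
    rw [this, h v, map_sum, Finset.sum_mul_sum, Finset.sum_product]
    refine Finset.sum_congr rfl fun k _ => Finset.sum_congr rfl fun l _ => ?_
    rw [map_mul, conj_fourierMode, sub_eq_add_neg, fourierMode_add_index]
    ring
  rw [h1]
  apply Complex.ofReal_injective
  rw [h2, h3, coeff_sum_fourierMode hL _ (fun p : (Fin d → ℤ) × (Fin d → ℤ) => p.1 - p.2),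
    Finset.sum_product]
  push_cast
  congr 1
  refine Finset.sum_congr rfl fun k hk => ?_
  simp only [sub_eq_zero]
  rw [Finset.sum_ite_eq, if_pos hk, Complex.mul_conj, Complex.normSq_eq_norm_sq]
  push_cast; rfl

end

section

/-! ### The collision operator on trigonometric polynomials -/

variable {d : ℕ} {L R C : ℝ} {Φ b : ℝ → ℝ} {f g : Vel d → ℝ} {S : Finset (Fin d → ℤ)}

/-- The weight `β(l, m)` of the product of the `l`-th coefficient of `g` with the `m`-th one of `f`
in the collision operator. -/
noncomputable def weight (L R : ℝ) (Φ b : ℝ → ℝ) (l m : Fin d → ℤ) : ℂ :=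
  ∫ p, conj (fourierMode L l (velMap 2⁻¹ 2⁻¹ p)) * conj (fourierMode L m (velMap 2⁻¹ (-2⁻¹) p))
    ∂(collisionMeasure d R Φ b) -
  ∫ p, conj (fourierMode L l (velMap 1 0 p)) ∂(collisionMeasure d R Φ b)

theorem integrable_conj_mode (hC : IsDensityBound d R Φ b C) (l : Fin d → ℤ) (α β : ℝ) :
    Integrable (fun p => conj (fourierMode L l (velMap α β p))) (collisionMeasure d R Φ b) := by
  have := isFiniteMeasure_collisionMeasure hC
  exact Integrable.of_bound (C := 1)
    (Complex.continuous_conj.comp ((continuous_fourierMode l).comp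
      (continuous_velMap _ _))).measurable.aestronglyMeasurable
    (Filter.Eventually.of_forall fun p => by simp [norm_fourierMode])

theorem integrable_conj_mode_mul (hC : IsDensityBound d R Φ b C) (l m : Fin d → ℤ)
    (α β α' β' : ℝ) :
    Integrable (fun p => conj (fourierMode L l (velMap α β p)) *
      conj (fourierMode L m (velMap α' β' p))) (collisionMeasure d R Φ b) := by
  have := isFiniteMeasure_collisionMeasure hC
  exact Integrable.of_bound (C := 1)
    ((Complex.continuous_conj.comp ((continuous_fourierMode l).comp
      (continuous_velMap _ _))).mul (Complex.continuous_conj.comp ((continuous_fourierMode m).comp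
      (continuous_velMap _ _)))).measurable.aestronglyMeasurable
    (Filter.Eventually.of_forall fun p => by simp [norm_fourierMode])

/-- Conservation of mass: the weights that feed the zeroth mode vanish, because `|q| σ` and `q` are
identically distributed. -/
theorem weight_neg (hB : KernelAssumptions d L R Φ b) (l : Fin d → ℤ) :
    weight L R Φ b l (-l) = 0 := by
  have h1 : ∀ p : Vel d × UnitSphere d, conj (fourierMode L l (velMap 2⁻¹ 2⁻¹ p)) *
      conj (fourierMode L (-l) (velMap 2⁻¹ (-2⁻¹) p)) = conj (fourierMode L l (velMap 0 1 p)) := by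
    intro p
    have : velMap 0 1 p = velMap 2⁻¹ 2⁻¹ p - velMap 2⁻¹ (-2⁻¹) p := by
      simp only [velMap]; module
    rw [this, fourierMode_sub, conj_fourierMode l (velMap 2⁻¹ (-2⁻¹) p), map_mul]
  have h2 : ∀ α β : ℝ, ∫ p, conj (fourierMode L l (velMap α β p)) ∂(collisionMeasure d R Φ b) =
      ∫ z, conj (fourierMode L l z) ∂((collisionMeasure d R Φ b).map (velMap α β)) := by
    intro α β
    rw [integral_map (continuous_velMap α β).measurable.aemeasurable]
    exact (Complex.continuous_conj.comp (continuous_fourierMode l)).aestronglyMeasurable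
  rw [weight]
  simp only [h1]
  rw [h2, h2, map_velMap_swap hB, sub_self]

/-- The collision operator applied to trigonometric polynomials. -/
theorem ofReal_collision (hB : KernelAssumptions d L R Φ b) (hC : IsDensityBound d R Φ b C)
    (hg : IsTrig L S g) (hf : IsTrig L S f) (v : Vel d) :
    (collision R Φ b g f v : ℂ) = ∑ p ∈ S ×ˢ S,
      rcoeff L g p.1 * rcoeff L f p.2 * weight L R Φ b p.1 p.2 * fourierMode L (p.1 + p.2) v := by
  have hL := L_pos hB
  rw [collision_eq hB hC (hg.periodicContinuous hL) (hf.periodicContinuous hL)]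
  have h1 : (gain R Φ b g f v : ℂ) = ∑ p ∈ S ×ˢ S,
      rcoeff L g p.1 * rcoeff L f p.2 * (∫ x, conj (fourierMode L p.1 (velMap 2⁻¹ 2⁻¹ x)) *
        conj (fourierMode L p.2 (velMap 2⁻¹ (-2⁻¹) x)) ∂(collisionMeasure d R Φ b)) *
        fourierMode L (p.1 + p.2) v := by
    rw [gain, ← integral_complex_ofReal]
    have : ∀ x : Vel d × UnitSphere d, ((g (v - velMap 2⁻¹ 2⁻¹ x) *
        f (v - velMap 2⁻¹ (-2⁻¹) x) : ℝ) : ℂ) = ∑ p ∈ S ×ˢ S,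
        (rcoeff L g p.1 * rcoeff L f p.2 * fourierMode L (p.1 + p.2) v) *
        (conj (fourierMode L p.1 (velMap 2⁻¹ 2⁻¹ x)) *
          conj (fourierMode L p.2 (velMap 2⁻¹ (-2⁻¹) x))) := by
      intro x
      rw [Complex.ofReal_mul, hg, hf, Finset.sum_mul_sum, Finset.sum_product]
      refine Finset.sum_congr rfl fun k _ => Finset.sum_congr rfl fun l _ => ?_
      rw [fourierMode_sub, fourierMode_sub, fourierMode_add_index]
      ring
    simp only [this]
    rw [integral_finsetSum _ fun p _ => (integrable_conj_mode_mul hC _ _ _ _ _ _).const_mul _]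
    refine Finset.sum_congr rfl fun p _ => ?_
    rw [integral_const_mul]
    ring
  have h2 : ((lossFreq R Φ b g v * f v : ℝ) : ℂ) = ∑ p ∈ S ×ˢ S,
      rcoeff L g p.1 * rcoeff L f p.2 *
        (∫ x, conj (fourierMode L p.1 (velMap 1 0 x)) ∂(collisionMeasure d R Φ b)) *
        fourierMode L (p.1 + p.2) v := by
    rw [Complex.ofReal_mul, hf v, lossFreq, ← integral_complex_ofReal]
    have : ∀ x : Vel d × UnitSphere d, ((g (v - velMap 1 0 x) : ℝ) : ℂ) = ∑ k ∈ S,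
        (rcoeff L g k * fourierMode L k v) * conj (fourierMode L k (velMap 1 0 x)) := by
      intro x
      rw [hg]
      refine Finset.sum_congr rfl fun k _ => ?_
      rw [fourierMode_sub]
      ring
    simp only [this]
    rw [integral_finsetSum _ fun p _ => (integrable_conj_mode hC _ _ _).const_mul _,
      Finset.sum_mul_sum, Finset.sum_product]
    refine Finset.sum_congr rfl fun k _ => Finset.sum_congr rfl fun l _ => ?_
    rw [integral_const_mul, fourierMode_add_index]
    ring
  rw [Complex.ofReal_sub, h1, h2, ← Finset.sum_sub_distrib]
  refine Finset.sum_congr rfl fun p _ => ?_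
  rw [weight]
  ring

theorem rcoeff_collision (hB : KernelAssumptions d L R Φ b) (hC : IsDensityBound d R Φ b C)
    (hg : IsTrig L S g) (hf : IsTrig L S f) (n : Fin d → ℤ) :
    rcoeff L (collision R Φ b g f) n = ∑ p ∈ S ×ˢ S, if p.1 + p.2 = n then
      rcoeff L g p.1 * rcoeff L f p.2 * weight L R Φ b p.1 p.2 else 0 := by
  rw [rcoeff, funext (ofReal_collision hB hC hg hf),
    coeff_sum_fourierMode (L_pos hB) _ (fun p : (Fin d → ℤ) × (Fin d → ℤ) => p.1 + p.2)]

theorem isTrig_collision (hB : KernelAssumptions d L R Φ b) (hC : IsDensityBound d R Φ b C)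
    (hg : IsTrig L S g) (hf : IsTrig L S f) : IsTrig L (S + S) (collision R Φ b g f) := by
  intro v
  simp only [rcoeff_collision hB hC hg hf, Finset.sum_mul]
  rw [ofReal_collision hB hC hg hf, Finset.sum_comm]
  refine Finset.sum_congr rfl fun p hp => ?_
  rw [Finset.mem_product] at hp
  simp only [ite_mul, zero_mul]
  rw [Finset.sum_ite_eq, if_pos (Finset.add_mem_add hp.1 hp.2)]

/-- The collision operator has integral zero. -/
theorem rcoeff_collision_zero (hB : KernelAssumptions d L R Φ b) (hC : IsDensityBound d R Φ b C)
    (hf : IsTrig L S f) : rcoeff L (collision R Φ b f f) 0 = 0 := by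
  rw [rcoeff_collision hB hC hf hf]
  refine Finset.sum_eq_zero fun p _ => ?_
  split_ifs with h
  · rw [← neg_eq_of_add_eq_zero_right h, weight_neg hB, mul_zero]
  · rfl

theorem periodicContinuous_collision (hB : KernelAssumptions d L R Φ b)
    (hC : IsDensityBound d R Φ b C) (hg : PeriodicContinuous L g) (hf : PeriodicContinuous L f) :
    PeriodicContinuous L (collision R Φ b g f) := by
  rw [funext (collision_eq hB hC hg hf)]
  exact (periodicContinuous_gain hB hC hg hf).sub ((periodicContinuous_lossFreq hB hC hg).mul hf)

theorem lpNorm_le_mul_of_abs_le {c : ℝ} (hc : 0 ≤ c) {F : Vel d → ℝ} (hf : PeriodicContinuous L f)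
    {p : ℝ≥0∞} (h : ∀ v, |F v| ≤ c * |f v|) :
    lpNorm F p (boxMeasure d L) ≤ c * lpNorm f p (boxMeasure d L) := by
  refine (lpNorm_mono_real ((hf.abs.const_mul c).memLp p) h).trans ?_
  have := lpNorm_const_smul (p := p) c (fun v => |f v|) (boxMeasure d L)
  simp only [Pi.smul_def, smul_eq_mul] at this
  rw [this, coe_nnnorm, Real.norm_of_nonneg hc, lpNorm_fun_abs hf.continuous.aestronglyMeasurable]

/-- The quadratic estimate on which all growth bounds rest: the collision operator is bounded in
`L²`, with the first factor measured in `L¹` only. -/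
theorem lpNorm_collision_le (hB : KernelAssumptions d L R Φ b)
    (hC : IsDensityBound d R Φ b C) (hg : PeriodicContinuous L g) (hf : PeriodicContinuous L f) :
    lpNorm (collision R Φ b g f) 2 (boxMeasure d L) ≤
      2 * C * lpNorm g 1 (boxMeasure d L) * lpNorm f 2 (boxMeasure d L) := by
  have h1 := lpNorm_gain_le hB hC hg hf
  have h2 : lpNorm (fun v => lossFreq R Φ b g v * f v) 2 (boxMeasure d L) ≤
      C * lpNorm g 1 (boxMeasure d L) * lpNorm f 2 (boxMeasure d L) := by
    refine lpNorm_le_mul_of_abs_le (mul_nonneg hC.pos.le lpNorm_nonneg) hf fun v => ?_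
    rw [abs_mul]
    exact mul_le_mul_of_nonneg_right (abs_lossFreq_le hB hC hg v) (abs_nonneg _)
  rw [funext (collision_eq hB hC hg hf)]
  have h3 := lpNorm_sub_le ((periodicContinuous_gain hB hC hg hf).memLp 2) (p := 2) (by norm_num)
    (g := fun v => lossFreq R Φ b g v * f v)
  have h4 : (fun v => gain R Φ b g f v - lossFreq R Φ b g v * f v) =
    gain R Φ b g f - fun v => lossFreq R Φ b g v * f v := rfl
  rw [h4]
  linarith

/-! ### Partial derivatives -/

/-- The `j`-th partial derivative. -/
noncomputable def pderiv (j : Fin d) (f : Vel d → ℝ) (v : Vel d) : ℝ :=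
  fderiv ℝ f v (EuclideanSpace.single j 1)

theorem IsTrig.contDiff (hf : IsTrig L S f) : ContDiff ℝ (⊤ : ℕ∞) f := by
  rw [funext hf.eq_re]
  refine Complex.reCLM.contDiff.comp (ContDiff.sum fun k _ => contDiff_const.mul ?_)
  unfold fourierMode
  refine (contDiff_const.mul (Complex.ofRealCLM.contDiff.comp (contDiff_const.mul
    (ContDiff.sum fun j _ => contDiff_const.mul ?_)))).cexp
  exact (EuclideanSpace.proj (𝕜 := ℝ) j).contDiff

theorem ofReal_pderiv (hf : IsTrig L S f) (j : Fin d) (v : Vel d) :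
    (pderiv j f v : ℂ) = ∑ k ∈ S,
      (Complex.I * ((Real.pi / L * k j : ℝ) : ℂ) * rcoeff L f k) * fourierMode L k v := by
  let e : Vel d := EuclideanSpace.single j 1
  have h1 : HasDerivAt (fun s : ℝ => ((f (v + s • e) : ℝ) : ℂ)) (pderiv j f v : ℂ) 0 := by
    have hd : DifferentiableAt ℝ f (v + (0 : ℝ) • e) :=
      (hf.contDiff.differentiable (by simp)).differentiableAt
    have hl : HasDerivAt (fun s : ℝ => v + s • e) e 0 := by
      simpa using ((hasDerivAt_id (0 : ℝ)).smul_const e).const_add v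
    have := hd.hasFDerivAt.comp_hasDerivAt (0 : ℝ) hl
    rw [zero_smul, add_zero] at this
    exact this.ofReal_comp
  have h2 : HasDerivAt (fun s : ℝ => ((f (v + s • e) : ℝ) : ℂ)) (∑ k ∈ S,
      (Complex.I * ((Real.pi / L * k j : ℝ) : ℂ) * rcoeff L f k) * fourierMode L k v) 0 := by
    have : (fun s : ℝ => ((f (v + s • e) : ℝ) : ℂ)) = fun s => ∑ k ∈ S,
        (rcoeff L f k * fourierMode L k v) *
          Complex.exp (Complex.I * (((Real.pi / L * k j) * s : ℝ) : ℂ)) := by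
      ext s
      rw [hf]
      refine Finset.sum_congr rfl fun k _ => ?_
      have he : s • e = EuclideanSpace.single j s := by
        ext i; simp [e, PiLp.single_apply]
      rw [he, fourierMode_add, fourierMode_single, mul_assoc, mul_assoc (Real.pi / L)]
    rw [this]
    refine HasDerivAt.fun_sum fun k _ => ?_
    have h3 : HasDerivAt (fun s : ℝ => Complex.I * (((Real.pi / L * k j) * s : ℝ) : ℂ))
        (Complex.I * ((Real.pi / L * k j : ℝ) : ℂ)) 0 := by
      have := (((hasDerivAt_id (0 : ℝ)).const_mul (Real.pi / L * k j)).ofReal_comp).const_mul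
        Complex.I
      simpa using this
    have h4 := (h3.cexp).const_mul (rcoeff L f k * fourierMode L k v)
    have h5 : rcoeff L f k * fourierMode L k v *
        (Complex.exp (Complex.I * (((Real.pi / L * k j) * (0 : ℝ) : ℝ) : ℂ)) *
          (Complex.I * ((Real.pi / L * k j : ℝ) : ℂ))) =
        (Complex.I * ((Real.pi / L * k j : ℝ) : ℂ) * rcoeff L f k) * fourierMode L k v := by
      rw [mul_zero, Complex.ofReal_zero, mul_zero, Complex.exp_zero]
      ring
    rw [h5] at h4
    exact h4
  exact h1.unique h2

theorem isTrig_pderiv (hL : 0 < L) (hf : IsTrig L S f) (j : Fin d) : IsTrig L S (pderiv j f) :=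
  (isTrig_of_sum hL (ofReal_pderiv hf j)).1

theorem rcoeff_pderiv (hL : 0 < L) (hf : IsTrig L S f) (j : Fin d) (k : Fin d → ℤ) :
    rcoeff L (pderiv j f) k = Complex.I * ((Real.pi / L * k j : ℝ) : ℂ) * rcoeff L f k := by
  by_cases hk : k ∈ S
  · exact (isTrig_of_sum hL (ofReal_pderiv hf j)).2 k hk
  · rw [(isTrig_pderiv hL hf j).coeff_eq_zero hL hk, hf.coeff_eq_zero hL hk, mul_zero]

/-- The Leibniz rule for the collision operator, on the level of Fourier coefficients. -/
theorem rcoeff_collision_pderiv (hB : KernelAssumptions d L R Φ b) (hC : IsDensityBound d R Φ b C)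
    (hf : IsTrig L S f) (j : Fin d) (n : Fin d → ℤ) :
    rcoeff L (collision R Φ b (pderiv j f) f) n + rcoeff L (collision R Φ b f (pderiv j f)) n =
      Complex.I * ((Real.pi / L * n j : ℝ) : ℂ) * rcoeff L (collision R Φ b f f) n := by
  have hp := isTrig_pderiv (L_pos hB) hf j
  rw [rcoeff_collision hB hC hp hf, rcoeff_collision hB hC hf hp, rcoeff_collision hB hC hf hf,
    Finset.mul_sum, ← Finset.sum_add_distrib]
  refine Finset.sum_congr rfl fun p _ => ?_
  split_ifs with h
  · rw [rcoeff_pderiv (L_pos hB) hf, rcoeff_pderiv (L_pos hB) hf, ← h, Pi.add_apply]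
    push_cast
    ring
  · simp

/-- The derivative of `Q(f, f)`, written as `Q(∂_j f, f) + Q(f, ∂_j f)`. -/
noncomputable def collisionDeriv (R : ℝ) (Φ b : ℝ → ℝ) (j : Fin d) (f : Vel d → ℝ) (v : Vel d) :
    ℝ :=
  collision R Φ b (pderiv j f) f v + collision R Φ b f (pderiv j f) v

theorem isTrig_add (hL : 0 < L) (hg : IsTrig L S g) (hf : IsTrig L S f) :
    IsTrig L S (fun v => g v + f v) ∧
      ∀ k, rcoeff L (fun v => g v + f v) k = rcoeff L g k + rcoeff L f k := by
  have h := isTrig_of_sum hL (S := S) (f := fun v => g v + f v)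
    (c := fun k => rcoeff L g k + rcoeff L f k) fun v => by
      rw [Complex.ofReal_add, hg v, hf v, ← Finset.sum_add_distrib]
      exact Finset.sum_congr rfl fun k _ => by ring
  refine ⟨h.1, fun k => ?_⟩
  by_cases hk : k ∈ S
  · exact h.2 k hk
  · rw [h.1.coeff_eq_zero hL hk, hg.coeff_eq_zero hL hk, hf.coeff_eq_zero hL hk, add_zero]

theorem isTrig_collisionDeriv (hB : KernelAssumptions d L R Φ b) (hC : IsDensityBound d R Φ b C)
    (hf : IsTrig L S f) (j : Fin d) : IsTrig L (S + S) (collisionDeriv R Φ b j f) :=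
  (isTrig_add (L_pos hB) (isTrig_collision hB hC (isTrig_pderiv (L_pos hB) hf j) hf)
    (isTrig_collision hB hC hf (isTrig_pderiv (L_pos hB) hf j))).1

theorem rcoeff_collisionDeriv (hB : KernelAssumptions d L R Φ b) (hC : IsDensityBound d R Φ b C)
    (hf : IsTrig L S f) (j : Fin d) (n : Fin d → ℤ) :
    rcoeff L (collisionDeriv R Φ b j f) n =
      Complex.I * ((Real.pi / L * n j : ℝ) : ℂ) * rcoeff L (collision R Φ b f f) n := by
  rw [← rcoeff_collision_pderiv hB hC hf]
  exact (isTrig_add (L_pos hB) (isTrig_collision hB hC (isTrig_pderiv (L_pos hB) hf j) hf)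
    (isTrig_collision hB hC hf (isTrig_pderiv (L_pos hB) hf j))).2 n

theorem lpNorm_collisionDeriv_le (hB : KernelAssumptions d L R Φ b)
    (hC : IsDensityBound d R Φ b C) (hf : IsTrig L S f) (j : Fin d) :
    lpNorm (collisionDeriv R Φ b j f) 2 (boxMeasure d L) ≤
      2 * C * lpNorm (pderiv j f) 1 (boxMeasure d L) * lpNorm f 2 (boxMeasure d L) +
      2 * C * lpNorm f 1 (boxMeasure d L) * lpNorm (pderiv j f) 2 (boxMeasure d L) := by
  have hp := (isTrig_pderiv (L_pos hB) hf j).periodicContinuous (L_pos hB)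
  have hf' := hf.periodicContinuous (L_pos hB)
  exact (lpNorm_add_le ((periodicContinuous_collision hB hC hp hf').memLp 2) (by norm_num)).trans
    (add_le_add (lpNorm_collision_le hB hC hp hf') (lpNorm_collision_le hB hC hf' hp))

/-! ### The Fourier projection -/

/-- The Fourier projection of a real-valued function, as a real-valued function. -/
noncomputable def rproj (L : ℝ) (N : ℕ) (g : Vel d → ℝ) (v : Vel d) : ℝ :=
  (proj L N (fun w => (g w : ℂ)) v).re

theorem ofReal_rproj (N : ℕ) (g : Vel d → ℝ) (v : Vel d) :
    (rproj L N g v : ℂ) = proj L N (fun w => (g w : ℂ)) v :=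
  ofReal_re_sum (fun _ => neg_mem_modes) (fun k _ => coeff_neg_index g k) v

theorem isTrig_rproj (hL : 0 < L) (N : ℕ) (g : Vel d → ℝ) :
    IsTrig L (modes d N) (rproj L N g) ∧
      ∀ k ∈ modes d N, rcoeff L (rproj L N g) k = rcoeff L g k :=
  isTrig_of_sum hL fun v => ofReal_rproj N g v

theorem IsTrig.lpNorm_sub_rproj_sq (hL : 0 < L) (N : ℕ) (hg : IsTrig L S g) :
    lpNorm (fun v => g v - rproj L N g v) 2 (boxMeasure d L) ^ 2 =
      (2 * L) ^ d * ∑ k ∈ S \ modes d N, ‖rcoeff L g k‖ ^ 2 := by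
  have h := isTrig_of_sum hL (S := S \ modes d N) (f := fun v => g v - rproj L N g v)
    (c := rcoeff L g) fun v => by
      have h1 : ∑ k ∈ S ∩ modes d N, rcoeff L g k * fourierMode L k v =
          ∑ k ∈ modes d N, rcoeff L g k * fourierMode L k v :=
        Finset.sum_subset Finset.inter_subset_right fun k hk hk' => by
          have : k ∉ S := fun h => hk' (Finset.mem_inter.2 ⟨h, hk⟩)
          rw [hg.coeff_eq_zero hL this, zero_mul]
      have h2 := Finset.sum_sdiff_eq_sub (f := fun k => rcoeff L g k * fourierMode L k v)
        (Finset.inter_subset_left (s₁ := S) (s₂ := modes d N))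
      rw [Finset.sdiff_inter_self_left] at h2
      rw [h2, h1, Complex.ofReal_sub, hg v, ofReal_rproj]
      rfl
  rw [h.1.lpNorm_sq hL]
  congr 1
  exact Finset.sum_congr rfl fun k hk => by rw [h.2 k hk]

theorem IsTrig.lpNorm_rproj_le (hL : 0 < L) (N : ℕ) (hg : IsTrig L S g) :
    lpNorm (rproj L N g) 2 (boxMeasure d L) ≤ lpNorm g 2 (boxMeasure d L) := by
  refine (sq_le_sq₀ lpNorm_nonneg lpNorm_nonneg).1 ?_
  have h := isTrig_rproj hL N g
  rw [h.1.lpNorm_sq hL, hg.lpNorm_sq hL]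
  refine mul_le_mul_of_nonneg_left ?_ (by positivity)
  calc ∑ k ∈ modes d N, ‖rcoeff L (rproj L N g) k‖ ^ 2
      = ∑ k ∈ modes d N, ‖rcoeff L g k‖ ^ 2 :=
        Finset.sum_congr rfl fun k hk => by rw [h.2 k hk]
    _ = ∑ k ∈ modes d N ∩ S, ‖rcoeff L g k‖ ^ 2 := by
        refine (Finset.sum_subset Finset.inter_subset_left fun k hk hk' => ?_).symm
        have : k ∉ S := fun h => hk' (Finset.mem_inter.2 ⟨hk, h⟩)
        rw [hg.coeff_eq_zero hL this]; simp
    _ ≤ ∑ k ∈ S, ‖rcoeff L g k‖ ^ 2 :=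
        Finset.sum_le_sum_of_subset_of_nonneg Finset.inter_subset_right
          fun _ _ _ => sq_nonneg _

/-- Frequencies above the cut-off are controlled by derivatives. -/
theorem sq_le_sum_sq_of_notMem_modes {N : ℕ} {k : Fin d → ℤ} (hk : k ∉ modes d N) :
    (((N : ℝ) + 1) / 2) ^ 2 ≤ ∑ j, (k j : ℝ) ^ 2 := by
  simp only [modes, Fintype.mem_piFinset, not_forall] at hk
  obtain ⟨j, hj⟩ := hk
  rw [Finset.mem_Icc, not_and_or] at hj
  refine le_trans ?_ (Finset.single_le_sum (f := fun j => (k j : ℝ) ^ 2)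
    (fun _ _ => sq_nonneg _) (Finset.mem_univ j))
  have h : (N : ℤ) + 1 ≤ 2 * |k j| := by
    have h0 := abs_nonneg (k j)
    rcases hj with hj | hj
    · have := neg_le_abs (k j); omega
    · have := le_abs_self (k j); omega
  have h' : (N : ℝ) + 1 ≤ 2 * |(k j : ℝ)| := by exact_mod_cast h
  rw [← sq_abs (k j : ℝ)]
  exact pow_le_pow_left₀ (by positivity) (by linarith) 2

/-- The spectral error of the projection, for a trigonometric polynomial whose derivatives are
`h j`. -/
theorem IsTrig.lpNorm_sub_rproj_le (hL : 0 < L) (N : ℕ) (hg : IsTrig L S g)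
    {h : Fin d → Vel d → ℝ} (hh : ∀ j, IsTrig L S (h j))
    (hgh : ∀ j k, rcoeff L (h j) k = Complex.I * ((Real.pi / L * k j : ℝ) : ℂ) * rcoeff L g k)
    {A : ℝ} (hA : 0 ≤ A) (hhA : ∀ j, lpNorm (h j) 2 (boxMeasure d L) ≤ A) :
    lpNorm (fun v => g v - rproj L N g v) 2 (boxMeasure d L) ≤
      2 * L / Real.pi * d * A / (N + 1) := by
  have hpi := Real.pi_pos
  refine (sq_le_sq₀ lpNorm_nonneg (by positivity)).1 ?_
  set c : ℝ := 2 * L / (Real.pi * (N + 1)) with hc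
  have hV : (0 : ℝ) ≤ (2 * L) ^ d := by positivity
  calc lpNorm (fun v => g v - rproj L N g v) 2 (boxMeasure d L) ^ 2
      = (2 * L) ^ d * ∑ k ∈ S \ modes d N, ‖rcoeff L g k‖ ^ 2 := hg.lpNorm_sub_rproj_sq hL N
    _ ≤ (2 * L) ^ d * ∑ k ∈ S \ modes d N, c ^ 2 * ∑ j, ‖rcoeff L (h j) k‖ ^ 2 := by
        refine mul_le_mul_of_nonneg_left (Finset.sum_le_sum fun k hk => ?_) hV
        have h1 := sq_le_sum_sq_of_notMem_modes (Finset.mem_sdiff.1 hk).2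
        have h2 : ∀ j, ‖rcoeff L (h j) k‖ ^ 2 =
            (Real.pi / L) ^ 2 * ‖rcoeff L g k‖ ^ 2 * (k j : ℝ) ^ 2 := by
          intro j
          rw [hgh, norm_mul, norm_mul, Complex.norm_I, one_mul, Complex.norm_real, Real.norm_eq_abs,
            mul_pow, sq_abs, mul_pow]
          ring
        simp only [h2]
        rw [← Finset.mul_sum]
        have h3 : c ^ 2 * ((Real.pi / L) ^ 2 * ‖rcoeff L g k‖ ^ 2 * ((((N : ℝ) + 1) / 2) ^ 2)) =
            ‖rcoeff L g k‖ ^ 2 := by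
          rw [hc]; field_simp
        rw [← h3]
        gcongr
        rw [h3]
    _ ≤ (2 * L) ^ d * ∑ k ∈ S, c ^ 2 * ∑ j, ‖rcoeff L (h j) k‖ ^ 2 := by
        refine mul_le_mul_of_nonneg_left ?_ hV
        exact Finset.sum_le_sum_of_subset_of_nonneg Finset.sdiff_subset
          fun _ _ _ => mul_nonneg (sq_nonneg _) (Finset.sum_nonneg fun _ _ => sq_nonneg _)
    _ = c ^ 2 * ∑ j, lpNorm (h j) 2 (boxMeasure d L) ^ 2 := by
        simp only [fun j => (hh j).lpNorm_sq hL]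
        rw [← Finset.mul_sum, ← Finset.mul_sum, Finset.sum_comm]
        ring
    _ ≤ c ^ 2 * ∑ _j : Fin d, A ^ 2 := by
        refine mul_le_mul_of_nonneg_left (Finset.sum_le_sum fun j _ => ?_) (sq_nonneg c)
        exact pow_le_pow_left₀ lpNorm_nonneg (hhA j) 2
    _ ≤ (2 * L / Real.pi * d * A / (N + 1)) ^ 2 := by
        rw [Finset.sum_const, Finset.card_univ, Fintype.card_fin, nsmul_eq_mul]
        have hd : (d : ℝ) ≤ (d : ℝ) ^ 2 := by
          have : d ≤ d ^ 2 := Nat.le_self_pow two_ne_zero d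
          exact_mod_cast this
        have : (2 * L / Real.pi * d * A / (N + 1)) ^ 2 = c ^ 2 * ((d : ℝ) ^ 2 * A ^ 2) := by
          rw [hc]; field_simp
        rw [this]
        gcongr

/-! ### Trigonometric polynomials in the Sobolev space -/

theorem IsTrig.hasWeakPartial (hL : 0 < L) (hf : IsTrig L S f) (i : Fin d) :
    HasWeakPartial i f (pderiv i f) := by
  have hfc := (hf.periodicContinuous hL).continuous
  have hpc := ((isTrig_pderiv hL hf i).periodicContinuous hL).continuous
  refine ⟨hfc.locallyIntegrable, hpc.locallyIntegrable, fun φ hφ hφc => ?_⟩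
  have hφ' : Continuous fun v => fderiv ℝ φ v (EuclideanSpace.single i 1) :=
    (hφ.continuous_fderiv (by simp)).clm_apply continuous_const
  have hφ'c : HasCompactSupport fun v => fderiv ℝ φ v (EuclideanSpace.single i 1) :=
    hφc.fderiv_apply (𝕜 := ℝ) (EuclideanSpace.single i 1)
  exact integral_mul_fderiv_eq_neg_fderiv_mul_of_integrable
    ((hpc.mul hφ.continuous).integrable_of_hasCompactSupport hφc.mul_left)
    ((hfc.mul hφ').integrable_of_hasCompactSupport hφ'c.mul_left)
    ((hfc.mul hφ.continuous).integrable_of_hasCompactSupport hφc.mul_left)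
    (fun x _ => (hf.contDiff.differentiable (by simp)).differentiableAt)
    (fun x _ => (hφ.differentiable (by simp)).differentiableAt)

theorem HasWeakPartial.ae_eq {i : Fin d} {g' : Vel d → ℝ} (h : HasWeakPartial i f g)
    (h' : HasWeakPartial i f g') : g =ᵐ[volume] g' := by
  refine ae_eq_of_integral_contDiff_smul_eq h.2.1 h'.2.1 fun φ hφ hφc => ?_
  have h1 := h.2.2 φ hφ hφc
  have h2 := h'.2.2 φ hφ hφc
  simp only [smul_eq_mul, mul_comm (φ _)]
  linarith

theorem IsTrig.weakPartial_ae_eq (hL : 0 < L) (hf : IsTrig L S f) (i : Fin d) :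
    weakPartial i f =ᵐ[volume] pderiv i f := by
  have h : ∃ g, HasWeakPartial i f g := ⟨_, hf.hasWeakPartial hL i⟩
  rw [weakPartial, dif_pos h]
  exact h.choose_spec.ae_eq (hf.hasWeakPartial hL i)

theorem IsTrig.memH1Per (hL : 0 < L) (hf : IsTrig L S f) : MemH1Per L f :=
  ⟨(hf.periodicContinuous hL).periodic, (hf.periodicContinuous hL).memLp 2, fun i =>
    ⟨_, hf.hasWeakPartial hL i, ((isTrig_pderiv hL hf i).periodicContinuous hL).memLp 2⟩⟩

theorem lpNorm_congr_ae' {α : Type*} [MeasurableSpace α] {μ : Measure α} {u w : α → ℝ}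
    (h : u =ᵐ[μ] w) (p : ℝ≥0∞) : lpNorm u p μ = lpNorm w p μ := by
  unfold lpNorm
  rw [eLpNorm_congr_ae h, aestronglyMeasurable_congr h]

theorem IsTrig.lpNorm_pderiv_le (hL : 0 < L) (hf : IsTrig L S f) (i : Fin d) :
    lpNorm (pderiv i f) 2 (boxMeasure d L) ≤ normH1 L f := by
  rw [← lpNorm_congr_ae' (ae_restrict_of_ae (hf.weakPartial_ae_eq hL i)), normH1]
  refine Real.le_sqrt_of_sq_le ?_
  have := Finset.single_le_sum (f := fun i => lpNorm (weakPartial i f) 2 (boxMeasure d L) ^ 2)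
    (fun _ _ => sq_nonneg _) (Finset.mem_univ i)
  have h2 := sq_nonneg (lpNorm f 2 (boxMeasure d L))
  linarith

/-! ### The Galerkin system for Fourier coefficients -/

/-- A solution of the Galerkin system on `[0, T]`, written as a family of trigonometric polynomials
whose Fourier coefficients satisfy a system of ordinary differential equations. -/
structure IsTraj (L R : ℝ) (Φ b : ℝ → ℝ) (N : ℕ) (T : ℝ) (f : ℝ → Vel d → ℝ) : Prop where
  trig : ∀ t ∈ Icc 0 T, IsTrig L (modes d N) (f t)
  deriv : ∀ t ∈ Icc 0 T, ∀ k ∈ modes d N, HasDerivWithinAt (fun s => rcoeff L (f s) k)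
    (rcoeff L (collision R Φ b (f t) (f t)) k) (Icc 0 T) t

/-- On trigonometric polynomials, each Fourier coefficient is a combination of finitely many point
evaluations. -/
theorem exists_coeff_eq_eval (hL : 0 < L) (S : Finset (Fin d → ℤ)) {k : Fin d → ℤ} (hk : k ∈ S) :
    ∃ c : Vel d →₀ ℂ, ∀ l ∈ S,
      ∑ v ∈ c.support, c v * fourierMode L l v = if l = k then 1 else 0 := by
  have hli : LinearIndependent ℂ fun l : S => fourierMode (d := d) L l := by
    rw [Fintype.linearIndependent_iff]
    intro c hc l
    have h := coeff_sum_fourierMode hL Finset.univ (fun l : S => (l : Fin d → ℤ)) c l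
    have h2 : (fun v => ∑ i, c i * fourierMode L (i : Fin d → ℤ) v) = fun _ => 0 := by
      ext v
      simpa using congrFun hc v
    rw [h2] at h
    simpa [coeff, Subtype.coe_inj] using h.symm
  have hspan := span_flip_eq_top_iff_linearIndependent.2 hli
  have hmem : (Pi.single ⟨k, hk⟩ 1 : S → ℂ) ∈ Submodule.span ℂ
      (range fun (v : Vel d) (l : S) => fourierMode L (l : Fin d → ℤ) v) :=
    Submodule.eq_top_iff'.1 hspan _
  obtain ⟨c, hc⟩ := Finsupp.mem_span_range_iff_exists_finsupp.1 hmem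
  refine ⟨c, fun l hl => ?_⟩
  have h := congrFun hc ⟨l, hl⟩
  rw [Finsupp.sum, Finset.sum_apply] at h
  simpa [Pi.single_apply] using h

theorem hasDerivWithinAt_Ici_of_Icc {E : Type*} [NormedAddCommGroup E] [NormedSpace ℝ E]
    {y : ℝ → E} {y' : E} {a c t : ℝ} (h : HasDerivWithinAt y y' (Icc a c) t) (ht : t ∈ Ico a c) :
    HasDerivWithinAt y y' (Ici t) t :=
  h.mono_of_mem_nhdsWithin (Icc_mem_nhdsGE_of_mem ht)

/-- Solutions of the Galerkin system stay trigonometric polynomials: their time derivative is one,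
and by evaluation at finitely many points it determines the coefficients. -/
theorem IsSolution.isTraj (hL : 0 < L) {N : ℕ} {T : ℝ} {f₀ : Vel d → ℝ} {f : ℝ → Vel d → ℝ}
    (h₀ : MemTrigPoly L N f₀) (h : IsSolution L R Φ b N f₀ T f) : IsTraj L R Φ b N T f := by
  choose! c hc using fun k hk => exists_coeff_eq_eval (k := k) hL (modes d N) hk
  rw [memTrigPoly_iff hL] at h₀
  let a : (Fin d → ℤ) → ℝ → ℂ := fun k t => ∑ v ∈ (c k).support, c k v * (f t v : ℂ)
  have ha : ∀ u : Vel d → ℂ, ∀ q : (Fin d → ℤ) → ℂ,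
      (∀ v, u v = ∑ l ∈ modes d N, q l * fourierMode L l v) → ∀ k ∈ modes d N,
        ∑ v ∈ (c k).support, c k v * u v = q k := by
    intro u q hu k hk
    simp only [hu, Finset.mul_sum]
    rw [Finset.sum_comm]
    calc _ = ∑ l ∈ modes d N, q l * ∑ v ∈ (c k).support, c k v * fourierMode L l v := by
          refine Finset.sum_congr rfl fun l _ => ?_
          rw [Finset.mul_sum]
          exact Finset.sum_congr rfl fun v _ => by ring
      _ = ∑ l ∈ modes d N, q l * if l = k then 1 else 0 :=
          Finset.sum_congr rfl fun l hl => by rw [hc k hk l hl]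
      _ = q k := by simp [hk]
  have hderiv : ∀ t ∈ Icc 0 T, ∀ k ∈ modes d N, HasDerivWithinAt (a k)
      (rcoeff L (collision R Φ b (f t) (f t)) k) (Icc 0 T) t := by
    intro t ht k hk
    rw [rcoeff, ← ha (proj L N fun w => (collision R Φ b (f t) (f t) w : ℂ)) _ (fun v => rfl) k hk]
    exact HasDerivWithinAt.fun_sum fun v _ => (h.eqn t ht v).const_mul (c k v)
  have hrep : ∀ t ∈ Icc 0 T, ∀ v, (f t v : ℂ) = ∑ k ∈ modes d N, a k t * fourierMode L k v := by
    intro t ht v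
    have hd : ∀ s ∈ Icc 0 T, HasDerivWithinAt
        (fun s => (f s v : ℂ) - ∑ k ∈ modes d N, a k s * fourierMode L k v) 0 (Icc 0 T) s := by
      intro s hs
      have h1 := (h.eqn s hs v).sub (HasDerivWithinAt.fun_sum fun k hk =>
        (hderiv s hs k hk).mul_const (fourierMode L k v))
      have h2 : proj L N (fun w => (collision R Φ b (f s) (f s) w : ℂ)) v -
          ∑ k ∈ modes d N, rcoeff L (collision R Φ b (f s) (f s)) k * fourierMode L k v = 0 :=
        sub_self _
      rw [h2] at h1
      exact h1
    have hconst := constant_of_has_deriv_right_zero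
      (fun s hs => (hd s hs).continuousWithinAt)
      (fun s hs => hasDerivWithinAt_Ici_of_Icc (hd s (Ico_subset_Icc_self hs)) hs) t ht
    have h0 : ∀ k ∈ modes d N, a k 0 = rcoeff L f₀ k := by
      intro k hk
      simp only [a, h.init]
      exact ha (fun v => (f₀ v : ℂ)) _ h₀ k hk
    have h3 : (f 0 v : ℂ) - ∑ k ∈ modes d N, a k 0 * fourierMode L k v = 0 := by
      rw [h.init, h₀ v, sub_eq_zero]
      exact Finset.sum_congr rfl fun k hk => by rw [h0 k hk]
    rw [h3] at hconst
    exact sub_eq_zero.1 hconst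
  refine ⟨fun t ht => (isTrig_of_sum hL (hrep t ht)).1, fun t ht k hk => ?_⟩
  exact (hderiv t ht k hk).congr (fun s hs => (isTrig_of_sum hL (hrep s hs)).2 k hk)
    ((isTrig_of_sum hL (hrep t ht)).2 k hk)

theorem IsTraj.hasDerivWithinAt {N : ℕ} {T : ℝ} {f : ℝ → Vel d → ℝ}
    (h : IsTraj L R Φ b N T f) {t : ℝ} (ht : t ∈ Icc 0 T) (v : Vel d) :
    HasDerivWithinAt (fun s => (f s v : ℂ))
      (proj L N (fun w => (collision R Φ b (f t) (f t) w : ℂ)) v) (Icc 0 T) t := by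
  have h1 : HasDerivWithinAt (fun s => ∑ k ∈ modes d N, rcoeff L (f s) k * fourierMode L k v)
      (proj L N (fun w => (collision R Φ b (f t) (f t) w : ℂ)) v) (Icc 0 T) t :=
    HasDerivWithinAt.fun_sum fun k hk => (h.deriv t ht k hk).mul_const _
  exact h1.congr (fun s hs => h.trig s hs v) (h.trig t ht v)

/-- Trajectories in coefficients solve the Galerkin system pointwise in `v`. -/
theorem IsTraj.isSolution (hL : 0 < L) {N : ℕ} {T : ℝ} {f : ℝ → Vel d → ℝ}
    (h : IsTraj L R Φ b N T f) : IsSolution L R Φ b N (f 0) T f where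
  memL1 t ht := ((h.trig t ht).periodicContinuous hL).memLp 1
  memH1 t ht := (h.trig t ht).memH1Per hL
  init := rfl
  eqn _ ht v := h.hasDerivWithinAt ht v

/-! ### Gronwall estimates -/

/-- The vector of the Fourier coefficients with frequencies up to the cut-off. -/
noncomputable def coeffVec (L : ℝ) (N : ℕ) (g : Vel d → ℝ) : EuclideanSpace ℂ (modes d N) :=
  WithLp.toLp 2 fun k => rcoeff L g k

theorem norm_coeffVec_sq (N : ℕ) (g : Vel d → ℝ) :
    ‖coeffVec L N g‖ ^ 2 = ∑ k ∈ modes d N, ‖rcoeff L g k‖ ^ 2 := by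
  rw [EuclideanSpace.norm_sq_eq, ← Finset.sum_coe_sort (modes d N)]
  rfl

theorem lpNorm_eq_coeffVec (hL : 0 < L) {N : ℕ} (hg : IsTrig L (modes d N) g) :
    lpNorm g 2 (boxMeasure d L) = √((2 * L) ^ d) * ‖coeffVec L N g‖ := by
  have hV : (0 : ℝ) ≤ (2 * L) ^ d := by positivity
  refine (pow_left_inj₀ lpNorm_nonneg (by positivity) two_ne_zero).1 ?_
  rw [hg.lpNorm_sq hL, mul_pow (√_), Real.sq_sqrt hV, norm_coeffVec_sq]

/-- Bessel's inequality. -/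
theorem coeffVec_le_lpNorm (hL : 0 < L) (N : ℕ) (hg : IsTrig L S g) :
    √((2 * L) ^ d) * ‖coeffVec L N g‖ ≤ lpNorm g 2 (boxMeasure d L) := by
  have h := isTrig_rproj hL N g
  have : coeffVec L N (rproj L N g) = coeffVec L N g := by
    unfold coeffVec
    congr 1
    ext k
    exact h.2 k k.2
  rw [← this, ← lpNorm_eq_coeffVec hL h.1]
  exact hg.lpNorm_rproj_le hL N

theorem hasDerivWithinAt_coeffVec {N : ℕ} {F : ℝ → Vel d → ℝ} {G : Vel d → ℝ} {s : Set ℝ} {t : ℝ}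
    (h : ∀ k ∈ modes d N, HasDerivWithinAt (fun s => rcoeff L (F s) k) (rcoeff L G k) s t) :
    HasDerivWithinAt (fun s => coeffVec L N (F s)) (coeffVec L N G) s t := by
  have h1 : HasDerivWithinAt (fun s (k : modes d N) => rcoeff L (F s) k)
      (fun k : modes d N => rcoeff L G k) s t := hasDerivWithinAt_pi.2 fun k => h k k.2
  exact ((EuclideanSpace.equiv (modes d N) ℂ).symm.toContinuousLinearMap.restrictScalars
    ℝ).hasFDerivAt.comp_hasDerivWithinAt t h1

/-- Exponential growth bound for a family of trigonometric polynomials that evolves by the Fourier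
projection of `G t`. -/
theorem lpNorm_le_exp_mul (hL : 0 < L) {N : ℕ} {T K : ℝ} {F G : ℝ → Vel d → ℝ}
    (hF : ∀ t ∈ Icc 0 T, IsTrig L (modes d N) (F t)) (hG : ∀ t ∈ Icc 0 T, IsTrig L S (G t))
    (hd : ∀ t ∈ Icc 0 T, ∀ k ∈ modes d N,
      HasDerivWithinAt (fun s => rcoeff L (F s) k) (rcoeff L (G t) k) (Icc 0 T) t)
    (hK : ∀ t ∈ Icc 0 T, lpNorm (G t) 2 (boxMeasure d L) ≤ K * lpNorm (F t) 2 (boxMeasure d L))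
    {t : ℝ} (ht : t ∈ Icc 0 T) :
    lpNorm (F t) 2 (boxMeasure d L) ≤ Real.exp (K * t) * lpNorm (F 0) 2 (boxMeasure d L) := by
  have hV : (0 : ℝ) < √((2 * L) ^ d) := by positivity
  have hy : ∀ t ∈ Icc 0 T, HasDerivWithinAt (fun s => coeffVec L N (F s)) (coeffVec L N (G t))
      (Icc 0 T) t := fun t ht => hasDerivWithinAt_coeffVec (hd t ht)
  have h := norm_le_gronwallBound_of_norm_deriv_right_le (K := K) (ε := 0)
    (fun t ht => (hy t ht).continuousWithinAt)
    (fun t ht => hasDerivWithinAt_Ici_of_Icc (hy t (Ico_subset_Icc_self ht)) ht) le_rfl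
    (fun t ht => by
      have ht' := Ico_subset_Icc_self ht
      have h1 := (coeffVec_le_lpNorm hL N (hG t ht')).trans (hK t ht')
      rw [lpNorm_eq_coeffVec hL (hF t ht'), mul_left_comm] at h1
      rw [add_zero]
      exact le_of_mul_le_mul_left h1 hV) t ht
  rw [gronwallBound_ε0, sub_zero] at h
  rw [lpNorm_eq_coeffVec hL (hF t ht), lpNorm_eq_coeffVec hL (hF 0 ⟨le_rfl, ht.1.trans ht.2⟩)]
  calc _ ≤ √((2 * L) ^ d) * (‖coeffVec L N (F 0)‖ * Real.exp (K * t)) := by gcongr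
    _ = _ := by ring

/-- Under an `L¹` bound the quadratic estimate becomes linear in the `L²` norm, so that Gronwall
applies. -/
theorem IsTraj.lpNorm_two_le (hB : KernelAssumptions d L R Φ b) (hC : IsDensityBound d R Φ b C)
    {N : ℕ} {T M : ℝ} {f : ℝ → Vel d → ℝ} (h : IsTraj L R Φ b N T f)
    (hM : ∀ t ∈ Icc 0 T, lpNorm (f t) 1 (boxMeasure d L) ≤ M) {t : ℝ} (ht : t ∈ Icc 0 T) :
    lpNorm (f t) 2 (boxMeasure d L) ≤
      Real.exp (T * (2 * C) * M) * lpNorm (f 0) 2 (boxMeasure d L) := by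
  have hL := L_pos hB
  have hM0 : 0 ≤ M := lpNorm_nonneg.trans (hM t ht)
  have h1 := lpNorm_le_exp_mul (K := 2 * C * M) hL h.trig
    (fun t ht => isTrig_collision hB hC (h.trig t ht) (h.trig t ht)) h.deriv
    (fun t ht => by
      have hp := (h.trig t ht).periodicContinuous hL
      refine (lpNorm_collision_le hB hC hp hp).trans ?_
      have := hC.pos
      have := hM t ht
      gcongr
      exact lpNorm_nonneg) ht
  refine h1.trans (mul_le_mul_of_nonneg_right (Real.exp_le_exp.2 ?_) lpNorm_nonneg)
  have : 2 * C * M * t ≤ 2 * C * M * T :=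
    mul_le_mul_of_nonneg_left ht.2 (by have := hC.pos; positivity)
  linarith

/-- Growth of the derivatives: `∂_j f` evolves by the projection of `∂_j Q(f, f)`. -/
theorem IsTraj.lpNorm_pderiv_le (hB : KernelAssumptions d L R Φ b)
    (hC : IsDensityBound d R Φ b C) {N : ℕ} {T K : ℝ} {f : ℝ → Vel d → ℝ}
    (h : IsTraj L R Φ b N T f) (j : Fin d)
    (hK : ∀ t ∈ Icc 0 T, lpNorm (collisionDeriv R Φ b j (f t)) 2 (boxMeasure d L) ≤
      K * lpNorm (pderiv j (f t)) 2 (boxMeasure d L)) {t : ℝ} (ht : t ∈ Icc 0 T) :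
    lpNorm (pderiv j (f t)) 2 (boxMeasure d L) ≤
      Real.exp (K * t) * lpNorm (pderiv j (f 0)) 2 (boxMeasure d L) := by
  have hL := L_pos hB
  refine lpNorm_le_exp_mul hL (F := fun t => pderiv j (f t))
    (G := fun t => collisionDeriv R Φ b j (f t))
    (fun t ht => isTrig_pderiv hL (h.trig t ht) j)
    (fun t ht => isTrig_collisionDeriv hB hC (h.trig t ht) j) (fun t ht k hk => ?_) hK ht
  rw [rcoeff_collisionDeriv hB hC (h.trig t ht)]
  exact ((h.deriv t ht k hk).const_mul _).congr
    (fun s hs => rcoeff_pderiv hL (h.trig s hs) j k) (rcoeff_pderiv hL (h.trig t ht) j k)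

/-! ### Comparison of norms and conservation of mass -/

theorem PeriodicContinuous.lpNorm_one_le (hL : 0 < L) (hf : PeriodicContinuous L f) :
    lpNorm f 1 (boxMeasure d L) ≤ √((2 * L) ^ d) * lpNorm f 2 (boxMeasure d L) := by
  have h := eLpNorm_le_eLpNorm_mul_rpow_measure_univ (μ := boxMeasure d L) (p := 1) (q := 2)
    (by norm_num) (f := f) hf.continuous.aestronglyMeasurable
  have hV : (0 : ℝ) ≤ (2 * L) ^ d := by positivity
  rw [Measure.restrict_apply_univ, volume_box d hL, ← ofReal_lpNorm (hf.memLp 1),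
    ← ofReal_lpNorm (hf.memLp 2)] at h
  norm_num at h
  rw [ENNReal.ofReal_rpow_of_nonneg (by positivity) (by norm_num),
    ← ENNReal.ofReal_mul lpNorm_nonneg,
    ENNReal.ofReal_le_ofReal_iff (mul_nonneg lpNorm_nonneg (by positivity))] at h
  rw [Real.sqrt_eq_rpow, mul_comm]
  exact h

/-- The negative part of a function. -/
def negPart (f : Vel d → ℝ) (v : Vel d) : ℝ := max (-f v) 0

/-- The positive part of a function. -/
def posPart (f : Vel d → ℝ) (v : Vel d) : ℝ := max (f v) 0

theorem negPart_nonneg (f : Vel d → ℝ) (v : Vel d) : 0 ≤ negPart f v := le_max_right _ _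

theorem PeriodicContinuous.negPart (hf : PeriodicContinuous L f) :
    PeriodicContinuous L (negPart f) := hf.neg.max_zero

theorem PeriodicContinuous.posPart (hf : PeriodicContinuous L f) :
    PeriodicContinuous L (posPart f) := hf.max_zero

theorem abs_posPart_le (f : Vel d → ℝ) (v : Vel d) : |posPart f v| ≤ |f v| := by
  unfold posPart
  rw [abs_of_nonneg (le_max_right _ _)]
  exact max_le (le_abs_self _) (abs_nonneg _)

theorem abs_eq_add_negPart (f : Vel d → ℝ) (v : Vel d) : |f v| = f v + 2 * negPart f v := by
  unfold negPart
  rcases le_total 0 (f v) with h | h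
  · rw [abs_of_nonneg h, max_eq_right (by linarith)]; ring
  · rw [abs_of_nonpos h, max_eq_left (by linarith)]; ring

theorem PeriodicContinuous.integrable (hf : PeriodicContinuous L f) :
    Integrable f (boxMeasure d L) := memLp_one_iff_integrable.1 (hf.memLp 1)

/-- Once the mass is fixed, the `L¹` norm is controlled by the negative part alone. -/
theorem lpNorm_one_eq_add_negPart (hf : PeriodicContinuous L f) :
    lpNorm f 1 (boxMeasure d L) =
      (∫ v in box d L, f v) + 2 * lpNorm (negPart f) 1 (boxMeasure d L) := by
  rw [lpNorm_one_eq_integral_norm hf.continuous.aestronglyMeasurable,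
    lpNorm_one_eq_integral_norm hf.negPart.continuous.aestronglyMeasurable]
  have h : ∀ v, ‖negPart f v‖ = negPart f v := fun v => Real.norm_of_nonneg (le_max_right _ _)
  simp only [h, Real.norm_eq_abs, abs_eq_add_negPart]
  rw [integral_add hf.integrable (hf.negPart.integrable.const_mul 2), integral_const_mul]

theorem lpNorm_mono_abs {p : ℝ≥0∞} {F : Vel d → ℝ} (hf : PeriodicContinuous L f)
    (h : ∀ v, |F v| ≤ |f v|) : lpNorm F p (boxMeasure d L) ≤ lpNorm f p (boxMeasure d L) := by
  simpa using lpNorm_le_mul_of_abs_le (p := p) zero_le_one hf (F := F) (by simpa using h)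

theorem integral_box_eq (hL : 0 < L) (g : Vel d → ℝ) :
    ((∫ v in box d L, g v : ℝ) : ℂ) = ((2 * L : ℝ) ^ d : ℂ) * rcoeff L g 0 := by
  have : ((2 * L : ℝ) ^ d : ℂ) ≠ 0 := by
    have : (2 * L : ℝ) ^ d ≠ 0 := by positivity
    exact_mod_cast this
  rw [rcoeff, coeff, mul_inv_cancel_left₀ this, ← integral_complex_ofReal]
  simp [fourierMode_zero]

theorem zero_mem_modes (N : ℕ) : (0 : Fin d → ℤ) ∈ modes d N := by
  simp only [modes, Fintype.mem_piFinset, Finset.mem_Icc, Pi.zero_apply]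
  intro i
  omega

/-- Conservation of mass: the zeroth Fourier coefficient does not move. -/
theorem IsTraj.integral_eq (hB : KernelAssumptions d L R Φ b) (hC : IsDensityBound d R Φ b C)
    {N : ℕ} {T : ℝ} {f : ℝ → Vel d → ℝ} (h : IsTraj L R Φ b N T f) {t : ℝ} (ht : t ∈ Icc 0 T) :
    ∫ v in box d L, f t v = ∫ v in box d L, f 0 v := by
  have hL := L_pos hB
  have hd : ∀ s ∈ Icc 0 T, HasDerivWithinAt (fun s => rcoeff L (f s) 0) 0 (Icc 0 T) s := by
    intro s hs
    have := h.deriv s hs 0 (zero_mem_modes N)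
    rwa [rcoeff_collision_zero hB hC (h.trig s hs)] at this
  have hconst := constant_of_has_deriv_right_zero (fun s hs => (hd s hs).continuousWithinAt)
    (fun s hs => hasDerivWithinAt_Ici_of_Icc (hd s (Ico_subset_Icc_self hs)) hs) t ht
  apply Complex.ofReal_injective
  rw [integral_box_eq hL, integral_box_eq hL, hconst]

/-! ### Continuity in time -/

theorem isTrig_sub (hL : 0 < L) (hg : IsTrig L S g) (hf : IsTrig L S f) :
    IsTrig L S (fun v => g v - f v) ∧
      ∀ k ∈ S, rcoeff L (fun v => g v - f v) k = rcoeff L g k - rcoeff L f k :=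
  isTrig_of_sum hL fun v => by
    rw [Complex.ofReal_sub, hg v, hf v, ← Finset.sum_sub_distrib]
    exact Finset.sum_congr rfl fun k _ => by ring

theorem isTrig_const_mul (hL : 0 < L) (c : ℝ) (hf : IsTrig L S f) :
    IsTrig L S (fun v => c * f v) ∧
      ∀ k ∈ S, rcoeff L (fun v => c * f v) k = c * rcoeff L f k :=
  isTrig_of_sum hL fun v => by
    rw [Complex.ofReal_mul, hf v, Finset.mul_sum]
    exact Finset.sum_congr rfl fun k _ => by ring

theorem lpNorm_sub_eq_coeffVec (hL : 0 < L) {N : ℕ} (hg : IsTrig L (modes d N) g)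
    (hf : IsTrig L (modes d N) f) :
    lpNorm (fun v => g v - f v) 2 (boxMeasure d L) =
      √((2 * L) ^ d) * ‖coeffVec L N g - coeffVec L N f‖ := by
  have h := isTrig_sub hL hg hf
  rw [lpNorm_eq_coeffVec hL h.1]
  congr 2
  ext k
  exact h.2 k k.2

theorem IsTraj.continuousOn_coeffVec {N : ℕ} {T : ℝ} {f : ℝ → Vel d → ℝ}
    (h : IsTraj L R Φ b N T f) : ContinuousOn (fun s => coeffVec L N (f s)) (Icc 0 T) :=
  fun t ht => (hasDerivWithinAt_coeffVec (h.deriv t ht)).continuousWithinAt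

/-- A functional that is Lipschitz for the `L²` distance is continuous along a continuous family of
trigonometric polynomials. -/
theorem continuousOn_of_sub_le_lpNorm (hL : 0 < L) {N : ℕ} {s : Set ℝ} {f : ℝ → Vel d → ℝ}
    (hf : ∀ t ∈ s, IsTrig L (modes d N) (f t))
    (hc : ContinuousOn (fun t => coeffVec L N (f t)) s) {u : (Vel d → ℝ) → ℝ} {c : ℝ}
    (hu : ∀ g g', PeriodicContinuous L g → PeriodicContinuous L g' →
      u g - u g' ≤ c * lpNorm (fun v => g v - g' v) 2 (boxMeasure d L)) :
    ContinuousOn (fun t => u (f t)) s := by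
  intro t ht
  have h1 := ((hc t ht).sub
    (continuousWithinAt_const (b := coeffVec L N (f t)))).norm.const_mul (c * √((2 * L) ^ d))
  refine tendsto_iff_norm_sub_tendsto_zero.2 ?_
  have h2 : Filter.Tendsto (fun r => c * √((2 * L) ^ d) *
      ‖coeffVec L N (f r) - coeffVec L N (f t)‖) (nhdsWithin t s) (nhds 0) := by
    simpa [ContinuousWithinAt] using h1
  refine squeeze_zero' (Filter.Eventually.of_forall fun _ => norm_nonneg _) ?_ h2
  filter_upwards [self_mem_nhdsWithin] with r hr
  have hs' := (hf r hr).periodicContinuous hL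
  have ht' := (hf t ht).periodicContinuous hL
  have e1 := hu _ _ hs' ht'
  have e2 := hu _ _ ht' hs'
  rw [lpNorm_sub_eq_coeffVec hL (hf r hr) (hf t ht), ← mul_assoc] at e1
  rw [lpNorm_sub_eq_coeffVec hL (hf t ht) (hf r hr), ← mul_assoc, norm_sub_rev] at e2
  rw [Real.norm_eq_abs, abs_le]
  constructor <;> linarith

theorem lpNorm_sub_le_lpNorm_sub {p : ℝ≥0∞} (hp : 1 ≤ p) (hg : PeriodicContinuous L g)
    (hf : PeriodicContinuous L f) :
    lpNorm g p (boxMeasure d L) - lpNorm f p (boxMeasure d L) ≤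
      lpNorm (fun v => g v - f v) p (boxMeasure d L) := by
  have h := lpNorm_add_le ((hg.sub hf).memLp p) (g := f) hp
  have : (fun v => g v - f v) + f = g := by ext v; simp
  rw [this] at h
  linarith

theorem lpNorm_negPart_sub_le (hg : PeriodicContinuous L g) (hf : PeriodicContinuous L f) :
    lpNorm (negPart g) 2 (boxMeasure d L) - lpNorm (negPart f) 2 (boxMeasure d L) ≤
      1 * lpNorm (fun v => g v - f v) 2 (boxMeasure d L) := by
  refine (lpNorm_sub_le_lpNorm_sub (by norm_num) hg.negPart hf.negPart).trans ?_
  refine lpNorm_le_mul_of_abs_le zero_le_one (hg.sub hf) fun v => ?_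
  have := abs_max_sub_max_le_abs (-g v) (-f v) 0
  rw [neg_sub_neg, abs_sub_comm (f v)] at this
  rw [one_mul]
  exact this

theorem continuousOn_lpNorm_one (hL : 0 < L) {N : ℕ} {s : Set ℝ} {f : ℝ → Vel d → ℝ}
    (hf : ∀ t ∈ s, IsTrig L (modes d N) (f t))
    (hc : ContinuousOn (fun t => coeffVec L N (f t)) s) :
    ContinuousOn (fun t => lpNorm (f t) 1 (boxMeasure d L)) s :=
  continuousOn_of_sub_le_lpNorm hL hf hc (u := fun g => lpNorm g 1 (boxMeasure d L))
    fun _ _ hg hf => (lpNorm_sub_le_lpNorm_sub le_rfl hg hf).trans ((hg.sub hf).lpNorm_one_le hL)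

/-! ### The negative part -/

/-- The part of the gain term in which exactly one of the two factors is negative. -/
noncomputable def mixedGain (R : ℝ) (Φ b : ℝ → ℝ) (f : Vel d → ℝ) (v : Vel d) : ℝ :=
  gain R Φ b (posPart f) (negPart f) v + gain R Φ b (negPart f) (posPart f) v

theorem periodicContinuous_mixedGain (hB : KernelAssumptions d L R Φ b)
    (hC : IsDensityBound d R Φ b C) (hf : PeriodicContinuous L f) :
    PeriodicContinuous L (mixedGain R Φ b f) :=
  (periodicContinuous_gain hB hC hf.posPart hf.negPart).add
    (periodicContinuous_gain hB hC hf.negPart hf.posPart)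

/-- Products of two factors of equal sign contribute nonnegatively to the gain term. -/
theorem neg_mixedGain_le_gain (hB : KernelAssumptions d L R Φ b) (hC : IsDensityBound d R Φ b C)
    (hf : PeriodicContinuous L f) (v : Vel d) : -mixedGain R Φ b f v ≤ gain R Φ b f f v := by
  have h1 := integrable_gain hB hC hf hf v
  have h2 := integrable_gain hB hC hf.posPart hf.negPart v
  have h3 := integrable_gain hB hC hf.negPart hf.posPart v
  have h23 : Integrable (fun p =>
      posPart f (v - velMap 2⁻¹ 2⁻¹ p) * negPart f (v - velMap 2⁻¹ (-2⁻¹) p) +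
      negPart f (v - velMap 2⁻¹ 2⁻¹ p) * posPart f (v - velMap 2⁻¹ (-2⁻¹) p))
      (collisionMeasure d R Φ b) := h2.add h3
  have h : 0 ≤ gain R Φ b f f v + mixedGain R Φ b f v := by
    rw [mixedGain, gain, gain, gain, ← integral_add h2 h3, ← integral_add h1 h23]
    refine integral_nonneg fun p => ?_
    have key : ∀ x y : ℝ, 0 ≤ x * y + (max x 0 * max (-y) 0 + max (-x) 0 * max y 0) := by
      intro x y
      rcases le_total 0 x with hx | hx <;> rcases le_total 0 y with hy | hy
      · rw [max_eq_right (neg_nonpos.2 hx), max_eq_right (neg_nonpos.2 hy)]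
        nlinarith
      · rw [max_eq_right (neg_nonpos.2 hx), max_eq_left hx, max_eq_left (neg_nonneg.2 hy)]
        nlinarith
      · rw [max_eq_left (neg_nonneg.2 hx), max_eq_right hx, max_eq_left hy]
        nlinarith
      · rw [max_eq_right hx, max_eq_right hy]
        nlinarith [mul_nonneg_of_nonpos_of_nonpos hx hy]
    exact key _ _
  linarith

theorem mixedGain_nonneg (f : Vel d → ℝ) (v : Vel d) : 0 ≤ mixedGain R Φ b f v :=
  add_nonneg (integral_nonneg fun _ => mul_nonneg (le_max_right _ _) (le_max_right _ _))
    (integral_nonneg fun _ => mul_nonneg (le_max_right _ _) (le_max_right _ _))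

/-- In the mixed gain term the negative part enters linearly: either through its `L²` norm, or
through its `L¹` norm, which Cauchy–Schwarz bounds by the `L²` norm. -/
theorem lpNorm_mixedGain_le (hB : KernelAssumptions d L R Φ b) (hC : IsDensityBound d R Φ b C)
    (hf : PeriodicContinuous L f) :
    lpNorm (mixedGain R Φ b f) 2 (boxMeasure d L) ≤
      C * (lpNorm f 1 (boxMeasure d L) + √((2 * L) ^ d) * lpNorm f 2 (boxMeasure d L)) *
        lpNorm (negPart f) 2 (boxMeasure d L) := by
  have hL := L_pos hB
  have h1 := lpNorm_gain_le hB hC hf.posPart hf.negPart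
  have h2 := lpNorm_gain_le hB hC hf.negPart hf.posPart
  have h3 := lpNorm_add_le ((periodicContinuous_gain hB hC hf.posPart hf.negPart).memLp 2)
    (g := gain R Φ b (negPart f) (posPart f)) (p := 2) (by norm_num)
  have h4 := lpNorm_mono_abs (p := 1) hf (abs_posPart_le f)
  have h5 := lpNorm_mono_abs (p := 2) hf (abs_posPart_le f)
  have h6 := hf.negPart.lpNorm_one_le hL
  have hC0 := hC.pos.le
  have hn := lpNorm_nonneg (f := negPart f) (p := 2) (μ := boxMeasure d L)
  refine h3.trans ((add_le_add h1 h2).trans ?_)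
  calc _ ≤ C * lpNorm f 1 (boxMeasure d L) * lpNorm (negPart f) 2 (boxMeasure d L) +
        C * (√((2 * L) ^ d) * lpNorm (negPart f) 2 (boxMeasure d L)) *
          lpNorm f 2 (boxMeasure d L) := by
        gcongr
        exact lpNorm_nonneg
    _ = _ := by ring

/-- One step of the evolution increases the negative part only through the loss term, the mixed
part of the gain term, the projection error `e` and the remainder `ρ`. -/
theorem negPart_step_le {x y lam G gn e rho h Λ : ℝ} (hh : 0 ≤ h) (hlam : |lam| ≤ Λ)
    (hhΛ : h * Λ ≤ 1) (hG : 0 ≤ G) (hgn : -G ≤ gn)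
    (hy : y = x + h * (gn - lam * x + e) + rho) :
    max (-y) 0 ≤ (1 + h * Λ) * max (-x) 0 + h * G + h * |e| + |rho| := by
  obtain ⟨hl1, hl2⟩ := abs_le.1 hlam
  have hΛ : 0 ≤ Λ := (abs_nonneg _).trans hlam
  have hn : 0 ≤ max (-x) 0 := le_max_right _ _
  have hx : -x ≤ max (-x) 0 := le_max_left _ _
  have hhl : h * lam ≤ 1 := (mul_le_mul_of_nonneg_left hl2 hh).trans hhΛ
  refine max_le ?_ (by positivity)
  have h1 : -x * (1 - h * lam) ≤ max (-x) 0 * (1 + h * Λ) := by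
    refine (mul_le_mul_of_nonneg_right hx (by linarith)).trans
      (mul_le_mul_of_nonneg_left ?_ hn)
    nlinarith
  have h2 : -(h * gn) ≤ h * G := by nlinarith
  have h3 : -(h * e) ≤ h * |e| := by nlinarith [neg_abs_le e]
  have h4 := neg_abs_le rho
  rw [hy]
  nlinarith

/-- Growth of the `L²` norm of the negative part. -/
theorem IsTraj.lpNorm_negPart_le (hB : KernelAssumptions d L R Φ b)
    (hC : IsDensityBound d R Φ b C) {N : ℕ} {T K Λ G ε : ℝ} {f : ℝ → Vel d → ℝ}
    (h : IsTraj L R Φ b N T f) (hΛ : ∀ t ∈ Icc 0 T, ∀ v, |lossFreq R Φ b (f t) v| ≤ Λ)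
    (hG : ∀ t ∈ Icc 0 T, lpNorm (mixedGain R Φ b (f t)) 2 (boxMeasure d L) ≤
      G * lpNorm (negPart (f t)) 2 (boxMeasure d L))
    (hε : ∀ t ∈ Icc 0 T, lpNorm (fun v => collision R Φ b (f t) (f t) v -
      rproj L N (collision R Φ b (f t) (f t)) v) 2 (boxMeasure d L) ≤ ε)
    (hK : Λ + G ≤ K) {t : ℝ} (ht : t ∈ Icc 0 T) :
    lpNorm (negPart (f t)) 2 (boxMeasure d L) ≤
      gronwallBound (lpNorm (negPart (f 0)) 2 (boxMeasure d L)) K ε t := by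
  have hL := L_pos hB
  have hV : (0 : ℝ) < √((2 * L) ^ d) := by positivity
  set u : ℝ → ℝ := fun t => lpNorm (negPart (f t)) 2 (boxMeasure d L) with hu
  have hu0 : ∀ t, 0 ≤ u t := fun t => lpNorm_nonneg
  have hcont : ContinuousOn u (Icc 0 T) :=
    continuousOn_of_sub_le_lpNorm hL h.trig h.continuousOn_coeffVec
      (u := fun g => lpNorm (negPart g) 2 (boxMeasure d L))
      fun _ _ hg hf => lpNorm_negPart_sub_le hg hf
  have hmain := le_gronwallBound_of_liminf_deriv_right_le (f := u)
    (f' := fun t => (Λ + G) * u t + ε) (δ := u 0) (K := K) (ε := ε) hcont ?_ le_rfl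
    (fun x _ => by
      have := mul_le_mul_of_nonneg_right hK (hu0 x)
      linarith) t ht
  · rwa [sub_zero] at hmain
  intro x hx r hr
  have hx' := Ico_subset_Icc_self hx
  refine Filter.Eventually.frequently ?_
  have hfx := h.trig x hx'
  have hpx := hfx.periodicContinuous hL
  set Q := collision R Φ b (f x) (f x) with hQ
  have hQtrig := isTrig_rproj hL N Q
  have hQpc : PeriodicContinuous L Q := periodicContinuous_collision hB hC hpx hpx
  -- the remainder of the first-order expansion in time is small in `L²`
  have hη : 0 < (r - ((Λ + G) * u x + ε)) / 2 := by linarith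
  set η := (r - ((Λ + G) * u x + ε)) / 2 with hη_def
  have hder := hasDerivWithinAt_Ici_of_Icc (hasDerivWithinAt_coeffVec (h.deriv x hx')) hx
  have hlit := (hasDerivWithinAt_iff_isLittleO.1 hder).def (div_pos hη hV)
  have hlit' := hlit.filter_mono (nhdsWithin_mono x (Ioi_subset_Ici_self))
  have hIcc : ∀ᶠ z in nhdsWithin x (Ioi x), z ∈ Icc 0 T :=
    (Ioo_mem_nhdsGT hx.2 : Ioo x T ∈ nhdsWithin x (Ioi x)) |> fun h => by
      filter_upwards [h] with z hz using ⟨hx.1.trans hz.1.le, hz.2.le⟩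
  have hsmall : ∀ᶠ z in nhdsWithin x (Ioi x), (z - x) * Λ ≤ 1 := by
    have : Filter.Tendsto (fun z => (z - x) * Λ) (nhdsWithin x (Ioi x)) (nhds ((x - x) * Λ)) :=
      ((continuous_id.sub continuous_const).mul continuous_const).continuousAt.tendsto.mono_left
        nhdsWithin_le_nhds
    rw [sub_self, zero_mul] at this
    exact (this.eventually (gt_mem_nhds zero_lt_one)).mono fun _ h => le_of_lt h
  filter_upwards [hlit', hIcc, hsmall, self_mem_nhdsWithin] with z hz hzI hzs hzx
  have hzx' : 0 < z - x := sub_pos.2 hzx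
  have hfz := h.trig z hzI
  have hpz := hfz.periodicContinuous hL
  let e : Vel d → ℝ := fun v => rproj L N Q v - Q v
  let rho : Vel d → ℝ := fun v => (f z v - f x v) - (z - x) * rproj L N Q v
  have hs1 := isTrig_sub hL hfz hfx
  have hs2 := isTrig_const_mul hL (z - x) hQtrig.1
  have hs3 := isTrig_sub hL hs1.1 hs2.1
  have hrho : lpNorm rho 2 (boxMeasure d L) ≤ η * (z - x) := by
    have h1 : lpNorm rho 2 (boxMeasure d L) = √((2 * L) ^ d) *
        ‖coeffVec L N (f z) - coeffVec L N (f x) - (z - x) • coeffVec L N Q‖ := by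
      rw [lpNorm_eq_coeffVec hL hs3.1]
      congr 2
      ext k
      change rcoeff L _ _ = rcoeff L _ _ - rcoeff L _ _ - (z - x) • rcoeff L _ _
      rw [hs3.2 k k.2, hs1.2 k k.2, hs2.2 k k.2, hQtrig.2 k k.2, Complex.real_smul]
    rw [h1]
    have h2 := mul_le_mul_of_nonneg_left hz hV.le
    rw [Real.norm_of_nonneg hzx'.le] at h2
    refine h2.trans (le_of_eq ?_)
    field_simp
  have hepc : PeriodicContinuous L e := (hQtrig.1.periodicContinuous hL).sub hQpc
  have he : lpNorm e 2 (boxMeasure d L) ≤ ε := by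
    refine le_trans (le_of_eq ?_) (hε x hx')
    exact lpNorm_sub_comm _ _ _ _
  have hrpc : PeriodicContinuous L rho := hs3.1.periodicContinuous hL
  have hGpc := periodicContinuous_mixedGain hB hC hpx
  have hstep : ∀ v, negPart (f z) v ≤ (1 + (z - x) * Λ) * negPart (f x) v +
      (z - x) * mixedGain R Φ b (f x) v + (z - x) * |e v| + |rho v| := by
    intro v
    refine negPart_step_le hzx'.le (hΛ x hx' v) hzs (mixedGain_nonneg _ v)
      (neg_mixedGain_le_gain hB hC hpx v) ?_
    have := collision_eq hB hC hpx hpx v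
    simp only [e, rho, hQ]
    rw [← this]
    ring
  have hcm : ∀ (c : ℝ) (F : Vel d → ℝ), 0 ≤ c → PeriodicContinuous L F →
      lpNorm (fun v => c * F v) 2 (boxMeasure d L) ≤ c * lpNorm F 2 (boxMeasure d L) :=
    fun c F hc hF => lpNorm_le_mul_of_abs_le hc hF fun v => by rw [abs_mul, abs_of_nonneg hc]
  have habs : ∀ F : Vel d → ℝ, PeriodicContinuous L F →
      lpNorm (fun v => |F v|) 2 (boxMeasure d L) = lpNorm F 2 (boxMeasure d L) :=
    fun F hF => lpNorm_fun_abs hF.continuous.aestronglyMeasurable 2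
  have hΛ0 : 0 ≤ Λ := (abs_nonneg _).trans (hΛ x hx' 0)
  have hc1 : 0 ≤ 1 + (z - x) * Λ := by positivity
  have p1 := hpx.negPart.const_mul (1 + (z - x) * Λ)
  have p2 := hGpc.const_mul (z - x)
  have p3 := hepc.abs.const_mul (z - x)
  have p4 := hrpc.abs
  have huz : u z ≤ (1 + (z - x) * Λ) * u x + (z - x) * (G * u x) + (z - x) * ε + η * (z - x) := by
    have q1 := lpNorm_mono_real (f := negPart (f z)) ((((p1.add p2).add p3).add p4).memLp 2)
      fun v => by
        rw [Real.norm_of_nonneg (negPart_nonneg _ _)]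
        exact hstep v
    have q2 := lpNorm_add_le (((p1.add p2).add p3).memLp 2) (g := fun v => |rho v|) (p := 2)
      (by norm_num)
    have q3 := lpNorm_add_le ((p1.add p2).memLp 2) (g := fun v => (z - x) * |e v|) (p := 2)
      (by norm_num)
    have q4 := lpNorm_add_le (p1.memLp 2) (g := fun v => (z - x) * mixedGain R Φ b (f x) v)
      (p := 2) (by norm_num)
    have r1 := hcm _ _ hc1 hpx.negPart
    have r2 := (hcm _ _ hzx'.le hGpc).trans (mul_le_mul_of_nonneg_left (hG x hx') hzx'.le)
    have r3 := (hcm _ _ hzx'.le hepc.abs).trans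
      (mul_le_mul_of_nonneg_left ((habs e hepc).le.trans he) hzx'.le)
    have r4 := (habs rho hrpc).le.trans hrho
    refine q1.trans (q2.trans (add_le_add (q3.trans (add_le_add (q4.trans (add_le_add r1 r2)) r3))
      r4))
  rw [inv_mul_lt_iff₀ hzx']
  have : u z - u x ≤ (z - x) * ((Λ + G) * u x + ε + η) := by linarith
  refine this.trans_lt (mul_lt_mul_of_pos_left ?_ hzx')
  rw [hη_def]
  linarith

/-! ### A priori bound in `L¹` -/

/-- The bootstrap step: as long as `‖f‖_{L¹} ≤ 2m` and the initial negative part is small, the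
strict inequality `‖f‖_{L¹} < 2m` holds, for all large cut-offs `N`. The second bound on `δ`
covers the initial time. -/
theorem exists_apriori (hB : KernelAssumptions d L R Φ b) (hC : IsDensityBound d R Φ b C)
    {m A₂ A₃ T : ℝ} (hm : 0 < m) (hA₂ : 0 ≤ A₂) (hA₃ : 0 ≤ A₃) (hT : 0 ≤ T) :
    ∃ δ : ℝ, 0 < δ ∧ √((2 * L) ^ d) * δ ≤ m / 8 ∧ ∃ N₁ : ℕ, ∀ N, N₁ ≤ N →
      ∀ (T' : ℝ) (f : ℝ → Vel d → ℝ), T' ≤ T → IsTraj L R Φ b N T' f → ∫ v in box d L, f 0 v = m →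
      lpNorm (f 0) 2 (boxMeasure d L) ≤ A₂ → normH1 L (f 0) ≤ A₃ →
      lpNorm (negPart (f 0)) 2 (boxMeasure d L) < δ →
      (∀ t ∈ Icc 0 T', lpNorm (f t) 1 (boxMeasure d L) ≤ 2 * m) →
      ∀ t ∈ Icc 0 T', lpNorm (f t) 1 (boxMeasure d L) < 2 * m := by
  have hL := L_pos hB
  have hC0 := hC.pos
  have hpi := Real.pi_pos
  set V : ℝ := √((2 * L) ^ d) with hV
  have hV0 : 0 < V := by positivity
  -- `B₂` bounds the `L²` norm on the whole time interval
  set B₂ : ℝ := Real.exp (T * (2 * C) * (2 * m)) * A₂ with hB₂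
  have hB₂0 : 0 ≤ B₂ := by positivity
  -- `K₃` is the growth rate of the derivatives, and `A` bounds those of the collision operator
  set K₃ : ℝ := 2 * C * V * B₂ + 2 * C * (2 * m) with hK₃
  have hK₃0 : 0 ≤ K₃ := by positivity
  set A : ℝ := K₃ * (Real.exp (K₃ * T) * A₃) with hA
  have hA0 : 0 ≤ A := by positivity
  -- rates at which the loss term and the mixed gain term increase the negative part
  set Λ : ℝ := C * (2 * m) with hΛ
  set G : ℝ := C * (2 * m + V * B₂) with hG
  set K : ℝ := Λ + G + 1 with hK
  have hK1 : 1 ≤ K := by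
    have : 0 ≤ Λ + G := by positivity
    linarith
  -- With initial negative part and spectral error below `m / (8M)`, the negative part has `L¹` norm
  -- at most `m / 4` up to time `T`, whence `‖f‖_{L¹} ≤ m + 2 · m / 4 < 2m`.
  set M : ℝ := V * Real.exp (K * T) with hM
  have hM0 : 0 < M := by positivity
  have hδ : 0 < m / (8 * M) := by positivity
  obtain ⟨N₁, hN₁⟩ := exists_nat_gt (2 * L / Real.pi * d * A / (m / (8 * M)))
  have hVδ : V * (m / (8 * M)) ≤ m / 8 := by
    have hexp : 1 ≤ Real.exp (K * T) := Real.one_le_exp (by positivity)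
    rw [hM, show V * (m / (8 * (V * Real.exp (K * T)))) = m / 8 / Real.exp (K * T) by field_simp]
    exact div_le_self (by positivity) hexp
  refine ⟨m / (8 * M), hδ, hVδ, N₁, fun N hN T' f hT' h hmass h2 hH1 hneg h1 t ht => ?_⟩
  have h0 : (0 : ℝ) ∈ Icc 0 T' := ⟨le_rfl, ht.1.trans ht.2⟩
  have hp : ∀ s ∈ Icc 0 T', PeriodicContinuous L (f s) := fun s hs =>
    (h.trig s hs).periodicContinuous hL
  have e2 : ∀ s ∈ Icc 0 T', lpNorm (f s) 2 (boxMeasure d L) ≤ B₂ := by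
    intro s hs
    refine (h.lpNorm_two_le hB hC h1 hs).trans ?_
    rw [hB₂]
    have hs2 := hs.2.trans hT'
    gcongr
    exact lpNorm_nonneg
  have e3 : ∀ j, ∀ s ∈ Icc 0 T', lpNorm (collisionDeriv R Φ b j (f s)) 2 (boxMeasure d L) ≤
      K₃ * lpNorm (pderiv j (f s)) 2 (boxMeasure d L) := by
    intro j s hs
    refine (lpNorm_collisionDeriv_le hB hC (h.trig s hs) j).trans ?_
    have i1 := ((isTrig_pderiv hL (h.trig s hs) j).periodicContinuous hL).lpNorm_one_le hL
    have i2 := h1 s hs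
    have i3 := e2 s hs
    have i4 := lpNorm_nonneg (f := pderiv j (f s)) (p := 2) (μ := boxMeasure d L)
    have i5 := lpNorm_nonneg (f := f s) (p := 2) (μ := boxMeasure d L)
    calc _ ≤ 2 * C * (V * lpNorm (pderiv j (f s)) 2 (boxMeasure d L)) * B₂ +
          2 * C * (2 * m) * lpNorm (pderiv j (f s)) 2 (boxMeasure d L) := by gcongr
      _ = _ := by rw [hK₃]; ring
  have e4 : ∀ j, ∀ s ∈ Icc 0 T', lpNorm (collisionDeriv R Φ b j (f s)) 2 (boxMeasure d L) ≤ A := by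
    intro j s hs
    refine (e3 j s hs).trans ?_
    rw [hA]
    refine mul_le_mul_of_nonneg_left ?_ hK₃0
    refine (h.lpNorm_pderiv_le hB hC j (e3 j) hs).trans ?_
    have := ((h.trig 0 h0).lpNorm_pderiv_le hL j).trans hH1
    have hs2 := hs.2.trans hT'
    gcongr
    exact lpNorm_nonneg
  have e5 : ∀ s ∈ Icc 0 T', lpNorm (fun v => collision R Φ b (f s) (f s) v -
      rproj L N (collision R Φ b (f s) (f s)) v) 2 (boxMeasure d L) ≤ m / (8 * M) := by
    intro s hs
    refine ((isTrig_collision hB hC (h.trig s hs) (h.trig s hs)).lpNorm_sub_rproj_le hL N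
      (fun j => isTrig_collisionDeriv hB hC (h.trig s hs) j)
      (fun j k => rcoeff_collisionDeriv hB hC (h.trig s hs) j k) hA0 (fun j => e4 j s hs)).trans ?_
    rw [div_le_iff₀ (by positivity)]
    rw [div_lt_iff₀ hδ] at hN₁
    have : (N₁ : ℝ) ≤ N + 1 := by
      have : (N₁ : ℝ) ≤ N := by exact_mod_cast hN
      linarith
    have := mul_le_mul_of_nonneg_right this hδ.le
    linarith
  have e6 := h.lpNorm_negPart_le hB hC (K := K) (Λ := Λ) (G := G)
    (fun s hs v => (abs_lossFreq_le hB hC (hp s hs) v).trans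
      (mul_le_mul_of_nonneg_left (h1 s hs) hC0.le))
    (fun s hs => (lpNorm_mixedGain_le hB hC (hp s hs)).trans (by
      have i2 := h1 s hs
      have i3 := e2 s hs
      have i4 := lpNorm_nonneg (f := negPart (f s)) (p := 2) (μ := boxMeasure d L)
      rw [hG]
      gcongr)) e5 (by linarith) ht
  have e7 : lpNorm (negPart (f t)) 2 (boxMeasure d L) ≤ Real.exp (K * T) * (m / (4 * M)) := by
    refine e6.trans ?_
    rw [gronwallBound_of_K_ne_0 (by linarith)]
    have i1 : Real.exp (K * t) ≤ Real.exp (K * T) := by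
      have := ht.2.trans hT'
      gcongr
    have i2 : m / (8 * M) / K ≤ m / (8 * M) := div_le_self hδ.le hK1
    have i3 := Real.exp_pos (K * t)
    have i4 : 0 ≤ m / (8 * M) / K := by positivity
    have i5 : m / (8 * M) / K * (Real.exp (K * t) - 1) ≤ m / (8 * M) * Real.exp (K * t) := by
      nlinarith
    have i6 : m / (4 * M) = m / (8 * M) + m / (8 * M) := by field_simp; norm_num
    have i7 := mul_le_mul_of_nonneg_right hneg.le i3.le
    have i8 := mul_le_mul_of_nonneg_right i1 hδ.le
    rw [i6]
    linarith
  have e8 := (hp t ht).negPart.lpNorm_one_le hL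
  rw [lpNorm_one_eq_add_negPart (hp t ht), h.integral_eq hB hC ht, hmass]
  have e9 : V * (Real.exp (K * T) * (m / (4 * M))) = m / 4 := by
    rw [hM]; field_simp
  have e10 := mul_le_mul_of_nonneg_left e7 hV0.le
  rw [e9] at e10
  linarith

/-! ### The Galerkin vector field -/

/-- The real-valued function with (not necessarily conjugate-symmetric) coefficient vector `a`. -/
noncomputable def realize (L : ℝ) (N : ℕ) (a : EuclideanSpace ℂ (modes d N)) (v : Vel d) : ℝ :=
  (∑ k : modes d N, a k * fourierMode L (k : Fin d → ℤ) v).re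

/-- The vector field of the Galerkin system in Fourier coefficients. -/
noncomputable def galerkinField (L R : ℝ) (Φ b : ℝ → ℝ) (N : ℕ)
    (a : EuclideanSpace ℂ (modes d N)) : EuclideanSpace ℂ (modes d N) :=
  coeffVec L N (collision R Φ b (realize L N a) (realize L N a))

/-- A real trigonometric polynomial is recovered from its coefficients. -/
theorem realize_coeffVec {N : ℕ} {g : Vel d → ℝ} (hg : IsTrig L (modes d N) g) :
    realize L N (coeffVec L N g) = g := by
  ext v
  rw [hg.eq_re v, realize, ← Finset.sum_coe_sort (modes d N)]
  rfl

/-- Taking the real part symmetrizes the coefficients; `true` indexes the mode itself and `false`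
its conjugate. -/
theorem ofReal_realize (N : ℕ) (a : EuclideanSpace ℂ (modes d N)) (v : Vel d) :
    (realize L N a v : ℂ) = ∑ p : modes d N × Bool,
      (if p.2 then 2⁻¹ * a p.1 else 2⁻¹ * conj (a p.1)) *
        fourierMode L (if p.2 then (p.1 : Fin d → ℤ) else -p.1) v := by
  rw [Fintype.sum_prod_type, realize, Complex.re_eq_add_conj, map_sum, ← Finset.sum_add_distrib,
    Finset.sum_div]
  refine Finset.sum_congr rfl fun k _ => ?_
  rw [map_mul, conj_fourierMode]
  simp
  ring

theorem rcoeff_realize (hL : 0 < L) (N : ℕ) (a : EuclideanSpace ℂ (modes d N)) (k : Fin d → ℤ) :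
    rcoeff L (realize L N a) k = ∑ p : modes d N × Bool,
      if (if p.2 then (p.1 : Fin d → ℤ) else -p.1) = k then
        (if p.2 then 2⁻¹ * a p.1 else 2⁻¹ * conj (a p.1)) else 0 := by
  rw [rcoeff, funext (ofReal_realize N a), coeff_sum_fourierMode hL]

theorem isTrig_realize (hL : 0 < L) (N : ℕ) (a : EuclideanSpace ℂ (modes d N)) :
    IsTrig L (modes d N) (realize L N a) := by
  intro v
  simp only [rcoeff_realize hL, Finset.sum_mul]
  rw [ofReal_realize, Finset.sum_comm]
  refine Finset.sum_congr rfl fun p _ => ?_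
  simp only [ite_mul, zero_mul]
  have hmem : (if p.2 then (p.1 : Fin d → ℤ) else -p.1) ∈ modes d N := by
    split_ifs
    exacts [p.1.2, neg_mem_modes p.1.2]
  rw [Finset.sum_ite_eq, if_pos hmem]

theorem contDiff_coord {N : ℕ} (k : modes d N) :
    ContDiff ℝ 1 fun a : EuclideanSpace ℂ (modes d N) => a k :=
  ((EuclideanSpace.proj (𝕜 := ℂ) k).restrictScalars ℝ).contDiff

theorem contDiff_rcoeff_realize (hL : 0 < L) (N : ℕ) (k : Fin d → ℤ) :
    ContDiff ℝ 1 fun a : EuclideanSpace ℂ (modes d N) => rcoeff L (realize L N a) k := by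
  simp only [rcoeff_realize hL]
  refine ContDiff.sum fun p _ => ?_
  split_ifs
  · exact contDiff_const.mul (contDiff_coord p.1)
  · exact contDiff_const
  · exact contDiff_const.mul (Complex.conjCLE.contDiff.comp (contDiff_coord p.1))
  · exact contDiff_const

theorem contDiff_galerkinField (hB : KernelAssumptions d L R Φ b) (hC : IsDensityBound d R Φ b C)
    (N : ℕ) : ContDiff ℝ 1 (galerkinField (d := d) L R Φ b N) := by
  have hL := L_pos hB
  have h : ContDiff ℝ 1 fun (a : EuclideanSpace ℂ (modes d N)) (k : modes d N) =>
      rcoeff L (collision R Φ b (realize L N a) (realize L N a)) k := by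
    refine contDiff_pi.2 fun k => ?_
    simp only [fun a => rcoeff_collision hB hC (isTrig_realize hL N a) (isTrig_realize hL N a)]
    refine ContDiff.sum fun p _ => ?_
    split_ifs
    · exact ((contDiff_rcoeff_realize hL N p.1).mul (contDiff_rcoeff_realize hL N p.2)).mul
        contDiff_const
    · exact contDiff_const
  exact ((EuclideanSpace.equiv (modes d N) ℂ).symm.toContinuousLinearMap.restrictScalars
    ℝ).contDiff.comp h

/-- The Galerkin vector field, cut off smoothly outside a ball, is bounded and Lipschitz. -/
theorem exists_truncation (hB : KernelAssumptions d L R Φ b) (hC : IsDensityBound d R Φ b C)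
    (N : ℕ) {ρ : ℝ} (hρ : 0 < ρ) :
    ∃ (χ : EuclideanSpace ℂ (modes d N) → ℝ) (K : NNReal) (M : NNReal),
      (∀ a, ‖a‖ ≤ ρ → χ a = 1) ∧ LipschitzWith K (fun a => χ a • galerkinField L R Φ b N a) ∧
        ∀ a, ‖χ a • galerkinField L R Φ b N a‖ ≤ M := by
  let χ : ContDiffBump (0 : EuclideanSpace ℂ (modes d N)) := ⟨ρ, ρ + 1, hρ, by linarith⟩
  have hc : HasCompactSupport fun a => χ a • galerkinField L R Φ b N a :=
    χ.hasCompactSupport.smul_right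
  have hs : ContDiff ℝ 1 fun a => χ a • galerkinField L R Φ b N a :=
    χ.contDiff.smul (contDiff_galerkinField hB hC N)
  obtain ⟨K, hK⟩ := hs.lipschitzWith_of_hasCompactSupport hc one_ne_zero
  obtain ⟨M, hM⟩ := hs.continuous.bounded_above_of_compact_support hc
  refine ⟨χ, K, M.toNNReal, fun a ha => χ.one_of_mem_closedBall ?_, hK, fun a =>
    (hM a).trans (Real.le_coe_toNNReal M)⟩
  simpa using ha

/-! ### Uniqueness and existence -/

theorem IsTraj.hasDerivWithinAt_coeffVec {N : ℕ} {T : ℝ} {f : ℝ → Vel d → ℝ}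
    (h : IsTraj L R Φ b N T f) {t : ℝ} (ht : t ∈ Icc 0 T) :
    HasDerivWithinAt (fun s => coeffVec L N (f s))
      (galerkinField L R Φ b N (coeffVec L N (f t))) (Icc 0 T) t := by
  rw [galerkinField, realize_coeffVec (h.trig t ht)]
  exact FourierGalerkin.hasDerivWithinAt_coeffVec (h.deriv t ht)

/-- The vector field is locally Lipschitz; both trajectories stay in a ball on which the truncated,
globally Lipschitz field agrees with it. -/
theorem IsTraj.unique (hB : KernelAssumptions d L R Φ b) (hC : IsDensityBound d R Φ b C) {N : ℕ}
    {T : ℝ} {f g : ℝ → Vel d → ℝ} (hf : IsTraj L R Φ b N T f) (hg : IsTraj L R Φ b N T g)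
    (h0 : f 0 = g 0) {t : ℝ} (ht : t ∈ Icc 0 T) : g t = f t := by
  obtain ⟨M, hM⟩ := isCompact_Icc.exists_bound_of_continuousOn hf.continuousOn_coeffVec
  obtain ⟨M', hM'⟩ := isCompact_Icc.exists_bound_of_continuousOn hg.continuousOn_coeffVec
  have hρ : 0 < max (max M M') 1 := lt_max_of_lt_right one_pos
  obtain ⟨χ, K, -, hχ, hK, -⟩ := exists_truncation hB hC N hρ
  have key : ∀ {y : ℝ → Vel d → ℝ}, IsTraj L R Φ b N T y →
      (∀ t ∈ Icc 0 T, ‖coeffVec L N (y t)‖ ≤ max (max M M') 1) → ∀ t ∈ Ico 0 T,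
      HasDerivWithinAt (fun s => coeffVec L N (y s))
        (χ (coeffVec L N (y t)) • galerkinField L R Φ b N (coeffVec L N (y t))) (Ici t) t := by
    intro y hy hb t ht
    have ht' := Ico_subset_Icc_self ht
    rw [hχ _ (hb t ht'), one_smul]
    exact hasDerivWithinAt_Ici_of_Icc (hy.hasDerivWithinAt_coeffVec ht') ht
  have := ODE_solution_unique_of_mem_Icc_right
    (v := fun _ a => χ a • galerkinField L R Φ b N a) (s := fun _ => univ) (K := K)
    (fun t _ => hK.lipschitzOnWith) hg.continuousOn_coeffVec
    (key hg fun t ht => (hM' t ht).trans ((le_max_right _ _).trans (le_max_left _ _)))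
    (fun _ _ => trivial) hf.continuousOn_coeffVec
    (key hf fun t ht => (hM t ht).trans ((le_max_left _ _).trans (le_max_left _ _)))
    (fun _ _ => trivial) (by rw [h0]) ht
  dsimp only at this
  rw [← realize_coeffVec (hg.trig t ht), this, realize_coeffVec (hf.trig t ht)]

/-- Solutions of the truncated Galerkin system exist for all times. -/
theorem exists_truncated_traj (hB : KernelAssumptions d L R Φ b) (hC : IsDensityBound d R Φ b C)
    {N : ℕ} {T ρ : ℝ} (hT : 0 ≤ T) (hρ : 0 < ρ) {g : Vel d → ℝ} (hg : IsTrig L (modes d N) g) :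
    ∃ f : ℝ → Vel d → ℝ, f 0 = g ∧ (∀ t ∈ Icc 0 T, IsTrig L (modes d N) (f t)) ∧
      ContinuousOn (fun t => coeffVec L N (f t)) (Icc 0 T) ∧
      ∀ T' ≤ T, (∀ t ∈ Icc 0 T', ‖coeffVec L N (f t)‖ ≤ ρ) → IsTraj L R Φ b N T' f := by
  have hL := L_pos hB
  obtain ⟨χ, K, M, hχ, hK, hM⟩ := exists_truncation hB hC N hρ
  have hPL : IsPicardLindelof (fun _ a => χ a • galerkinField L R Φ b N a)
      (⟨0, le_rfl, hT⟩ : Icc 0 T) (coeffVec L N g) (M * T.toNNReal) 0 M K :=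
    { lipschitzOnWith := fun _ _ => hK.lipschitzOnWith
      continuousOn := fun _ _ => continuousOn_const
      norm_le := fun _ _ a _ => hM a
      mul_max_le := by simp [hT] }
  obtain ⟨a, ha0, ha⟩ := hPL.exists_eq_forall_mem_Icc_hasDerivWithinAt₀
  have ha0' : a 0 = coeffVec L N g := ha0
  have hcoord : ∀ t ∈ Icc 0 T, ∀ k : modes d N, HasDerivWithinAt (fun s => a s k)
      ((χ (a t) : ℂ) * rcoeff L (collision R Φ b (realize L N (a t)) (realize L N (a t))) k)
      (Icc 0 T) t := by
    intro t ht k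
    have := ((EuclideanSpace.proj (𝕜 := ℂ) k).restrictScalars ℝ).hasFDerivAt.comp_hasDerivWithinAt
      t (ha t ht)
    exact this
  -- the sum of the modes stays real, since its derivative is real
  have hreal : ∀ t ∈ Icc 0 T, ∀ v, (realize L N (a t) v : ℂ) =
      ∑ k : modes d N, a t k * fourierMode L (k : Fin d → ℤ) v := by
    intro t ht v
    have hd : ∀ s ∈ Icc 0 T, HasDerivWithinAt
        (fun s => (∑ k : modes d N, a s k * fourierMode L (k : Fin d → ℤ) v).im) 0 (Icc 0 T) s := by
      intro s hs
      have h1 := HasDerivWithinAt.fun_sum (u := Finset.univ) fun (k : modes d N) _ =>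
        (hcoord s hs k).mul_const (fourierMode L (k : Fin d → ℤ) v)
      have h2 := Complex.imCLM.hasFDerivAt.comp_hasDerivWithinAt s h1
      have h3 : (∑ k : modes d N, ((χ (a s) : ℂ) *
          rcoeff L (collision R Φ b (realize L N (a s)) (realize L N (a s))) k) *
            fourierMode L (k : Fin d → ℤ) v) =
          ((χ (a s) * rproj L N (collision R Φ b (realize L N (a s)) (realize L N (a s))) v : ℝ) :
            ℂ) := by
        rw [Complex.ofReal_mul, ofReal_rproj, proj, Finset.mul_sum,
          ← Finset.sum_coe_sort (modes d N)]
        exact Finset.sum_congr rfl fun k _ => by rw [mul_assoc]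
      rw [h3, Complex.imCLM_apply, Complex.ofReal_im] at h2
      exact h2
    have hconst := constant_of_has_deriv_right_zero (fun s hs => (hd s hs).continuousWithinAt)
      (fun s hs => hasDerivWithinAt_Ici_of_Icc (hd s (Ico_subset_Icc_self hs)) hs) t ht
    have h0 : (∑ k : modes d N, a 0 k * fourierMode L (k : Fin d → ℤ) v).im = 0 := by
      have : (g v : ℂ) = ∑ k : modes d N, a 0 k * fourierMode L (k : Fin d → ℤ) v := by
        rw [hg v, ha0', ← Finset.sum_coe_sort (modes d N)]
        rfl
      rw [← this, Complex.ofReal_im]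
    rw [h0] at hconst
    exact Complex.ext (by rw [realize, Complex.ofReal_re]) (by rw [Complex.ofReal_im, hconst])
  have hvec : ∀ t ∈ Icc 0 T, coeffVec L N (realize L N (a t)) = a t := by
    intro t ht
    have h := isTrig_of_sum hL (S := modes d N) (f := realize L N (a t))
      (c := fun k => if h : k ∈ modes d N then a t ⟨k, h⟩ else 0) fun v => by
        rw [hreal t ht v, ← Finset.sum_coe_sort (modes d N)]
        exact Finset.sum_congr rfl fun k _ => by simp
    ext k
    have := h.2 k k.2
    rw [dif_pos k.2] at this
    exact this
  have hcont : ContinuousOn (fun t => coeffVec L N (realize L N (a t))) (Icc 0 T) :=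
    ContinuousOn.congr (fun t ht => (ha t ht).continuousWithinAt) hvec
  refine ⟨fun t => realize L N (a t), ?_, fun t _ => isTrig_realize hL N (a t), hcont, ?_⟩
  · dsimp only
    rw [ha0', realize_coeffVec hg]
  · intro T' hT' hb
    refine ⟨fun t _ => isTrig_realize hL N (a t), fun t ht k hk => ?_⟩
    have htT : t ∈ Icc 0 T := ⟨ht.1, ht.2.trans hT'⟩
    have h1 := (hcoord t htT ⟨k, hk⟩).mono (Icc_subset_Icc_right hT')
    have h2 : χ (a t) = 1 := hχ _ (by rw [← hvec t htT]; exact hb t ht)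
    rw [h2, Complex.ofReal_one, one_mul] at h1
    have h3 : ∀ s ∈ Icc 0 T', rcoeff L (realize L N (a s)) k = a s ⟨k, hk⟩ := fun s hs => by
      conv_rhs => rw [← hvec s ⟨hs.1, hs.2.trans hT'⟩]
      rfl
    exact h1.congr h3 (h3 t ht)

/-- Continuous induction: a strict bound propagates if it follows from the weak bound on the
past. -/
theorem neg_of_bootstrap {T : ℝ} {u : ℝ → ℝ} (hu : ContinuousOn u (Icc 0 T)) (h0 : u 0 ≤ 0)
    (hstep : ∀ t ∈ Icc 0 T, (∀ s ∈ Icc 0 t, u s ≤ 0) → u t < 0) : ∀ t ∈ Icc 0 T, u t < 0 := by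
  by_contra! hcon
  obtain ⟨t₁, ht₁, hut₁⟩ := hcon
  have hcpt : IsCompact (Icc 0 T ∩ u ⁻¹' Ici 0) :=
    isCompact_Icc.of_isClosed_subset (hu.preimage_isClosed_of_isClosed isClosed_Icc isClosed_Ici)
      inter_subset_left
  obtain ⟨t, ⟨ht, hut⟩, hmin⟩ := hcpt.exists_isLeast ⟨t₁, ht₁, hut₁⟩
  have hlt : ∀ s ∈ Icc 0 T, s < t → u s ≤ 0 := by
    intro s hs hst
    by_contra! hus
    exact absurd (hmin ⟨hs, hus.le⟩) (not_le.2 hst)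
  have hut0 : u t ≤ 0 := by
    rcases ht.1.eq_or_lt with h | h
    · rwa [← h]
    · have hc : ContinuousWithinAt u (Ioo 0 t) t :=
        (hu t ht).mono fun s hs => ⟨hs.1.le, hs.2.le.trans ht.2⟩
      refine hc.closure_le (by rw [closure_Ioo h.ne]; exact ⟨h.le, le_rfl⟩)
        continuousWithinAt_const fun s hs => hlt s ⟨hs.1.le, hs.2.le.trans ht.2⟩ hs.2
  have := hstep t ht fun s hs => by
    rcases hs.2.eq_or_lt with h | h
    · rwa [h]
    · exact hlt s ⟨hs.1, hs.2.trans ht.2⟩ h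
  exact absurd hut (not_le.2 this)

/-- Existence on `[0, T]` once the `L¹` bootstrap is available. -/
theorem exists_traj_of_apriori (hB : KernelAssumptions d L R Φ b) (hC : IsDensityBound d R Φ b C)
    {N : ℕ} {T m : ℝ} (hT : 0 ≤ T) {g : Vel d → ℝ} (hg : IsTrig L (modes d N) g)
    (hg1 : lpNorm g 1 (boxMeasure d L) ≤ 2 * m)
    (hstep : ∀ (T' : ℝ) (f : ℝ → Vel d → ℝ), T' ≤ T → IsTraj L R Φ b N T' f → f 0 = g →
      (∀ t ∈ Icc 0 T', lpNorm (f t) 1 (boxMeasure d L) ≤ 2 * m) →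
      ∀ t ∈ Icc 0 T', lpNorm (f t) 1 (boxMeasure d L) < 2 * m) :
    ∃ f : ℝ → Vel d → ℝ, f 0 = g ∧ IsTraj L R Φ b N T f ∧
      ∀ t ∈ Icc 0 T, lpNorm (f t) 1 (boxMeasure d L) ≤ 2 * m := by
  have hL := L_pos hB
  have hC0 := hC.pos
  have hm : 0 ≤ m := by have := lpNorm_nonneg.trans hg1; linarith
  set W : ℝ := Real.exp (T * (2 * C) * (2 * m)) * ‖coeffVec L N g‖ with hW
  have hW0 : 0 ≤ W := by positivity
  obtain ⟨f, hf0, hftrig, hfc, hf⟩ := exists_truncated_traj hB hC hT (by linarith : 0 < W + 1) hg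
  have hWg : ‖coeffVec L N g‖ ≤ W := by
    rw [hW]
    exact le_mul_of_one_le_left (norm_nonneg _) (Real.one_le_exp (by positivity))
  have hcont : ContinuousOn (fun t => max (lpNorm (f t) 1 (boxMeasure d L) - 2 * m)
      (‖coeffVec L N (f t)‖ - (W + 1))) (Icc 0 T) :=
    ((continuousOn_lpNorm_one hL hftrig hfc).sub continuousOn_const).sup
      (hfc.norm.sub continuousOn_const)
  -- both the `L¹` bound and the bound that makes the truncation inactive are bootstrapped
  have hall := neg_of_bootstrap hcont ?_ ?_
  · have h1 : ∀ t ∈ Icc 0 T, ‖coeffVec L N (f t)‖ ≤ W + 1 := fun t ht => by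
      have := (max_lt_iff.1 (hall t ht)).2; linarith
    exact ⟨f, hf0, hf T le_rfl h1, fun t ht => by have := (max_lt_iff.1 (hall t ht)).1; linarith⟩
  · rw [hf0]
    exact max_le (by linarith) (by linarith)
  · intro t ht hs
    have h1 : ∀ s ∈ Icc 0 t, lpNorm (f s) 1 (boxMeasure d L) ≤ 2 * m := fun s hs' => by
      have := (max_le_iff.1 (hs s hs')).1; linarith
    have h2 : ∀ s ∈ Icc 0 t, ‖coeffVec L N (f s)‖ ≤ W + 1 := fun s hs' => by
      have := (max_le_iff.1 (hs s hs')).2; linarith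
    have htraj := hf t ht.2 h2
    have htt : t ∈ Icc 0 t := ⟨ht.1, le_rfl⟩
    refine max_lt (by have := hstep t f ht.2 htraj hf0 h1 t htt; linarith) ?_
    have h3 := htraj.lpNorm_two_le hB hC h1 htt
    rw [hf0, lpNorm_eq_coeffVec hL (hftrig t ht), lpNorm_eq_coeffVec hL hg, mul_left_comm] at h3
    have h4 := le_of_mul_le_mul_left h3 (by positivity)
    have h5 : Real.exp (t * (2 * C) * (2 * m)) * ‖coeffVec L N g‖ ≤ W := by
      rw [hW]
      have := ht.2
      gcongr
    linarith

end

end FourierGalerkin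

theorem mainTheorem1 (d : ℕ) (hd : 2 ≤ d) (L R : ℝ) (Φ b : ℝ → ℝ)
    (hB : FourierGalerkin.KernelAssumptions d L R Φ b) :
    ∃ D₀ : ℝ, 0 < D₀ ∧ FourierGalerkin.IsL2GrowthConstant d L R Φ b D₀ ∧
      ∀ f0 : FourierGalerkin.Vel d → ℝ, (∀ v, 0 ≤ f0 v) →
        MemLp f0 1 (FourierGalerkin.boxMeasure d L) → FourierGalerkin.MemH1Per L f0 →
      ∀ (C : ℝ) (Nc : ℕ) (Nd : ℝ → ℕ) (T : ℝ), 1 < C → 0 < T →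
      ∃ N₀ : ℕ, ∀ fN0 : ℕ → FourierGalerkin.Vel d → ℝ,
        FourierGalerkin.AdmissibleData L f0 C Nc Nd fN0 →
        ∀ N : ℕ, N₀ < N →
          ∃ f : ℝ → FourierGalerkin.Vel d → ℝ,
            FourierGalerkin.IsSolution L R Φ b N (fN0 N) T f ∧
            (∀ g : ℝ → FourierGalerkin.Vel d → ℝ,
              FourierGalerkin.IsSolution L R Φ b N (fN0 N) T g → ∀ t ∈ Icc 0 T, g t = f t) ∧
            ∀ t ∈ Icc 0 T,
              FourierGalerkin.MemTrigPoly L N (f t) ∧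
              lpNorm (f t) 1 (FourierGalerkin.boxMeasure d L) ≤
                2 * lpNorm f0 1 (FourierGalerkin.boxMeasure d L) ∧
              lpNorm (f t) 2 (FourierGalerkin.boxMeasure d L) ≤
                Real.exp (2 * D₀ * lpNorm f0 1 (FourierGalerkin.boxMeasure d L) * T) *
                  lpNorm f0 2 (FourierGalerkin.boxMeasure d L) := by
  open FourierGalerkin in
  obtain ⟨C₀, hC₀⟩ := exists_isDensityBound hd hB
  have hL := L_pos hB
  have hpos := hC₀.pos
  refine ⟨2 * C₀, by positivity, ?_, ?_⟩
  · intro N t₀ M g f _ hg hf hM t ht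
    have := (hf.isTraj hL hg).lpNorm_two_le hB hC₀ hM ht
    rwa [hf.init] at this
  intro f0 hf0 hf0m hf0H C Nc Nd T _ hT
  set m := lpNorm f0 1 (boxMeasure d L) with hm
  -- it suffices to find a solution that obeys the `L¹` bound
  have hfinish : ∀ {N : ℕ} {g : Vel d → ℝ}, IsTrig L (modes d N) g →
      lpNorm g 2 (boxMeasure d L) ≤ lpNorm f0 2 (boxMeasure d L) →
      (∃ f : ℝ → Vel d → ℝ, f 0 = g ∧ IsTraj L R Φ b N T f ∧
        ∀ t ∈ Icc 0 T, lpNorm (f t) 1 (boxMeasure d L) ≤ 2 * m) →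
      ∃ f : ℝ → Vel d → ℝ, IsSolution L R Φ b N g T f ∧
        (∀ g' : ℝ → Vel d → ℝ, IsSolution L R Φ b N g T g' → ∀ t ∈ Icc 0 T, g' t = f t) ∧
        ∀ t ∈ Icc 0 T, MemTrigPoly L N (f t) ∧ lpNorm (f t) 1 (boxMeasure d L) ≤ 2 * m ∧
          lpNorm (f t) 2 (boxMeasure d L) ≤
            Real.exp (2 * (2 * C₀) * m * T) * lpNorm f0 2 (boxMeasure d L) := by
    rintro N g hg hg2 ⟨f, rfl, hf, hf1⟩
    refine ⟨f, hf.isSolution hL, fun g' hg' t ht => ?_, fun t ht =>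
      ⟨(memTrigPoly_iff hL).2 (hf.trig t ht), hf1 t ht, ?_⟩⟩
    · exact hf.unique hB hC₀ (hg'.isTraj hL ((memTrigPoly_iff hL).2 hg)) hg'.init.symm ht
    · refine (hf.lpNorm_two_le hB hC₀ hf1 ht).trans ?_
      have : T * (2 * C₀) * (2 * m) = 2 * (2 * C₀) * m * T := by ring
      rw [this]
      exact mul_le_mul_of_nonneg_left hg2 (Real.exp_pos _).le
  have hmass : ∫ v in box d L, f0 v = m := by
    rw [hm, lpNorm_one_eq_integral_norm hf0m.aestronglyMeasurable]
    exact integral_congr_ae (Filter.Eventually.of_forall fun v =>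
      (Real.norm_of_nonneg (hf0 v)).symm)
  rcases (lpNorm_nonneg : 0 ≤ m).eq_or_lt with hm0 | hm0
  · -- vanishing data: the zero function is the solution
    refine ⟨0, fun fN0 hA N _ => ?_⟩
    have htrig := (memTrigPoly_iff hL).1 (hA.trig N)
    refine hfinish htrig (hA.normL2_le N) ?_
    have h1 : f0 =ᵐ[boxMeasure d L] 0 := (lpNorm_eq_zero hf0m one_ne_zero).1 (hm ▸ hm0.symm)
    have h2 : lpNorm f0 2 (boxMeasure d L) = 0 := by
      rw [lpNorm_congr_ae' h1, lpNorm_zero]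
    have h3 : lpNorm (fN0 N) 2 (boxMeasure d L) = 0 :=
      le_antisymm ((hA.normL2_le N).trans h2.le) lpNorm_nonneg
    have h4 : coeffVec L N (fN0 N) = 0 := by
      rw [lpNorm_eq_coeffVec hL htrig] at h3
      exact norm_eq_zero.1 ((mul_eq_zero.1 h3).resolve_left (by positivity))
    have h5 : fN0 N = 0 := by
      rw [← realize_coeffVec htrig, h4]
      ext v
      simp [realize]
    have h6 : collision R Φ b (0 : Vel d → ℝ) 0 = 0 := by
      ext v
      simp [collision]
    refine ⟨fun _ => fN0 N, rfl, ⟨fun _ _ => htrig, fun t _ k _ => ?_⟩, fun t _ => ?_⟩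
    · simpa [h5, h6, rcoeff, coeff] using hasDerivWithinAt_const t (Icc 0 T) (0 : ℂ)
    · rw [h5, lpNorm_zero]
      linarith
  · obtain ⟨δ, hδ, hVδ, N₁, hN₁⟩ := exists_apriori (A₂ := lpNorm f0 2 (boxMeasure d L))
      (A₃ := normH1 L f0) hB hC₀ hm0 lpNorm_nonneg (Real.sqrt_nonneg _) hT.le
    refine ⟨max N₁ (Nd δ), fun fN0 hA N hN => ?_⟩
    have hN1 : N₁ ≤ N := (le_max_left _ _).trans hN.le
    have hneg := hA.neg_small δ hδ N ((le_max_right _ _).trans_lt hN)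
    have htrig := (memTrigPoly_iff hL).1 (hA.trig N)
    have hmassN := (hA.mass N).trans hmass
    refine hfinish htrig (hA.normL2_le N) ?_
    have hp := htrig.periodicContinuous hL
    refine exists_traj_of_apriori hB hC₀ hT.le htrig ?_ fun T' f hT' hf hf0 h1 =>
      hN₁ N hN1 T' f hT' hf (hf0 ▸ hmassN) (hf0 ▸ hA.normL2_le N) (hf0 ▸ hA.normH1_le N)
        (hf0 ▸ hneg) h1
    have h7 := hp.negPart.lpNorm_one_le hL
    have h8 := mul_le_mul_of_nonneg_left (le_of_lt hneg) (Real.sqrt_nonneg ((2 * L) ^ d))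
    rw [lpNorm_one_eq_add_negPart hp, hmassN]
    have h9 := h7.trans (h8.trans hVδ)
    linarith
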